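/- **Setting.** Let $m_1,m_2,m_3>0$ with $m_1+m_2+m_3=1$; indices are taken modulo 3. An oriented m-triangle is a pair $\Gamma=(X,\mathbf n)$ of a triple $X=(\mathbf a_1,\mathbf a_2,\mathbf a_3)$ of vectors in $\mathbb R^3$ with $\sum m_i\mathbf a_i=0$ and a unit vector $\mathbf n$ perpendicular to all $\mathbf a_i$. The moduli space $\bar M$ is the set of orbits of oriented m-triangles under $SO(3)$. A three-body motion on an open interval $J$ is a curve $\Gamma(t)=(X(t),\mathbf n(t))$ with $\mathbf n$ continuous, without collisions, satisfying $\ddot{\mathbf a}_i=\sum_{j\ne i} m_j r_{ij}^{-3}(\mathbf a_j-\mathbf a_i)$, $r_{ij}=|\mathbf a_i-\mathbf a_j|$. Its moduli curve $\bar\Gamma(t)$ is its image in $\bar M$, and $\mathbf\Omega=\sum m_i\mathbf a_i\times\dot{\mathbf a}_i$ is its (conserved) angular momentum. Put $I_i=m_i|\mathbf a_i|^2$, $I=\sum I_i=\rho^2$, $C_i=-m_iI_i+m_{i+1}I_{i+1}+m_{i+2}I_{i+2}$, and let $\Delta$ be the area of the triangle, positive if $(\mathbf a_1,\mathbf a_2,\mathbf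 n)$ is right-handed and negative if it is left-handed. Spherical coordinates $(\rho,\varphi,\theta)$ of a point $\neq 0$ of $\bar M$ are given by $$\rho>0,\qquad I_i=\tfrac{1-m_i}{2}\,\rho^2\,(1+\sin\varphi\cos\theta_i),\qquad 4\sqrt{m_1m_2m_3}\,\Delta=\rho^2\cos\varphi,$$ where $\theta_1=\theta$, $\theta_2=\theta-\beta_3$, $\theta_3=\theta+\beta_2$ and $\beta_i=\arccos\frac{m_{i+1}m_{i+2}-m_i}{(1-m_{i+1})(1-m_{i+2})}$. The angles $\varphi,\theta$ are any real numbers with these properties, so that they can be chosen $C^2$ along a curve. Then $r_{i+1,i+2}^2=\frac{(1-m_i)I-I_i}{m_{i+1}m_{i+2}}$. The poles are the shapes with $I_i=\frac{1-m_i}{2}I$ for all $i$ (i.e. $\sin\varphi=0$), and the collinear configurations are those with $\cos\varphi=0$. Put $$\lambda_1=\tfrac I2(1-\sin\varphi),\quad \lambda_2=\tfrac I2(1+\sin\varphi),\quad \lambda_3=I.$$ An eigenframe is a positive orthonormal frame $(\mathbf u_1,\mathbf u_2,\mathbf n)$ of eigenvectors of the inertia tensor $B_X(\mathbf u,\mathbf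 v)=\sum m_j(\mathbf u\times\mathbf a_j)\cdot(\mathbf v\times\mathbf a_j)$, with eigenvalues $\lambda_1,\lambda_2,\lambda_3$; at a pole it is moreover required that $\mathbf a_1$ is parallel to $\cos\psi_1\mathbf u_1+\sin\psi_1\mathbf u_2$, where $\psi_i$ is the angle modulo $\pi$ with $\tan\psi_i=\frac{\cos\varphi}{1+\sin\varphi}\tan\frac{\theta_i}2$. The moving frame coordinates of $\mathbf\Omega$ are $g_1=\mathbf\Omega\cdot\mathbf u_1$, $g_2=\mathbf\Omega\cdot\mathbf u_2$, $g_3=\mathbf\Omega\cdot\mathbf n$. The *coupled reduced system* for functions $(\rho,\varphi,\theta,g_1,g_2,g_3)$ of $t$ consists of the $\Omega$-reduced Newton equations $$\ddot I_i=4T_i-\Big(\frac{m_i+2m_{i+1}}{r_{i,i+1}^3}+\frac{m_i+2m_{i+2}}{r_{i,i+2}^3}\Big)I_i-\Big(\frac1{r_{i,i+1}^3}-\frac1{r_{i,i+2}^3}\Big)(m_{i+1}I_{i+1}-m_{i+2}I_{i+2}),\quad i=1,2,3,$$ with $T_i=T_i^\tau+T_i^\eta$, $$T_i^\tau=\tfrac12\omega_i^2I_i+\frac{\dot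 I_i^2}{8I_i},\qquad T_i^\eta=\tfrac12I_i\Big(\frac{g_1}{\lambda_1}\sin\psi_i-\frac{g_2}{\lambda_2}\cos\psi_i\Big)^2,$$ $$\omega_i=\frac{g_3}I+\frac{(C_{i+2}I_{i+2}-C_{i+1}I_{i+1})\frac{\dot I_i}{I_i}-(C_i+2m_{i+1}I_{i+2})\dot I_{i+1}+(C_i+2m_{i+2}I_{i+1})\dot I_{i+2}}{8m_1m_2m_3\,\Delta\, I},$$ and of the Euler equations $$\dot g_1=g_2\Big[\Big(\frac1{\lambda_3}-\frac1{\lambda_2}\Big)g_3-\tfrac12\dot\theta\cos\varphi\Big],\quad \dot g_2=g_1\Big[\Big(\frac1{\lambda_1}-\frac1{\lambda_3}\Big)g_3+\tfrac12\dot\theta\cos\varphi\Big],\quad \dot g_3=g_1g_2\Big(\frac1{\lambda_2}-\frac1{\lambda_1}\Big).$$ **Theorem E2.** Let $J$ be an open interval, $t_0\in J$, and $\mathbf\Omega\in\mathbb R^3$. 1. *(Determination.)* Let $\Gamma,\Gamma'$ be three-body motions on $J$ with angular momentum $\mathbf\Omega$, with the same moduli curve on $J$ and the same initial position $\Gamma(t_0)=\Gamma'(t_0)$,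 which is not collinear. Then $X(t)=X'(t)$ for all $t\in J$, and $\mathbf n(t)=\mathbf n'(t)$ whenever $X(t)$ is not collinear. 2. *(The moduli curve satisfies the reduced equations.)* Let $\Gamma$ be a three-body motion on $J$ with angular momentum $\mathbf\Omega$ which is never collinear on $J$. For any $C^2$ spherical coordinates $(\rho,\varphi,\theta)$ of $\bar\Gamma$ and any continuous eigenframe along $\Gamma$ on $J$, the functions $(\rho,\varphi,\theta)$ and the moving frame coordinates $g_i$ of $\mathbf\Omega$ satisfy the coupled reduced system, and $T_i^\tau$, $T_i^\eta$ are the kinetic energies of the components of $\dot{\mathbf a}_i$ tangential, respectively normal, to the plane of the triangle. Such coordinates and such a frame exist on $J$ if the shape of $\Gamma(t)$ is never a pole. 3. *(Every solution is the moduli curve of a motion.)* Let $\bar\Gamma$ be a curve in $\bar M$ on $J$ with $C^2$ spherical coordinates $(\rho,\varphi,\theta)$, $\cos\varphi\ne0$, which together with functions $g_1,g_2,g_3$ satisfies the coupled reduced system on $J$. Let $\Gamma_0$ be an oriented m-triangle whose class is $\bar\Gamma(t_0)$, with an eigenframe $(\mathbf v_1,\mathbf v_2,\mathbf n_0)$,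 relative to which $\mathbf\Omega$ has coordinates $g_i(t_0)$. Then there is a three-body motion $\Gamma$ on $J$ with $\Gamma(t_0)=\Gamma_0$, angular momentum $\mathbf\Omega$ and moduli curve $\bar\Gamma$, and a continuous eigenframe along $\Gamma$, equal to $(\mathbf v_1,\mathbf v_2,\mathbf n_0)$ at $t_0$, relative to which $\mathbf\Omega$ has coordinates $g_i(t)$ for all $t\in J$. -/

import Mathlib

open scoped Matrix

namespace ThreeBody

noncomputable section

/-! ### Oriented m-triangles and the moduli space -/

/-- Vectors of 3-space. Only the dot product, the cross product and the (norm independent)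
topology of `Fin 3 → ℝ` are used, so lengths are written as `√(v ⬝ᵥ v)`. -/
abbrev Vec := Fin 3 → ℝ

/-- An oriented m-triangle `(X, n)`: position vectors of the three masses in a center of mass
frame, and a unit vector perpendicular to them. Vertices are indexed by `0, 1, 2`, modulo 3. -/
@[ext]
structure OrientedTriangle (m : Fin 3 → ℝ) where
  pos : Fin 3 → Vec
  normal : Vec
  com : ∑ i, m i • pos i = 0
  unit : normal ⬝ᵥ normal = 1
  perp : ∀ i, normal ⬝ᵥ pos i = 0

variable {m : Fin 3 → ℝ}

namespace OrientedTriangle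

/-- The configuration is not collinear (in particular not a single point). -/
def Nondegenerate (Γ : OrientedTriangle m) : Prop :=
  ¬ Collinear ℝ (Set.range Γ.pos)

/-- Individual moment of inertia `I_i = m_i |a_i|²`. -/
def inertia (Γ : OrientedTriangle m) (i : Fin 3) : ℝ :=
  m i * (Γ.pos i ⬝ᵥ Γ.pos i)

/-- Area of the triangle, counted positive iff `(a_1, a_2, n)` is right-handed. -/
def signedArea (Γ : OrientedTriangle m) : ℝ :=
  1 / 2 * (((Γ.pos 1 - Γ.pos 0) ⨯₃ (Γ.pos 2 - Γ.pos 0)) ⬝ᵥ Γ.normal)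

/-- Mutual distance `r_ij`. -/
def dist (Γ : OrientedTriangle m) (i j : Fin 3) : ℝ :=
  √((Γ.pos i - Γ.pos j) ⬝ᵥ (Γ.pos i - Γ.pos j))

/-- The inertia tensor `B_X(u, v) = ∑ m_j (u × a_j) · (v × a_j)`. -/
def inertiaTensor (Γ : OrientedTriangle m) (u v : Vec) : ℝ :=
  ∑ j, m j * ((u ⨯₃ Γ.pos j) ⬝ᵥ (v ⨯₃ Γ.pos j))

/-- Congruence: the two oriented m-triangles lie in the same `SO(3)`-orbit. -/
def Congruent (Γ Γ' : OrientedTriangle m) : Prop :=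
  ∃ R ∈ Matrix.specialOrthogonalGroup (Fin 3) ℝ,
    (∀ i, R *ᵥ Γ.pos i = Γ'.pos i) ∧ R *ᵥ Γ.normal = Γ'.normal

end OrientedTriangle

theorem rot_dot {R : Matrix (Fin 3) (Fin 3) ℝ}
    (hR : R ∈ Matrix.specialOrthogonalGroup (Fin 3) ℝ) (v w : Vec) :
    (R *ᵥ v) ⬝ᵥ (R *ᵥ w) = v ⬝ᵥ w := by
  have h : Rᵀ * R = 1 := by
    have := (Matrix.mem_specialOrthogonalGroup_iff.1 hR).1
    exact (Matrix.mem_orthogonalGroup_iff' (Fin 3) ℝ).1 this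
  rw [Matrix.dotProduct_mulVec, ← Matrix.mulVec_transpose, Matrix.mulVec_mulVec, h,
    Matrix.one_mulVec]

theorem rot_triple {R : Matrix (Fin 3) (Fin 3) ℝ}
    (hR : R ∈ Matrix.specialOrthogonalGroup (Fin 3) ℝ) (u v w : Vec) :
    ((R *ᵥ u) ⨯₃ (R *ᵥ v)) ⬝ᵥ (R *ᵥ w) = (u ⨯₃ v) ⬝ᵥ w := by
  have h : R.det = 1 := (Matrix.mem_specialOrthogonalGroup_iff.1 hR).2
  have key : ((R *ᵥ u) ⨯₃ (R *ᵥ v)) ⬝ᵥ (R *ᵥ w) = R.det * ((u ⨯₃ v) ⬝ᵥ w) := by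
    simp [Matrix.det_fin_three, cross_apply, dotProduct, Matrix.mulVec, Fin.sum_univ_three]
    ring
  rw [key, h, one_mul]

/-- Congruence is an equivalence relation. -/
instance congruence (m : Fin 3 → ℝ) : Setoid (OrientedTriangle m) where
  r := OrientedTriangle.Congruent
  iseqv :=
    { refl := fun Γ => ⟨1, one_mem _, by simp, by simp⟩
      symm := by
        rintro Γ Γ' ⟨R, hR, hp, hn⟩
        have h : Rᵀ * R = 1 :=
          (Matrix.mem_orthogonalGroup_iff' (Fin 3) ℝ).1
            (Matrix.mem_specialOrthogonalGroup_iff.1 hR).1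
        have h' : R * Rᵀ = 1 :=
          (Matrix.mem_orthogonalGroup_iff (Fin 3) ℝ).1
            (Matrix.mem_specialOrthogonalGroup_iff.1 hR).1
        refine ⟨Rᵀ, ?_, ?_, ?_⟩
        · refine Matrix.mem_specialOrthogonalGroup_iff.2 ⟨?_, ?_⟩
          · rw [Matrix.mem_orthogonalGroup_iff]
            simpa using h
          · rw [Matrix.det_transpose]
            exact (Matrix.mem_specialOrthogonalGroup_iff.1 hR).2
        · intro i
          rw [← hp i, Matrix.mulVec_mulVec, h, Matrix.one_mulVec]
        · rw [← hn, Matrix.mulVec_mulVec, h, Matrix.one_mulVec]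
      trans := by
        rintro Γ Γ' Γ'' ⟨R, hR, hp, hn⟩ ⟨S, hS, hp', hn'⟩
        refine ⟨S * R, mul_mem hS hR, ?_, ?_⟩
        · intro i
          rw [← Matrix.mulVec_mulVec, hp, hp']
        · rw [← Matrix.mulVec_mulVec, hn, hn'] }

/-- The (congruence) moduli space: the orbit space of oriented m-triangles under `SO(3)`. -/
def ModuliSpace (m : Fin 3 → ℝ) : Type := Quotient (congruence m)

/-- The orbit map. -/
def OrientedTriangle.moduli (Γ : OrientedTriangle m) : ModuliSpace m :=
  Quotient.mk (congruence m) Γ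

namespace ModuliSpace

/-- Individual moments of inertia, as functions on the moduli space. -/
def inertia (δ : ModuliSpace m) (i : Fin 3) : ℝ :=
  Quotient.lift (fun Γ : OrientedTriangle m => Γ.inertia i) (by
    rintro Γ Γ' ⟨R, hR, hp, -⟩
    simp only [OrientedTriangle.inertia]
    rw [← hp i, rot_dot hR]) δ

/-- Signed area, as a function on the moduli space. -/
def signedArea (δ : ModuliSpace m) : ℝ :=
  Quotient.lift (fun Γ : OrientedTriangle m => Γ.signedArea) (by
    rintro Γ Γ' ⟨R, hR, hp, hn⟩
    simp only [OrientedTriangle.signedArea]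
    rw [← hp 0, ← hp 1, ← hp 2, ← hn, ← Matrix.mulVec_sub, ← Matrix.mulVec_sub,
      rot_triple hR]) δ

/-- The shape is one of the two poles: each individual moment of inertia is
`I_i = (1 - m_i) / 2 * I`. -/
def IsPole (δ : ModuliSpace m) : Prop :=
  ∀ i, δ.inertia i = (1 - m i) / 2 * ∑ j, δ.inertia j

end ModuliSpace

/-! ### Three-body motions -/

/-- Velocity of the `i`-th mass. -/
def vel (Γ : ℝ → OrientedTriangle m) (i : Fin 3) (t : ℝ) : Vec :=
  deriv (fun s => (Γ s).pos i) t

/-- `Γ` is a (collision free) solution of Newton's equations on the open set `J` of times, with a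
continuous choice of the normal vector. -/
structure IsThreeBodyMotion (Γ : ℝ → OrientedTriangle m) (J : Set ℝ) : Prop where
  normal_continuousOn : ContinuousOn (fun t => (Γ t).normal) J
  noncollision : ∀ t ∈ J, Function.Injective (Γ t).pos
  differentiable : ∀ t ∈ J, ∀ i, DifferentiableAt ℝ (fun s => (Γ s).pos i) t
  newton : ∀ t ∈ J, ∀ i, HasDerivAt (vel Γ i)
    (∑ j ∈ Finset.univ.erase i, (m j / (Γ t).dist i j ^ 3) • ((Γ t).pos j - (Γ t).pos i)) t

/-- Total angular momentum `∑ m_i a_i × ȧ_i`. -/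
def angularMomentum (Γ : ℝ → OrientedTriangle m) (t : ℝ) : Vec :=
  ∑ i, m i • ((Γ t).pos i ⨯₃ vel Γ i t)

/-! ### Spherical coordinates on the moduli space -/

/-- Values of the coordinates `(ρ, φ, θ)`: size `ρ`, colatitude `φ` and longitude `θ`.
The angles are arbitrary reals, so that they can vary smoothly along a curve. -/
structure Coord where
  ρ : ℝ
  φ : ℝ
  θ : ℝ

/-- The angle `β_i` between the longitudes of the binary collision points `b_{i,i+1}` and
`b_{i,i+2}`. -/
def betaAngle (m : Fin 3 → ℝ) (i : Fin 3) : ℝ :=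
  Real.arccos ((m (i + 1) * m (i + 2) - m i) / ((1 - m (i + 1)) * (1 - m (i + 2))))

/-- Longitude of the binary collision point `b_{i+1,i+2}`; the zero meridian passes through the
collision point of the last two masses, and longitude increases towards the collision point of the
last and the first mass. -/
def collisionLongitude (m : Fin 3 → ℝ) : Fin 3 → ℝ :=
  ![0, betaAngle m 2, -betaAngle m 1]

namespace Coord

/-- Longitude measured from the binary collision point `b_{i+1,i+2}`. -/
def relLongitude (m : Fin 3 → ℝ) (p : Coord) (i : Fin 3) : ℝ :=
  p.θ - collisionLongitude m i

/-- `I_i` as a function of the coordinates. -/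
def inertia (m : Fin 3 → ℝ) (p : Coord) (i : Fin 3) : ℝ :=
  (1 - m i) / 2 * p.ρ ^ 2 * (1 + Real.sin p.φ * Real.cos (p.relLongitude m i))

/-- Signed area as a function of the coordinates. -/
def signedArea (m : Fin 3 → ℝ) (p : Coord) : ℝ :=
  p.ρ ^ 2 * Real.cos p.φ / (4 * √(m 0 * m 1 * m 2))

/-- `C_i = - m_i I_i + m_{i+1} I_{i+1} + m_{i+2} I_{i+2}`. -/
def cevaC (m : Fin 3 → ℝ) (p : Coord) (i : Fin 3) : ℝ :=
  -(m i * p.inertia m i) + m (i + 1) * p.inertia m (i + 1) + m (i + 2) * p.inertia m (i + 2)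

/-- The side `s_i = r_{i+1,i+2}` opposite to the `i`-th vertex. -/
def side (m : Fin 3 → ℝ) (p : Coord) (i : Fin 3) : ℝ :=
  √(((1 - m i) * p.ρ ^ 2 - p.inertia m i) / (m (i + 1) * m (i + 2)))

/-- Eigenvalues of the inertia tensor as functions of the coordinates. -/
def eigenvalue (p : Coord) : Fin 3 → ℝ :=
  ![p.ρ ^ 2 / 2 * (1 - Real.sin p.φ), p.ρ ^ 2 / 2 * (1 + Real.sin p.φ), p.ρ ^ 2]

/-- The angle `ψ_i` from `u_1` to `a_i` (modulo `π`), determined by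
`tan ψ_i = cos φ / (1 + sin φ) * tan (θ_i / 2)`, with `θ_i` the longitude measured from
`b_{i+1,i+2}`. -/
def frameAngle (m : Fin 3 → ℝ) (p : Coord) (i : Fin 3) : ℝ :=
  Complex.arg ⟨(1 + Real.sin p.φ) * Real.cos (p.relLongitude m i / 2),
    Real.cos p.φ * Real.sin (p.relLongitude m i / 2)⟩

end Coord

/-- `p` is a triple of spherical coordinates of the point `δ ≠ 0` of the moduli space. -/
structure IsCoord (δ : ModuliSpace m) (p : Coord) : Prop where
  pos : 0 < p.ρ
  inertia : ∀ i, δ.inertia i = p.inertia m i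
  area : δ.signedArea = p.signedArea m

/-- `γ` is a twice continuously differentiable description in spherical coordinates, on `J`, of the
curve `δ` in the moduli space. -/
structure IsCoordCurve (δ : ℝ → ModuliSpace m) (γ : ℝ → Coord) (J : Set ℝ) : Prop where
  contDiffOn_ρ : ContDiffOn ℝ 2 (fun t => (γ t).ρ) J
  contDiffOn_φ : ContDiffOn ℝ 2 (fun t => (γ t).φ) J
  contDiffOn_θ : ContDiffOn ℝ 2 (fun t => (γ t).θ) J
  isCoord : ∀ t ∈ J, IsCoord (δ t) (γ t)

/-! ### Eigenframes -/

/-- `(u₁, u₂, n)` is a positive orthonormal frame of eigenvectors of the inertia tensor, with the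
eigenvalues in the order prescribed by the coordinates `p`. At a pole of the shape sphere, where all
orthonormal frames of the plane of the triangle are eigenframes and where the longitude is
arbitrary, `u₁` is moreover required to make the angle prescribed by `p` with `a_1`. -/
structure IsEigenframe (Γ : OrientedTriangle m) (p : Coord) (u₁ u₂ : Vec) : Prop where
  unit₁ : u₁ ⬝ᵥ u₁ = 1
  unit₂ : u₂ ⬝ᵥ u₂ = 1
  orthogonal : u₁ ⬝ᵥ u₂ = 0
  positive : u₁ ⨯₃ u₂ = Γ.normal
  eigen₁ : Γ.inertiaTensor u₁ u₁ = p.eigenvalue 0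
  eigen₂ : Γ.inertiaTensor u₂ u₂ = p.eigenvalue 1
  eigen₁₂ : Γ.inertiaTensor u₁ u₂ = 0
  pole : Real.sin p.φ = 0 →
    (Γ.pos 0 ⬝ᵥ u₁) * Real.sin (p.frameAngle m 0) = (Γ.pos 0 ⬝ᵥ u₂) * Real.cos (p.frameAngle m 0)

/-- A continuous moving eigenframe along `Γ`. -/
structure IsMovingEigenframe (Γ : ℝ → OrientedTriangle m) (γ : ℝ → Coord) (u₁ u₂ : ℝ → Vec)
    (J : Set ℝ) : Prop where
  continuousOn₁ : ContinuousOn u₁ J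
  continuousOn₂ : ContinuousOn u₂ J
  isEigenframe : ∀ t ∈ J, IsEigenframe (Γ t) (γ t) (u₁ t) (u₂ t)

/-- The coordinate vector `(g_1, g_2, g_3)` of `Ω` relative to the frame `(u₁, u₂, n)`. -/
def frameCoords (Ω u₁ u₂ n : Vec) : Fin 3 → ℝ := ![Ω ⬝ᵥ u₁, Ω ⬝ᵥ u₂, Ω ⬝ᵥ n]

/-! ### The reduced equations -/

/-- Time derivative of `I_i` along a curve of coordinates. -/
def inertiaDot (m : Fin 3 → ℝ) (γ : ℝ → Coord) (i : Fin 3) (t : ℝ) : ℝ :=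
  deriv (fun s => (γ s).inertia m i) t

/-- The angular velocity `ω_i⁰`, a differential expression at the level of the moduli space. -/
def omegaZero (m : Fin 3 → ℝ) (γ : ℝ → Coord) (i : Fin 3) (t : ℝ) : ℝ :=
  1 / (8 * (m 0 * m 1 * m 2) * (γ t).signedArea m * (γ t).ρ ^ 2) *
    (((γ t).cevaC m (i + 2) * (γ t).inertia m (i + 2)
        - (γ t).cevaC m (i + 1) * (γ t).inertia m (i + 1))
          * (inertiaDot m γ i t / (γ t).inertia m i)
      - ((γ t).cevaC m i + 2 * m (i + 1) * (γ t).inertia m (i + 2)) * inertiaDot m γ (i + 1) t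
      + ((γ t).cevaC m i + 2 * m (i + 2) * (γ t).inertia m (i + 1)) * inertiaDot m γ (i + 2) t)

/-- The tangential angular velocity `ω_i = ω_i⁰ + g_3 / I`. -/
def omega (m : Fin 3 → ℝ) (γ : ℝ → Coord) (g : ℝ → Fin 3 → ℝ) (i : Fin 3) (t : ℝ) : ℝ :=
  omegaZero m γ i t + g t 2 / (γ t).ρ ^ 2

/-- The tangential kinetic energy term `T_i^τ = ω_i² I_i / 2 + İ_i² / (8 I_i)`. -/
def kinTangential (m : Fin 3 → ℝ) (γ : ℝ → Coord) (g : ℝ → Fin 3 → ℝ) (i : Fin 3) (t : ℝ) : ℝ :=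
  1 / 2 * omega m γ g i t ^ 2 * (γ t).inertia m i
    + inertiaDot m γ i t ^ 2 / (8 * (γ t).inertia m i)

/-- The normal kinetic energy term
`T_i^η = I_i / 2 * (g_1 / λ_1 * sin ψ_i - g_2 / λ_2 * cos ψ_i)²`. -/
def kinNormal (m : Fin 3 → ℝ) (γ : ℝ → Coord) (g : ℝ → Fin 3 → ℝ) (i : Fin 3) (t : ℝ) : ℝ :=
  1 / 2 * (γ t).inertia m i *
    (g t 0 / (γ t).eigenvalue 0 * Real.sin ((γ t).frameAngle m i)
      - g t 1 / (γ t).eigenvalue 1 * Real.cos ((γ t).frameAngle m i)) ^ 2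

/-- The `Ω`-reduced Newton equations for the curve `γ` of coordinates, with kinetic energy terms
`T_i = T_i^τ + T_i^η` depending on `g`, on the set `J` of times. -/
def ReducedNewton (m : Fin 3 → ℝ) (γ : ℝ → Coord) (g : ℝ → Fin 3 → ℝ) (J : Set ℝ) : Prop :=
  ∀ t ∈ J, ∀ i : Fin 3,
    deriv (inertiaDot m γ i) t =
      4 * (kinTangential m γ g i t + kinNormal m γ g i t)
      - ((m i + 2 * m (i + 1)) / (γ t).side m (i + 2) ^ 3
          + (m i + 2 * m (i + 2)) / (γ t).side m (i + 1) ^ 3) * (γ t).inertia m i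
      - (1 / (γ t).side m (i + 2) ^ 3 - 1 / (γ t).side m (i + 1) ^ 3)
          * (m (i + 1) * (γ t).inertia m (i + 1) - m (i + 2) * (γ t).inertia m (i + 2))

/-- The rate `- θ̇ cos φ / 2` at which the eigenframe rotates in the plane of the triangle, in a
motion with the given moduli curve and without angular momentum. -/
def frameRate (γ : ℝ → Coord) (t : ℝ) : ℝ :=
  -(1 / 2 * deriv (fun s => (γ s).θ) t * Real.cos (γ t).φ)

/-- The Euler equations for the components of the angular momentum in the moving eigenframe. -/
structure EulerEquations (γ : ℝ → Coord) (g : ℝ → Fin 3 → ℝ) (J : Set ℝ) : Prop where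
  euler₁ : ∀ t ∈ J, HasDerivAt (fun s => g s 0)
    (g t 1 * ((1 / (γ t).eigenvalue 2 - 1 / (γ t).eigenvalue 1) * g t 2 + frameRate γ t)) t
  euler₂ : ∀ t ∈ J, HasDerivAt (fun s => g s 1)
    (g t 0 * ((1 / (γ t).eigenvalue 0 - 1 / (γ t).eigenvalue 2) * g t 2 - frameRate γ t)) t
  euler₃ : ∀ t ∈ J, HasDerivAt (fun s => g s 2)
    (g t 0 * g t 1 * (1 / (γ t).eigenvalue 1 - 1 / (γ t).eigenvalue 0)) t

end

end ThreeBody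

/-! The proof separates the shape of the triangle from its position in space. A triangle with
coordinates $(\rho,\varphi,\theta)$, $\cos\varphi\ne0$, has a normal form in its plane. Take a
reference triangle whose planar inertia tensor is the identity, rotate it by $\theta/2$, and stretch
the axes by $\rho\cos\alpha$ and $-\rho\sin\alpha$, where $\alpha=\varphi/2-\pi/4$ (`Coord.planarX`,
`Coord.planarY`). Every such triangle is this planar one laid along an orthonormal frame
(`OrientedTriangle.exists_realizes`), and an eigenframe is this frame up to one common sign
(`OrientedTriangle.exists_sign_realizes`). The sign is constant along a curve, and the coupled
system is invariant under it.

A motion is therefore a coordinate curve together with a rotating frame. The angular momentum is an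
invertible affine function of the angular velocity of the frame (`IsCoordCurve.sum_cross_velocity`),
so prescribing it turns the kinematics into the linear-looking system `FrameEquations`. Given those,
the Euler equations express that $\Omega$ is constant in space. The reduced Newton equations express
$\ddot I_i=4T_i+2m_i\,\mathbf a_i\cdot\ddot{\mathbf a}_i$, where $T_i$ is read off from the velocity
in the frame and $\mathbf a_i\cdot\ddot{\mathbf a}_i$ depends only on mutual distances. That
$\omega_i$ is the correct tangential rotation rate rests on `planar_omega_identity`.

One rigidity statement, `OrientedTriangle.eq_zero_of_sum_cross_eq_zero`, carries both the uniqueness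
and the converse: vectors $d_i$ with $\sum m_id_i=0$, $\sum m_i\mathbf a_i\times d_i=0$ and $\mathbf
a_i\cdot d_i=0$ vanish. Applied to a difference of velocities it shows that the moduli curve, the
position and $\Omega$ fix the initial velocity, after which uniqueness for Newton's equations
applies. Applied to acceleration minus force it shows that a curve built from a solution of the
coupled system obeys Newton's equations: conservation of the centre of mass, conservation of
$\Omega$ and the reduced equations are exactly its three hypotheses. Such a curve is built by
solving the frame equations on all of $J$ (`exists_rotating_frame`).

Coordinates along a motion come from the Jacobi vectors: their inner products, with the signed area,
give Cartesian coordinates on the moduli space, and away from the poles these can be written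
smoothly in spherical form. -/

namespace ThreeBody

open Set Filter Topology

section

/-! ### Positive orthonormal frames -/

theorem dot_eq (u v : Vec) : u ⬝ᵥ v = u 0 * v 0 + u 1 * v 1 + u 2 * v 2 := by
  simp [dotProduct, Fin.sum_univ_three]

theorem cross_zero (u v : Vec) : (u ⨯₃ v) 0 = u 1 * v 2 - u 2 * v 1 := by simp [cross_apply]

theorem cross_one (u v : Vec) : (u ⨯₃ v) 1 = u 2 * v 0 - u 0 * v 2 := by simp [cross_apply]

theorem cross_two (u v : Vec) : (u ⨯₃ v) 2 = u 0 * v 1 - u 1 * v 0 := by simp [cross_apply]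

theorem vec_ext {u v : Vec} (h₀ : u 0 = v 0) (h₁ : u 1 = v 1) (h₂ : u 2 = v 2) : u = v := by
  ext i
  fin_cases i <;> assumption

/-- Two orthonormal vectors; together with their cross product they form a positive orthonormal
frame. -/
structure IsFrame (u v : Vec) : Prop where
  unit₁ : u ⬝ᵥ u = 1
  unit₂ : v ⬝ᵥ v = 1
  orthogonal : u ⬝ᵥ v = 0

namespace IsFrame

variable {u v : Vec}

theorem dot_normal₁ : u ⬝ᵥ (u ⨯₃ v) = 0 := dot_self_cross u v

theorem dot_normal₂ : v ⬝ᵥ (u ⨯₃ v) = 0 := dot_cross_self u v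

theorem unit_normal (h : IsFrame u v) : (u ⨯₃ v) ⬝ᵥ (u ⨯₃ v) = 1 := by
  rw [cross_dot_cross, h.unit₁, h.unit₂, h.orthogonal]; ring

theorem cross_normal₂ (h : IsFrame u v) : v ⨯₃ (u ⨯₃ v) = u := by
  rw [cross_cross_eq_smul_sub_smul', h.unit₂, h.orthogonal]; simp

theorem cross_normal₁ (h : IsFrame u v) : u ⨯₃ (u ⨯₃ v) = -v := by
  rw [cross_cross_eq_smul_sub_smul', h.unit₁, h.orthogonal]; simp

/-- Cramer's rule in space expresses $\det(u,v,n)\,w$ through $u,v,n$. For $n=u\times v$ the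
determinant is 1 and the coefficients become inner products. -/
theorem expand (h : IsFrame u v) (w : Vec) :
    w = (w ⬝ᵥ u) • u + (w ⬝ᵥ v) • v + (w ⬝ᵥ (u ⨯₃ v)) • (u ⨯₃ v) := by
  have key : ∀ n : Vec, ((u ⨯₃ v) ⬝ᵥ n) • w =
      (w ⬝ᵥ (v ⨯₃ n)) • u - (w ⬝ᵥ (u ⨯₃ n)) • v + (w ⬝ᵥ (u ⨯₃ v)) • n := by
    intro n
    apply vec_ext <;>
    · simp only [dot_eq, cross_zero, cross_one, cross_two, Pi.add_apply, Pi.sub_apply,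
        Pi.smul_apply, smul_eq_mul]
      ring
  have := key (u ⨯₃ v)
  rw [h.unit_normal, h.cross_normal₁, h.cross_normal₂, one_smul] at this
  simpa using this

theorem abs_le_one (h : IsFrame u v) (i : Fin 3) : |u i| ≤ 1 ∧ |v i| ≤ 1 := by
  have h₁ := h.unit₁
  have h₂ := h.unit₂
  rw [dot_eq] at h₁ h₂
  constructor <;> rw [abs_le_one_iff_mul_self_le_one] <;> fin_cases i <;>
    simp <;> nlinarith [sq_nonneg (u 0), sq_nonneg (u 1), sq_nonneg (u 2), sq_nonneg (v 0),
      sq_nonneg (v 1), sq_nonneg (v 2)]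

end IsFrame

/-! ### Global solutions of differential equations -/

/-- A time dependent vector field on an open interval which is bounded and Lipschitz, uniformly on
compact intervals of time, has solutions on the whole interval. -/
theorem exists_hasDerivAt_of_lipschitz_bounded {E : Type*} [NormedAddCommGroup E] [NormedSpace ℝ E]
    [CompleteSpace E] {J : Set ℝ} (hJ : IsOpen J) (hJ' : J.OrdConnected) {t₀ : ℝ} (ht₀ : t₀ ∈ J)
    (v : ℝ → E → E) (hv : ∀ x, ContinuousOn (v · x) J)
    (hb : ∀ a b, Icc a b ⊆ J → ∃ K L : NNReal, ∀ t ∈ Icc a b,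
      LipschitzWith K (v t) ∧ ∀ x, ‖v t x‖ ≤ L) (x₀ : E) :
    ∃ α : ℝ → E, α t₀ = x₀ ∧ ∀ t ∈ J, HasDerivAt α (v t (α t)) t := by
  have hI : ∀ t ∈ J, ∃ a b, t ∈ Ioo a b ∧ t₀ ∈ Ioo a b ∧ Icc a b ⊆ J := by
    intro t ht
    have hmin : min t t₀ ∈ J := by rcases min_choice t t₀ with h | h <;> rwa [h]
    have hmax : max t t₀ ∈ J := by rcases max_choice t t₀ with h | h <;> rwa [h]
    obtain ⟨ε, hε, h₁⟩ := Metric.isOpen_iff.1 hJ _ hmin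
    obtain ⟨ε', hε', h₂⟩ := Metric.isOpen_iff.1 hJ _ hmax
    have ha : min t t₀ - ε / 2 ∈ J := h₁ (by simp [abs_of_pos hε]; linarith)
    have hb : max t t₀ + ε' / 2 ∈ J := h₂ (by simp [abs_of_pos hε']; linarith)
    have := min_le_left t t₀
    have := min_le_right t t₀
    have := le_max_left t t₀
    have := le_max_right t t₀
    exact ⟨_, _, ⟨by linarith, by linarith⟩, ⟨by linarith, by linarith⟩, hJ'.out ha hb⟩
  have hS : ∀ a b, t₀ ∈ Ioo a b → Icc a b ⊆ J →
      ∃ α : ℝ → E, α t₀ = x₀ ∧ ∀ t ∈ Ioo a b, HasDerivAt α (v t (α t)) t := by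
    intro a b h₀ hab
    obtain ⟨K, L, h⟩ := hb a b hab
    -- A field bounded by `L` cannot move a point further than `L` times the elapsed time. As the
    -- bounds hold on the whole space, a ball of that radius may be taken, and no smallness of the
    -- time interval is needed.
    have hp : IsPicardLindelof v (tmin := a) (tmax := b) ⟨t₀, Ioo_subset_Icc_self h₀⟩ x₀
        (L * Real.toNNReal (max (b - t₀) (t₀ - a))) 0 L K :=
      { lipschitzOnWith := fun t ht => (h t ht).1.lipschitzOnWith
        continuousOn := fun x _ => (hv x).mono hab
        norm_le := fun t ht x _ => (h t ht).2 x
        mul_max_le := by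
          have : 0 ≤ max (b - t₀) (t₀ - a) := le_max_of_le_left (by linarith [h₀.2])
          simp [Real.coe_toNNReal _ this] }
    obtain ⟨α, hα₀, hα⟩ := hp.exists_eq_forall_mem_Icc_hasDerivWithinAt₀
    exact ⟨α, hα₀, fun t ht =>
      (hα t (Ioo_subset_Icc_self ht)).hasDerivAt (Icc_mem_nhds ht.1 ht.2)⟩
  choose! a b hab using hI
  have hS' : ∀ t ∈ J, ∃ α : ℝ → E, α t₀ = x₀ ∧
      ∀ s ∈ Ioo (a t) (b t), HasDerivAt α (v s (α s)) s :=
    fun t ht => hS _ _ (hab t ht).2.1 (hab t ht).2.2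
  choose! α hα using hS'
  have huniq : ∀ t ∈ J, ∀ s ∈ Ioo (a t) (b t), α s s = α t s := by
    intro t ht s hs
    have hsJ : s ∈ J := (hab t ht).2.2 (Ioo_subset_Icc_self hs)
    obtain ⟨K, L, h⟩ := hb (a t) (b t) (hab t ht).2.2
    have hsub₁ : Ioo (max (a s) (a t)) (min (b s) (b t)) ⊆ Ioo (a s) (b s) :=
      Ioo_subset_Ioo (le_max_left _ _) (min_le_left _ _)
    have hsub₂ : Ioo (max (a s) (a t)) (min (b s) (b t)) ⊆ Ioo (a t) (b t) :=
      Ioo_subset_Ioo (le_max_right _ _) (min_le_right _ _)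
    refine ODE_solution_unique_of_mem_Ioo (v := v) (s := fun _ => univ) (K := K) (t₀ := t₀)
      (fun r hr => (h r (Ioo_subset_Icc_self (hsub₂ hr))).1.lipschitzOnWith) ?_
      (fun r hr => ⟨(hα s hsJ).2 r (hsub₁ hr), mem_univ _⟩)
      (fun r hr => ⟨(hα t ht).2 r (hsub₂ hr), mem_univ _⟩)
      ((hα s hsJ).1.trans (hα t ht).1.symm) ?_
    · exact ⟨max_lt (hab s hsJ).2.1.1 (hab t ht).2.1.1, lt_min (hab s hsJ).2.1.2 (hab t ht).2.1.2⟩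
    · exact ⟨max_lt (hab s hsJ).1.1 hs.1, lt_min (hab s hsJ).1.2 hs.2⟩
  -- The local solutions all pass through `x₀` at `t₀`, so they agree on overlaps and the diagonal
  -- glues them.
  refine ⟨fun t => α t t, (hα t₀ ht₀).1, fun t ht => ?_⟩
  refine ((hα t ht).2 t (hab t ht).1).congr_of_eventuallyEq ?_
  filter_upwards [Ioo_mem_nhds (hab t ht).1.1 (hab t ht).1.2] with s hs
  exact huniq t ht s hs

/-- Compactly supported $C^1$ fields are bounded and Lipschitz, and continuous coefficients are
bounded on compact time intervals, so the sum satisfies the uniform bounds needed for a solution on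
all of $J$. -/
theorem exists_hasDerivAt_sum_smul {E ι : Type*} [NormedAddCommGroup E] [NormedSpace ℝ E]
    [CompleteSpace E] [Fintype ι] {J : Set ℝ} (hJ : IsOpen J) (hJ' : J.OrdConnected) {t₀ : ℝ}
    (ht₀ : t₀ ∈ J) {c : ι → ℝ → ℝ} (hc : ∀ i, ContinuousOn (c i) J) {G : ι → E → E}
    (hG : ∀ i, ContDiff ℝ 1 (G i)) (hG' : ∀ i, HasCompactSupport (G i)) (x₀ : E) :
    ∃ α : ℝ → E, α t₀ = x₀ ∧ ∀ t ∈ J, HasDerivAt α (∑ i, c i t • G i (α t)) t := by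
  refine exists_hasDerivAt_of_lipschitz_bounded hJ hJ' ht₀ (fun t x => ∑ i, c i t • G i x) ?_ ?_ x₀
  · intro x
    exact continuousOn_finsetSum _ fun i _ => (hc i).smul continuousOn_const
  · intro a b hab
    choose C hC using fun i => isCompact_Icc.exists_bound_of_continuousOn ((hc i).mono hab)
    choose K hK using fun i =>
      (hG i).lipschitzWith_of_hasCompactSupport (hG' i) one_ne_zero
    choose L hL using fun i => (hG' i).exists_bound_of_continuous (hG i).continuous
    refine ⟨∑ i, (C i).toNNReal * K i, ∑ i, (C i).toNNReal * (L i).toNNReal, fun t ht => ⟨?_, ?_⟩⟩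
    · rw [lipschitzWith_iff_norm_sub_le]
      intro x y
      rw [← Finset.sum_sub_distrib, NNReal.coe_sum, Finset.sum_mul]
      refine (norm_sum_le _ _).trans (Finset.sum_le_sum fun i _ => ?_)
      rw [← smul_sub, norm_smul, NNReal.coe_mul, mul_assoc]
      exact mul_le_mul ((hC i t ht).trans (Real.le_coe_toNNReal _))
        (lipschitzWith_iff_norm_sub_le.1 (hK i) x y) (norm_nonneg _) (NNReal.coe_nonneg _)
    · intro x
      rw [NNReal.coe_sum]
      refine (norm_sum_le _ _).trans (Finset.sum_le_sum fun i _ => ?_)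
      rw [norm_smul, NNReal.coe_mul]
      exact mul_le_mul ((hC i t ht).trans (Real.le_coe_toNNReal _))
        ((hL i x).trans (Real.le_coe_toNNReal _)) (norm_nonneg _) (NNReal.coe_nonneg _)

theorem _root_.HasDerivAt.dotProduct {f g : ℝ → Vec} {f' g' : Vec} {t : ℝ} (hf : HasDerivAt f f' t)
    (hg : HasDerivAt g g' t) :
    HasDerivAt (fun s => f s ⬝ᵥ g s) (f' ⬝ᵥ g t + f t ⬝ᵥ g') t := by
  rw [hasDerivAt_pi] at hf hg
  simp only [dot_eq]
  refine ((((hf 0).fun_mul (hg 0)).fun_add ((hf 1).fun_mul (hg 1))).fun_add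
    ((hf 2).fun_mul (hg 2))).congr_deriv ?_
  ring

theorem _root_.HasDerivAt.crossProduct {f g : ℝ → Vec} {f' g' : Vec} {t : ℝ} (hf : HasDerivAt f f' t)
    (hg : HasDerivAt g g' t) :
    HasDerivAt (fun s => f s ⨯₃ g s) (f' ⨯₃ g t + f t ⨯₃ g') t := by
  rw [hasDerivAt_pi] at hf hg ⊢
  simp only [Fin.forall_fin_succ, IsEmpty.forall_iff, and_true, Fin.succ_zero_eq_one,
    Fin.succ_one_eq_two, cross_zero, cross_one, cross_two, Pi.add_apply]
  refine ⟨?_, ?_, ?_⟩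
  · refine (((hf 1).fun_mul (hg 2)).fun_sub ((hf 2).fun_mul (hg 1))).congr_deriv ?_
    ring
  · refine (((hf 2).fun_mul (hg 0)).fun_sub ((hf 0).fun_mul (hg 2))).congr_deriv ?_
    ring
  · refine (((hf 0).fun_mul (hg 1)).fun_sub ((hf 1).fun_mul (hg 0))).congr_deriv ?_
    ring

theorem eq_of_hasDerivAt_zero {E : Type*} [NormedAddCommGroup E] [NormedSpace ℝ E] {J : Set ℝ}
    (hJ : IsOpen J) (hJ' : J.OrdConnected) {f : ℝ → E} (hf : ∀ t ∈ J, HasDerivAt f 0 t) {s t : ℝ}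
    (hs : s ∈ J) (ht : t ∈ J) : f s = f t :=
  let ⟨_, hc⟩ := hJ.exists_is_const_of_deriv_eq_zero hJ'.isPreconnected
    (fun x hx => (hf x hx).differentiableAt.differentiableWithinAt)
    (fun x hx => (hf x hx).deriv)
  (hc s hs).trans (hc t ht).symm

theorem contDiff_crossProduct : ContDiff ℝ 1 (fun z : Vec × Vec => z.1 ⨯₃ z.2) := by
  rw [contDiff_pi]
  intro i
  fin_cases i <;> simp only [cross_apply] <;> simp <;> fun_prop

/-- The frame equation: a positive orthonormal frame rotating with given angular velocity, whose
coordinates relative to the frame are `(a, b, κ)`. -/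
theorem exists_rotating_frame {J : Set ℝ} (hJ : IsOpen J) (hJ' : J.OrdConnected) {t₀ : ℝ}
    (ht₀ : t₀ ∈ J) {κ a b : ℝ → ℝ} (hκ : ContinuousOn κ J) (ha : ContinuousOn a J)
    (hb : ContinuousOn b J) {v₁ v₂ : Vec} (hv : IsFrame v₁ v₂) :
    ∃ u₁ u₂ : ℝ → Vec, u₁ t₀ = v₁ ∧ u₂ t₀ = v₂ ∧ (∀ t, IsFrame (u₁ t) (u₂ t)) ∧
      (∀ t ∈ J, HasDerivAt u₁ (κ t • u₂ t - b t • (u₁ t ⨯₃ u₂ t)) t) ∧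
      (∀ t ∈ J, HasDerivAt u₂ (-(κ t) • u₁ t + a t • (u₁ t ⨯₃ u₂ t)) t) := by
  classical
  -- The frame equation is quadratic through the cross product, so it is cut off to obtain bounded
  -- Lipschitz fields. In the sup norm orthonormal pairs lie in the unit ball, where the bump equals
  -- 1; the cut-off is thus invisible once orthonormality is known.
  let χ : ContDiffBump (0 : Vec × Vec) := ⟨1, 2, one_pos, one_lt_two⟩
  let G : Fin 3 → Vec × Vec → Vec × Vec := ![fun z => χ z • (z.2, -z.1),
    fun z => χ z • (0, z.1 ⨯₃ z.2), fun z => χ z • (-(z.1 ⨯₃ z.2), 0)]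
  have hχ : ContDiff ℝ 1 (χ : Vec × Vec → ℝ) := χ.contDiff
  have hG : ∀ i, ContDiff ℝ 1 (G i) := by
    have := contDiff_crossProduct
    simp only [Fin.forall_fin_succ, IsEmpty.forall_iff, and_true]
    exact ⟨hχ.smul (contDiff_snd.prodMk contDiff_fst.neg), hχ.smul (contDiff_const.prodMk this),
      hχ.smul (this.neg.prodMk contDiff_const)⟩
  have hG' : ∀ i, HasCompactSupport (G i) := by
    simp only [Fin.forall_fin_succ, IsEmpty.forall_iff, and_true]
    exact ⟨χ.hasCompactSupport.smul_right, χ.hasCompactSupport.smul_right,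
      χ.hasCompactSupport.smul_right⟩
  obtain ⟨α, hα₀, hα⟩ := exists_hasDerivAt_sum_smul hJ hJ' ht₀ (c := ![κ, a, b])
    (by simp [Fin.forall_fin_succ, hκ, ha, hb]) hG hG' (v₁, v₂)
  have h₁ : ∀ t ∈ J, HasDerivAt (fun s => (α s).1)
      (χ (α t) • (κ t • (α t).2 - b t • ((α t).1 ⨯₃ (α t).2))) t := by
    intro t ht
    refine (hasFDerivAt_fst.comp_hasDerivAt t (hα t ht)).congr_deriv ?_
    simp [Fin.sum_univ_three, G, -cross_anticomm]
    module
  have h₂ : ∀ t ∈ J, HasDerivAt (fun s => (α s).2)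
      (χ (α t) • (-(κ t) • (α t).1 + a t • ((α t).1 ⨯₃ (α t).2))) t := by
    intro t ht
    refine (hasFDerivAt_snd.comp_hasDerivAt t (hα t ht)).congr_deriv ?_
    simp [Fin.sum_univ_three, G, -cross_anticomm]
    module
  -- The terms with `a` and `b` point along the cross product, which is perpendicular to both
  -- vectors, so they do not affect the inner products.
  have hd : ∀ t ∈ J,
      HasDerivAt (fun s => (α s).1 ⬝ᵥ (α s).1) (2 * χ (α t) * κ t * ((α t).1 ⬝ᵥ (α t).2)) t ∧
      HasDerivAt (fun s => (α s).2 ⬝ᵥ (α s).2) (-(2 * χ (α t) * κ t * ((α t).1 ⬝ᵥ (α t).2))) t ∧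
      HasDerivAt (fun s => (α s).1 ⬝ᵥ (α s).2)
        (χ (α t) * κ t * ((α t).2 ⬝ᵥ (α t).2 - (α t).1 ⬝ᵥ (α t).1)) t := by
    intro t ht
    refine ⟨((h₁ t ht).dotProduct (h₁ t ht)).congr_deriv ?_,
      ((h₂ t ht).dotProduct (h₂ t ht)).congr_deriv ?_,
      ((h₁ t ht).dotProduct (h₂ t ht)).congr_deriv ?_⟩ <;>
    · simp only [dot_eq, cross_zero, cross_one, cross_two, Pi.add_apply, Pi.sub_apply,
        Pi.smul_apply, smul_eq_mul]
      ring
  have hframe : ∀ t ∈ J, IsFrame (α t).1 (α t).2 := by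
    intro t ht
    have e₁ := eq_of_hasDerivAt_zero hJ hJ' (f := fun s => (α s).1 ⬝ᵥ (α s).1 + (α s).2 ⬝ᵥ (α s).2)
      (fun s hs => ((hd s hs).1.fun_add (hd s hs).2.1).congr_deriv (by ring)) ht ht₀
    -- The Gram matrix is rotated by `κ` and the cut-off factor. Its trace and the discriminant of
    -- its characteristic polynomial are conserved; their initial values 2 and 0 force it to stay
    -- the identity, whatever the cut-off does.
    have e₂ := eq_of_hasDerivAt_zero hJ hJ'
      (f := fun s => ((α s).1 ⬝ᵥ (α s).1 - (α s).2 ⬝ᵥ (α s).2) ^ 2 + 4 * ((α s).1 ⬝ᵥ (α s).2) ^ 2)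
      (fun s hs => ((((hd s hs).1.fun_sub (hd s hs).2.1).fun_pow 2).fun_add
        (((hd s hs).2.2.fun_pow 2).const_mul 4)).congr_deriv (by push_cast; ring)) ht ht₀
    simp only [hα₀, hv.unit₁, hv.unit₂, hv.orthogonal] at e₁ e₂
    have e₃ : (α t).1 ⬝ᵥ (α t).1 - (α t).2 ⬝ᵥ (α t).2 = 0 := by
      rw [← sq_eq_zero_iff]; nlinarith [sq_nonneg ((α t).1 ⬝ᵥ (α t).2)]
    refine ⟨by linarith, by linarith, ?_⟩
    rw [← sq_eq_zero_iff]; rw [e₃] at e₂; linarith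
  have hχ₁ : ∀ t ∈ J, χ (α t) = 1 := by
    intro t ht
    refine χ.one_of_mem_closedBall ?_
    rw [mem_closedBall_zero_iff, Prod.norm_def]
    exact max_le ((pi_norm_le_iff_of_nonneg zero_le_one).2 fun i => ((hframe t ht).abs_le_one i).1)
      ((pi_norm_le_iff_of_nonneg zero_le_one).2 fun i => ((hframe t ht).abs_le_one i).2)
  -- Outside `J` the constant initial frame is inserted, so that orthonormality holds for all real
  -- times and triangles can be placed along the frame without a side condition.
  refine ⟨fun t => if t ∈ J then (α t).1 else v₁, fun t => if t ∈ J then (α t).2 else v₂,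
    by simp [ht₀, hα₀], by simp [ht₀, hα₀], fun t => ?_, fun t ht => ?_, fun t ht => ?_⟩
  · by_cases ht : t ∈ J
    · simpa [ht] using hframe t ht
    · simpa [ht] using hv
  · have := h₁ t ht
    rw [hχ₁ t ht, one_smul] at this
    simp only [if_pos ht]
    refine this.congr_of_eventuallyEq ?_
    filter_upwards [hJ.mem_nhds ht] with s hs
    simp [hs]
  · have := h₂ t ht
    rw [hχ₁ t ht, one_smul] at this
    simp only [if_pos ht]
    refine this.congr_of_eventuallyEq ?_
    filter_upwards [hJ.mem_nhds ht] with s hs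
    simp [hs]

end

section

/-! ### A normal form for triangles with given spherical coordinates -/

/-- When the three masses sum to 1, $(1-y)(1-z)=x+yz$. Hence $1\pm\cos\beta$ have numerators $2yz$
and $2x$, and the half-angle formulas apply. -/
theorem cos_sin_half_arccos {x y z : ℝ} (hx : 0 < x) (hy : 0 < y) (hz : 0 < z)
    (h : x + y + z = 1) :
    Real.cos (Real.arccos ((y * z - x) / ((1 - y) * (1 - z))) / 2) =
        √y * √z / (√(1 - y) * √(1 - z)) ∧
      Real.sin (Real.arccos ((y * z - x) / ((1 - y) * (1 - z))) / 2) =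
        √x / (√(1 - y) * √(1 - z)) := by
  have hy' : 0 < 1 - y := by linarith
  have hz' : 0 < 1 - z := by linarith
  have hp : 0 < (1 - y) * (1 - z) := mul_pos hy' hz'
  have hyz : 0 < y * z := mul_pos hy hz
  have e : (1 - y) * (1 - z) = x + y * z := by linear_combination (-1) * h
  have h₁ : -1 ≤ (y * z - x) / ((1 - y) * (1 - z)) := by rw [le_div_iff₀ hp]; linarith
  have h₂ : (y * z - x) / ((1 - y) * (1 - z)) ≤ 1 := by rw [div_le_one hp]; linarith
  have h₀ := Real.arccos_nonneg ((y * z - x) / ((1 - y) * (1 - z)))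
  have hπ := Real.arccos_le_pi ((y * z - x) / ((1 - y) * (1 - z)))
  constructor
  · rw [Real.cos_half (by linarith) hπ, Real.cos_arccos h₁ h₂, ← Real.sqrt_mul hy.le,
      ← Real.sqrt_mul hy'.le, ← Real.sqrt_div hyz.le]
    congr 1
    field_simp
    linear_combination e
  · rw [Real.sin_half_eq_sqrt h₀ (by linarith), Real.cos_arccos h₁ h₂,
      ← Real.sqrt_mul hy'.le, ← Real.sqrt_div hx.le]
    congr 1
    field_simp
    linear_combination e

/-- First coordinates of a reference triangle whose inertia tensor is the identity, with the first
vertex on the first axis. -/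
noncomputable def refX (m : Fin 3 → ℝ) : Fin 3 → ℝ :=
  ![√(1 - m 0) / √(m 0), -(√(m 0) / √(1 - m 0)), -(√(m 0) / √(1 - m 0))]

/-- Second coordinates of the reference triangle. -/
noncomputable def refY (m : Fin 3 → ℝ) : Fin 3 → ℝ :=
  ![0, √(m 2) / (√(m 1) * √(1 - m 0)), -(√(m 1) / (√(m 2) * √(1 - m 0)))]

/-- Signed distances of the vertices of the reference triangle from the origin. -/
noncomputable def refRadius (m : Fin 3 → ℝ) : Fin 3 → ℝ :=
  ![√(1 - m 0) / √(m 0), -(√(1 - m 1) / √(m 1)), -(√(1 - m 2) / √(m 2))]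

section Reference

variable {m : Fin 3 → ℝ}

theorem forall_fin_three {P : Fin 3 → Prop} : (∀ i, P i) ↔ P 0 ∧ P 1 ∧ P 2 := by
  simp [Fin.forall_fin_succ]

theorem sub_mass_pos (hm : ∀ i, 0 < m i) (hsum : ∑ i, m i = 1) (i : Fin 3) : 0 < 1 - m i := by
  have h := forall_fin_three.1 hm
  rw [Fin.sum_univ_three] at hsum
  revert i
  rw [forall_fin_three]
  refine ⟨?_, ?_, ?_⟩ <;> linarith [h.1, h.2.1, h.2.2]

theorem refRadius_sq (hm : ∀ i, 0 < m i) (hsum : ∑ i, m i = 1) (i : Fin 3) :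
    refRadius m i ^ 2 = (1 - m i) / m i := by
  have h := sub_mass_pos hm hsum
  revert i
  simp [forall_fin_three, refRadius, div_pow, Real.sq_sqrt, (h _).le, (hm _).le]

/-- The angles $\beta_i$ are turned into masses here: in polar form, with signed radii, the
reference vertices lie at minus half the longitudes of the collision points. -/
theorem ref_polar (hm : ∀ i, 0 < m i) (hsum : ∑ i, m i = 1) (i : Fin 3) :
    refX m i = refRadius m i * Real.cos (collisionLongitude m i / 2) ∧
      refY m i = -(refRadius m i * Real.sin (collisionLongitude m i / 2)) := by
  have h := sub_mass_pos hm hsum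
  have hs : ∀ i, 0 < √(m i) := fun i => Real.sqrt_pos.2 (hm i)
  have hs' : ∀ i, 0 < √(1 - m i) := fun i => Real.sqrt_pos.2 (h i)
  rw [Fin.sum_univ_three] at hsum
  have h₁ := cos_sin_half_arccos (hm 1) (hm 2) (hm 0) (by linarith)
  have h₂ := cos_sin_half_arccos (hm 2) (hm 0) (hm 1) (by linarith)
  have n0 := (hs 0).ne'
  have n1 := (hs 1).ne'
  have n2 := (hs 2).ne'
  have k0 := (hs' 0).ne'
  have k1 := (hs' 1).ne'
  have k2 := (hs' 2).ne'
  revert i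
  simp only [forall_fin_three, refX, refY, refRadius, collisionLongitude, betaAngle,
    Matrix.cons_val_zero, Matrix.cons_val_one, Matrix.cons_val, zero_div, Real.cos_zero,
    Real.sin_zero, mul_one, mul_zero, neg_zero, and_true, true_and, neg_div, Real.cos_neg,
    Real.sin_neg, Fin.isValue, Fin.reduceAdd]
  rw [h₁.1, h₁.2, h₂.1, h₂.2]
  refine ⟨⟨?_, ?_⟩, ?_, ?_⟩ <;> field_simp

/-- Together with $\sum m_i=1$, these relations say that the $3\times3$ matrix with rows
$(\sqrt{m_i})$, $(\sqrt{m_i}X_i)$, $(\sqrt{m_i}Y_i)$ is orthogonal. -/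
theorem ref_relations (hm : ∀ i, 0 < m i) (hsum : ∑ i, m i = 1) :
    ∑ i, m i * refX m i = 0 ∧ ∑ i, m i * refY m i = 0 ∧ ∑ i, m i * refX m i ^ 2 = 1 ∧
      ∑ i, m i * refY m i ^ 2 = 1 ∧ ∑ i, m i * (refX m i * refY m i) = 0 := by
  have h := sub_mass_pos hm hsum
  have hs : ∀ i, 0 < √(m i) := fun i => Real.sqrt_pos.2 (hm i)
  have hs' : ∀ i, 0 < √(1 - m i) := fun i => Real.sqrt_pos.2 (h i)
  have e0 := Real.sq_sqrt (hm 0).le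
  have e1 := Real.sq_sqrt (hm 1).le
  have e2 := Real.sq_sqrt (hm 2).le
  have f0 := Real.sq_sqrt (h 0).le
  have n0 := (hs 0).ne'
  have n1 := (hs 1).ne'
  have n2 := (hs 2).ne'
  have k0 := (hs' 0).ne'
  have hr : √(1 - m 0) ^ 2 = √(m 1) ^ 2 + √(m 2) ^ 2 := by
    rw [f0, e1, e2]; rw [Fin.sum_univ_three] at hsum; linarith
  have hr' : √(m 0) ^ 2 + √(1 - m 0) ^ 2 = 1 := by rw [f0, e0]; ring
  simp only [Fin.sum_univ_three, refX, refY, Matrix.cons_val_zero, Matrix.cons_val_one,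
    Matrix.cons_val]
  -- With the square roots as variables, only the relations $r^2=b^2+c^2$ and $a^2+r^2=1$ are
  -- needed, and the claims become polynomial.
  generalize √(1 - m 0) = r at *
  generalize √(m 0) = a at *
  generalize √(m 1) = b at *
  generalize √(m 2) = c at *
  rw [← e0, ← e1, ← e2]
  refine ⟨?_, ?_, ?_, ?_, ?_⟩ <;> field_simp
  · linear_combination a * hr
  · ring
  · linear_combination -a ^ 2 * hr + r ^ 2 * hr'
  · linear_combination -hr
  · ring

/-- The $2\times2$ minors of a rotation matrix equal its complementary entries; for the matrix with
rows $(\sqrt{m_i})$, $(\sqrt{m_i}X_i)$, $(\sqrt{m_i}Y_i)$ this is the stated value. -/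
theorem ref_cross (hm : ∀ i, 0 < m i) (hsum : ∑ i, m i = 1) (i : Fin 3) :
    refX m i * refY m (i + 1) - refY m i * refX m (i + 1) = m (i + 2) / √(m 0 * m 1 * m 2) := by
  have h := sub_mass_pos hm hsum
  have hs : ∀ i, 0 < √(m i) := fun i => Real.sqrt_pos.2 (hm i)
  have hs' : ∀ i, 0 < √(1 - m i) := fun i => Real.sqrt_pos.2 (h i)
  have e0 := Real.sq_sqrt (hm 0).le
  have e1 := Real.sq_sqrt (hm 1).le
  have e2 := Real.sq_sqrt (hm 2).le
  have f0 := Real.sq_sqrt (h 0).le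
  have n0 := (hs 0).ne'
  have n1 := (hs 1).ne'
  have n2 := (hs 2).ne'
  have k0 := (hs' 0).ne'
  have hr : √(1 - m 0) ^ 2 = √(m 1) ^ 2 + √(m 2) ^ 2 := by
    rw [f0, e1, e2]; rw [Fin.sum_univ_three] at hsum; linarith
  rw [Real.sqrt_mul (mul_pos (hm 0) (hm 1)).le, Real.sqrt_mul (hm 0).le]
  revert i
  simp only [forall_fin_three, refX, refY, Matrix.cons_val_zero, Matrix.cons_val_one,
    Matrix.cons_val, Fin.isValue, Fin.reduceAdd]
  generalize √(1 - m 0) = r at *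
  generalize √(m 0) = a at *
  generalize √(m 1) = b at *
  generalize √(m 2) = c at *
  rw [← e0, ← e1, ← e2]
  refine ⟨?_, ?_, ?_⟩ <;> field_simp
  · ring
  · linear_combination -hr
  · ring

end Reference

namespace Coord

/-- First coordinate of the `i`-th vertex, relative to the eigenframe, of the standard triangle with
spherical coordinates `p`. -/
noncomputable def planarX (m : Fin 3 → ℝ) (p : Coord) (i : Fin 3) : ℝ :=
  p.ρ * Real.cos (p.φ / 2 - Real.pi / 4) *
    (refX m i * Real.cos (p.θ / 2) - refY m i * Real.sin (p.θ / 2))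

/-- Second coordinate of the `i`-th vertex, relative to the eigenframe, of the standard triangle
with spherical coordinates `p`. -/
noncomputable def planarY (m : Fin 3 → ℝ) (p : Coord) (i : Fin 3) : ℝ :=
  -(p.ρ * Real.sin (p.φ / 2 - Real.pi / 4) *
    (refX m i * Real.sin (p.θ / 2) + refY m i * Real.cos (p.θ / 2)))

/-- The angle $\varphi/2-\pi/4$ makes $\rho\cos\alpha$ and $\rho\sin\alpha$ smooth signed square
roots of $\lambda_2$ and $\lambda_1$, with no choice of branch when $\varphi$ is an arbitrary real
number. -/
theorem sin_eq_cos_half (φ : ℝ) :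
    Real.sin φ = 2 * Real.cos (φ / 2 - Real.pi / 4) ^ 2 - 1 := by
  rw [← Real.cos_two_mul, show 2 * (φ / 2 - Real.pi / 4) = φ - Real.pi / 2 by ring,
    Real.cos_sub_pi_div_two]

theorem cos_eq_half (φ : ℝ) :
    Real.cos φ = -(2 * Real.sin (φ / 2 - Real.pi / 4) * Real.cos (φ / 2 - Real.pi / 4)) := by
  rw [← Real.sin_two_mul, show 2 * (φ / 2 - Real.pi / 4) = φ - Real.pi / 2 by ring,
    Real.sin_sub_pi_div_two, neg_neg]

variable {m : Fin 3 → ℝ} (p : Coord)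

theorem sum_planarX (hm : ∀ i, 0 < m i) (hsum : ∑ i, m i = 1) :
    ∑ i, m i * p.planarX m i = 0 := by
  obtain ⟨h₁, h₂, -⟩ := ref_relations hm hsum
  simp only [Fin.sum_univ_three, planarX] at *
  linear_combination p.ρ * Real.cos (p.φ / 2 - Real.pi / 4) *
    (Real.cos (p.θ / 2) * h₁ - Real.sin (p.θ / 2) * h₂)

theorem sum_planarY (hm : ∀ i, 0 < m i) (hsum : ∑ i, m i = 1) :
    ∑ i, m i * p.planarY m i = 0 := by
  obtain ⟨h₁, h₂, -⟩ := ref_relations hm hsum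
  simp only [Fin.sum_univ_three, planarY] at *
  linear_combination -(p.ρ * Real.sin (p.φ / 2 - Real.pi / 4)) *
    (Real.sin (p.θ / 2) * h₁ + Real.cos (p.θ / 2) * h₂)

/-- The inertia about an axis in the plane is the second moment of the other coordinate; hence first
coordinates go with index 1. The rotation by $\theta/2$ drops out because the reference tensor is
the identity. -/
theorem sum_planarX_sq (hm : ∀ i, 0 < m i) (hsum : ∑ i, m i = 1) :
    ∑ i, m i * p.planarX m i ^ 2 = p.eigenvalue 1 := by
  obtain ⟨-, -, h₁, h₂, h₃⟩ := ref_relations hm hsum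
  simp only [Fin.sum_univ_three, planarX, eigenvalue, Matrix.cons_val_one,
    Matrix.cons_val_zero] at *
  rw [sin_eq_cos_half p.φ]
  have h₄ := Real.sin_sq_add_cos_sq (p.θ / 2)
  generalize Real.cos (p.φ / 2 - Real.pi / 4) = c at *
  generalize Real.cos (p.θ / 2) = k at *
  generalize Real.sin (p.θ / 2) = s at *
  linear_combination (p.ρ * c) ^ 2 * (k ^ 2 * h₁ + s ^ 2 * h₂ - 2 * k * s * h₃ + h₄)

theorem sum_planarY_sq (hm : ∀ i, 0 < m i) (hsum : ∑ i, m i = 1) :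
    ∑ i, m i * p.planarY m i ^ 2 = p.eigenvalue 0 := by
  obtain ⟨-, -, h₁, h₂, h₃⟩ := ref_relations hm hsum
  simp only [Fin.sum_univ_three, planarY, eigenvalue, Matrix.cons_val_zero] at *
  rw [sin_eq_cos_half p.φ]
  have h₄ := Real.sin_sq_add_cos_sq (p.θ / 2)
  have h₅ := Real.sin_sq_add_cos_sq (p.φ / 2 - Real.pi / 4)
  generalize Real.cos (p.φ / 2 - Real.pi / 4) = c at *
  generalize Real.sin (p.φ / 2 - Real.pi / 4) = d at *
  generalize Real.cos (p.θ / 2) = k at *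
  generalize Real.sin (p.θ / 2) = s at *
  linear_combination (p.ρ * d) ^ 2 * (s ^ 2 * h₁ + k ^ 2 * h₂ + 2 * k * s * h₃ + h₄) +
    p.ρ ^ 2 * h₅

theorem sum_planarX_mul_planarY (hm : ∀ i, 0 < m i) (hsum : ∑ i, m i = 1) :
    ∑ i, m i * (p.planarX m i * p.planarY m i) = 0 := by
  obtain ⟨-, -, h₁, h₂, h₃⟩ := ref_relations hm hsum
  simp only [Fin.sum_univ_three, planarX, planarY] at *
  generalize Real.cos (p.φ / 2 - Real.pi / 4) = c at *
  generalize Real.sin (p.φ / 2 - Real.pi / 4) = d at *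
  generalize Real.cos (p.θ / 2) = k at *
  generalize Real.sin (p.θ / 2) = s at *
  linear_combination -(p.ρ ^ 2 * c * d) * (k * s * h₁ - s * k * h₂ + (k ^ 2 - s ^ 2) * h₃)

/-- Rotating by $\theta/2$ a vertex whose polar angle is minus half a collision longitude leaves
half of the relative longitude $\theta_i$. -/
theorem planarX_eq (hm : ∀ i, 0 < m i) (hsum : ∑ i, m i = 1) (i : Fin 3) :
    p.planarX m i = p.ρ * Real.cos (p.φ / 2 - Real.pi / 4) *
      (refRadius m i * Real.cos (p.relLongitude m i / 2)) := by
  rw [planarX, (ref_polar hm hsum i).1, (ref_polar hm hsum i).2, relLongitude, sub_div,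
    Real.cos_sub (p.θ / 2)]
  ring

theorem planarY_eq (hm : ∀ i, 0 < m i) (hsum : ∑ i, m i = 1) (i : Fin 3) :
    p.planarY m i = -(p.ρ * Real.sin (p.φ / 2 - Real.pi / 4) *
      (refRadius m i * Real.sin (p.relLongitude m i / 2))) := by
  rw [planarY, (ref_polar hm hsum i).1, (ref_polar hm hsum i).2, relLongitude, sub_div,
    Real.sin_sub (p.θ / 2)]
  ring

/-- With $r_i^2m_i=1-m_i$ this reduces to
$c^2k^2+(1-c^2)(1-k^2)=\tfrac12\bigl(1+(2c^2-1)(2k^2-1)\bigr)$, where the two brackets on the right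
are $\sin\varphi$ and $\cos\theta_i$. -/
theorem inertia_eq_planar (hm : ∀ i, 0 < m i) (hsum : ∑ i, m i = 1) (i : Fin 3) :
    p.inertia m i = m i * (p.planarX m i ^ 2 + p.planarY m i ^ 2) := by
  have h₁ := refRadius_sq hm hsum i
  rw [eq_div_iff (hm i).ne'] at h₁
  rw [planarX_eq p hm hsum, planarY_eq p hm hsum, inertia, sin_eq_cos_half p.φ,
    show p.relLongitude m i = 2 * (p.relLongitude m i / 2) by ring, Real.cos_two_mul,
    show 2 * (p.relLongitude m i / 2) / 2 = p.relLongitude m i / 2 by ring]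
  have h₄ := Real.sin_sq_add_cos_sq (p.relLongitude m i / 2)
  have h₅ := Real.sin_sq_add_cos_sq (p.φ / 2 - Real.pi / 4)
  generalize Real.cos (p.φ / 2 - Real.pi / 4) = c at *
  generalize Real.sin (p.φ / 2 - Real.pi / 4) = d at *
  generalize Real.cos (p.relLongitude m i / 2) = k at *
  generalize Real.sin (p.relLongitude m i / 2) = s at *
  have hd : d ^ 2 = 1 - c ^ 2 := by linarith
  have hs : s ^ 2 = 1 - k ^ 2 := by linarith
  have : m i * ((p.ρ * c * (refRadius m i * k)) ^ 2 + (-(p.ρ * d * (refRadius m i * s))) ^ 2) =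
    (refRadius m i ^ 2 * m i) * p.ρ ^ 2 * (c ^ 2 * k ^ 2 + d ^ 2 * s ^ 2) := by ring
  rw [this, h₁, hd, hs]
  ring

theorem sum_inertia (hm : ∀ i, 0 < m i) (hsum : ∑ i, m i = 1) :
    ∑ i, p.inertia m i = p.ρ ^ 2 := by
  have h₁ := sum_planarX_sq p hm hsum
  have h₂ := sum_planarY_sq p hm hsum
  simp only [inertia_eq_planar p hm hsum, mul_add, Finset.sum_add_distrib, h₁, h₂, eigenvalue,
    Matrix.cons_val_one, Matrix.cons_val_zero]
  ring

/-- The linear map from the reference triangle has determinant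
$-\rho^2\cos\alpha\sin\alpha=\tfrac12\rho^2\cos\varphi$, which multiplies the reference cross
products. -/
theorem planar_cross (hm : ∀ i, 0 < m i) (hsum : ∑ i, m i = 1) (i : Fin 3) :
    p.planarX m i * p.planarY m (i + 1) - p.planarY m i * p.planarX m (i + 1) =
      2 * m (i + 2) * p.signedArea m := by
  have h := ref_cross hm hsum i
  have hs : 0 < √(m 0 * m 1 * m 2) := Real.sqrt_pos.2 (mul_pos (mul_pos (hm 0) (hm 1)) (hm 2))
  have : 2 * m (i + 2) * p.signedArea m =
      p.ρ ^ 2 * Real.cos p.φ / 2 * (m (i + 2) / √(m 0 * m 1 * m 2)) := by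
    rw [signedArea]; field_simp; ring
  rw [this, ← h, cos_eq_half p.φ, planarX, planarX, planarY, planarY]
  have h₄ := Real.sin_sq_add_cos_sq (p.θ / 2)
  linear_combination -p.ρ ^ 2 * Real.cos (p.φ / 2 - Real.pi / 4) *
    Real.sin (p.φ / 2 - Real.pi / 4) * (refX m i * refY m (i + 1) - refY m i * refX m (i + 1)) * h₄

theorem half_ne_zero (hφ : Real.cos p.φ ≠ 0) :
    Real.cos (p.φ / 2 - Real.pi / 4) ≠ 0 ∧ Real.sin (p.φ / 2 - Real.pi / 4) ≠ 0 := by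
  rw [cos_eq_half p.φ] at hφ
  constructor <;> intro h <;> simp [h] at hφ

/-- The complex number defining $\psi_i$ is
$2\cos\alpha\,(\cos\alpha\cos\tfrac{\theta_i}2,\,-\sin\alpha\sin\tfrac{\theta_i}2)$, a real multiple
of the direction of the vertex. The multiple may be negative, so only parallelism, that is $\psi_i$
modulo $\pi$, is obtained. -/
theorem planar_frameAngle (hm : ∀ i, 0 < m i) (hsum : ∑ i, m i = 1) (hφ : Real.cos p.φ ≠ 0)
    (i : Fin 3) :
    p.planarX m i * Real.sin (p.frameAngle m i) = p.planarY m i * Real.cos (p.frameAngle m i) := by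
  obtain ⟨hc, hd⟩ := half_ne_zero p hφ
  set z : ℂ := ⟨(1 + Real.sin p.φ) * Real.cos (p.relLongitude m i / 2),
    Real.cos p.φ * Real.sin (p.relLongitude m i / 2)⟩ with hz
  have hre : z.re = 2 * Real.cos (p.φ / 2 - Real.pi / 4) ^ 2 *
      Real.cos (p.relLongitude m i / 2) := by
    rw [hz, sin_eq_cos_half p.φ]; ring
  have him : z.im = -(2 * Real.sin (p.φ / 2 - Real.pi / 4) * Real.cos (p.φ / 2 - Real.pi / 4)) *
      Real.sin (p.relLongitude m i / 2) := by
    rw [hz, cos_eq_half p.φ]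
  have hz₀ : z ≠ 0 := by
    intro h
    have h₁ : z.re = 0 := by rw [h]; rfl
    have h₂ : z.im = 0 := by rw [h]; rfl
    rw [hre] at h₁
    rw [him] at h₂
    have h₃ : Real.cos (p.relLongitude m i / 2) = 0 := by simpa [hc] using h₁
    have h₄ : Real.sin (p.relLongitude m i / 2) = 0 := by simpa [hc, hd] using h₂
    have := Real.sin_sq_add_cos_sq (p.relLongitude m i / 2)
    rw [h₃, h₄] at this
    norm_num at this
  have hψ : p.frameAngle m i = z.arg := rfl
  rw [hψ, Complex.sin_arg, Complex.cos_arg hz₀, hre, him, planarX_eq p hm hsum,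
    planarY_eq p hm hsum]
  ring

theorem eigenvalue_pos (hρ : 0 < p.ρ) (hφ : Real.cos p.φ ≠ 0) (i : Fin 3) :
    0 < p.eigenvalue i := by
  have h := Real.sin_sq_add_cos_sq p.φ
  have h' : 0 < Real.cos p.φ ^ 2 := by positivity
  have h₁ : 0 < 1 - Real.sin p.φ := by nlinarith
  have h₂ : 0 < 1 + Real.sin p.φ := by nlinarith
  revert i
  simp only [forall_fin_three, eigenvalue, Matrix.cons_val_zero, Matrix.cons_val_one,
    Matrix.cons_val]
  refine ⟨?_, ?_, ?_⟩ <;> positivity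

end Coord

end

/-! ### Triangles in space laid along a frame -/

section

variable {m : Fin 3 → ℝ}

theorem sum_three_smul_eq_zero {m : Fin 3 → ℝ} {w : Fin 3 → Vec} (h : ∑ i, m i • w i = 0)
    (k : Fin 3) : m 0 * w 0 k + m 1 * w 1 k + m 2 * w 2 k = 0 := by
  have := congrFun h k
  simpa [Fin.sum_univ_three] using this

/-- Since $n\times(a\times b)=0$, expanding $n\times(n\times(a\times b))$ leaves only the component
along $n$. -/
theorem eq_smul_of_dot_eq_zero {n a b : Vec} (hn : n ⬝ᵥ n = 1) (ha : n ⬝ᵥ a = 0)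
    (hb : n ⬝ᵥ b = 0) : a ⨯₃ b = ((a ⨯₃ b) ⬝ᵥ n) • n := by
  have h₁ : n ⨯₃ (a ⨯₃ b) = 0 := by
    rw [cross_cross_eq_smul_sub_smul', dotProduct_comm a, ha, hb]; simp
  have h₂ := cross_cross_eq_smul_sub_smul' n n (a ⨯₃ b)
  rw [h₁, hn, map_zero, one_smul, dotProduct_comm] at h₂
  exact (sub_eq_zero.1 h₂.symm).symm

/-- Vectors with the same Gram matrix as two independent planar vectors are an isometric copy of
them; the frame is found by inverting the $2\times2$ coordinate matrix. Keeping `D` signed in the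
last identity lets it decide the orientation. -/
theorem exists_frame_of_gram {a b : Vec} {x₀ x₁ y₀ y₁ D : ℝ} (hD : x₀ * y₁ - y₀ * x₁ = D)
    (hD₀ : D ≠ 0) (haa : a ⬝ᵥ a = x₀ ^ 2 + y₀ ^ 2) (hab : a ⬝ᵥ b = x₀ * x₁ + y₀ * y₁)
    (hbb : b ⬝ᵥ b = x₁ ^ 2 + y₁ ^ 2) :
    ∃ u v, IsFrame u v ∧ a = x₀ • u + y₀ • v ∧ b = x₁ • u + y₁ • v ∧ D • (u ⨯₃ v) = a ⨯₃ b := by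
  have hba := hab
  rw [dotProduct_comm] at hba
  refine ⟨D⁻¹ • (y₁ • a - y₀ • b), D⁻¹ • (x₀ • b - x₁ • a), ?_, ?_, ?_, ?_⟩
  · constructor <;>
    simp only [smul_dotProduct, dotProduct_smul, sub_dotProduct, dotProduct_sub, haa, hab, hba, hbb,
      smul_eq_mul] <;>
    field_simp <;>
    rw [← hD] <;>
    ring
  · apply smul_right_injective _ hD₀
    simp only [smul_add, smul_comm D x₀, smul_comm D y₀, smul_inv_smul₀ hD₀]
    rw [← hD]
    module
  · apply smul_right_injective _ hD₀
    simp only [smul_add, smul_comm D x₁, smul_comm D y₁, smul_inv_smul₀ hD₀]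
    rw [← hD]
    module
  · apply smul_right_injective _ hD₀
    simp only
    rw [map_smul, smul_inv_smul₀ hD₀, map_smul, LinearMap.smul_apply, smul_inv_smul₀ hD₀]
    rw [← hD]
    simp only [map_sub, map_smul, LinearMap.sub_apply, LinearMap.smul_apply, cross_self,
      ← cross_anticomm a b]
    module

namespace OrientedTriangle

variable (Γ : OrientedTriangle m)

/-- The centre of mass cuts the triangle into three triangles whose areas are proportional to the
opposite masses. -/
theorem cross_pos_dot (hm : ∀ i, 0 < m i) (hsum : ∑ i, m i = 1) (i : Fin 3) :
    (Γ.pos i ⨯₃ Γ.pos (i + 1)) ⬝ᵥ Γ.normal = 2 * m (i + 2) * Γ.signedArea := by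
  have hc := sum_three_smul_eq_zero Γ.com
  have h₂ := (hm 2).ne'
  have h₃ : ∀ k, Γ.pos 2 k = -(m 0 * Γ.pos 0 k + m 1 * Γ.pos 1 k) / m 2 := by
    intro k; rw [eq_div_iff h₂]; linarith [hc k]
  have h₁ : m 0 = 1 - m 1 - m 2 := by rw [Fin.sum_univ_three] at hsum; linarith
  revert i
  simp only [forall_fin_three, signedArea, dot_eq, cross_zero, cross_one, cross_two, Pi.sub_apply,
    Fin.isValue, Fin.reduceAdd, h₃]
  refine ⟨?_, ?_, ?_⟩ <;> field_simp <;> rw [h₁] <;> ring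

theorem cross_pos (hm : ∀ i, 0 < m i) (hsum : ∑ i, m i = 1) (i : Fin 3) :
    Γ.pos i ⨯₃ Γ.pos (i + 1) = (2 * m (i + 2) * Γ.signedArea) • Γ.normal := by
  rw [← Γ.cross_pos_dot hm hsum]
  exact eq_smul_of_dot_eq_zero Γ.unit (Γ.perp _) (Γ.perp _)

/-- Compare the squared lengths of $m_i\mathbf a_i+m_{i+1}\mathbf a_{i+1}$ and $-m_{i+2}\mathbf
a_{i+2}$. All inner products of positions are thereby functions of the $I_j$. -/
theorem two_mul_dot_pos (i : Fin 3) :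
    2 * m i * m (i + 1) * (Γ.pos i ⬝ᵥ Γ.pos (i + 1)) =
      m (i + 2) * Γ.inertia (i + 2) - m i * Γ.inertia i - m (i + 1) * Γ.inertia (i + 1) := by
  have hc := sum_three_smul_eq_zero Γ.com
  have h₀ := hc 0
  have h₁ := hc 1
  have h₂ := hc 2
  revert i
  simp only [forall_fin_three, inertia, dot_eq, Fin.isValue, Fin.reduceAdd]
  refine ⟨?_, ?_, ?_⟩
  · linear_combination
      (m 0 * Γ.pos 0 0 + m 1 * Γ.pos 1 0 - m 2 * Γ.pos 2 0) * h₀ +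
      (m 0 * Γ.pos 0 1 + m 1 * Γ.pos 1 1 - m 2 * Γ.pos 2 1) * h₁ +
      (m 0 * Γ.pos 0 2 + m 1 * Γ.pos 1 2 - m 2 * Γ.pos 2 2) * h₂
  · linear_combination
      (m 1 * Γ.pos 1 0 + m 2 * Γ.pos 2 0 - m 0 * Γ.pos 0 0) * h₀ +
      (m 1 * Γ.pos 1 1 + m 2 * Γ.pos 2 1 - m 0 * Γ.pos 0 1) * h₁ +
      (m 1 * Γ.pos 1 2 + m 2 * Γ.pos 2 2 - m 0 * Γ.pos 0 2) * h₂
  · linear_combination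
      (m 2 * Γ.pos 2 0 + m 0 * Γ.pos 0 0 - m 1 * Γ.pos 1 0) * h₀ +
      (m 2 * Γ.pos 2 1 + m 0 * Γ.pos 0 1 - m 1 * Γ.pos 1 1) * h₁ +
      (m 2 * Γ.pos 2 2 + m 0 * Γ.pos 0 2 - m 1 * Γ.pos 1 2) * h₂

/-- The edges are perpendicular to the normal, so their cross product is a multiple of it; zero area
makes them linearly dependent. -/
theorem signedArea_ne_zero (h : Γ.Nondegenerate) : Γ.signedArea ≠ 0 := by
  intro hA
  apply h
  have hc : (Γ.pos 1 - Γ.pos 0) ⨯₃ (Γ.pos 2 - Γ.pos 0) = 0 := by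
    rw [eq_smul_of_dot_eq_zero Γ.unit (a := Γ.pos 1 - Γ.pos 0) (b := Γ.pos 2 - Γ.pos 0)
      (by simp [Γ.perp]) (by simp [Γ.perp])]
    rw [signedArea] at hA
    rw [show ((Γ.pos 1 - Γ.pos 0) ⨯₃ (Γ.pos 2 - Γ.pos 0)) ⬝ᵥ Γ.normal = 0 by linarith, zero_smul]
  have hd : ¬ LinearIndependent ℝ ![Γ.pos 1 - Γ.pos 0, Γ.pos 2 - Γ.pos 0] := by
    rw [← crossProduct_ne_zero_iff_linearIndependent]; simpa using hc
  rw [collinear_iff_of_mem (mem_range_self (f := Γ.pos) 0)]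
  rw [LinearIndependent.pair_iff] at hd
  push Not at hd
  obtain ⟨s, t, hst, hne⟩ := hd
  -- A relation without the second edge means that the first edge vanishes, so the line must then be
  -- taken along the second edge.
  by_cases ht : t = 0
  · have hs : s ≠ 0 := fun hs => hne hs ht
    have h₁ : Γ.pos 1 = Γ.pos 0 := by
      rw [ht, zero_smul, add_zero] at hst
      exact sub_eq_zero.1 ((smul_eq_zero.1 hst).resolve_left hs)
    refine ⟨Γ.pos 2 - Γ.pos 0, ?_⟩
    rintro _ ⟨i, rfl⟩
    revert i
    rw [forall_fin_three]
    exact ⟨⟨0, by simp⟩, ⟨0, by simp [h₁]⟩, ⟨1, by simp⟩⟩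
  · refine ⟨Γ.pos 1 - Γ.pos 0, ?_⟩
    rintro _ ⟨i, rfl⟩
    revert i
    rw [forall_fin_three]
    refine ⟨⟨0, by simp⟩, ⟨1, by simp⟩, ⟨-s / t, ?_⟩⟩
    have h₂ : t • (Γ.pos 2 - Γ.pos 0) = t • ((-s / t) • (Γ.pos 1 - Γ.pos 0)) := by
      rw [smul_smul, mul_div_cancel₀ _ ht, neg_smul, eq_neg_iff_add_eq_zero, add_comm]
      exact hst
    have h₃ := smul_right_injective _ ht h₂
    rw [vadd_eq_add, ← sub_eq_iff_eq_add]
    exact h₃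

theorem injective_pos (hm : ∀ i, 0 < m i) (hsum : ∑ i, m i = 1) (h : Γ.signedArea ≠ 0) :
    Function.Injective Γ.pos := by
  have hne : ∀ i, Γ.pos i ≠ Γ.pos (i + 1) := by
    intro i hi
    have := Γ.cross_pos_dot hm hsum i
    rw [hi, cross_self, zero_dotProduct] at this
    have h₂ := (hm (i + 2)).ne'
    simp_all
  have := forall_fin_three.1 hne
  simp only [Fin.isValue, Fin.reduceAdd] at this
  intro i j hij
  fin_cases i <;> fin_cases j <;> simp_all

/-- `Γ` is the standard triangle with coordinates `p`, placed along the frame `(u, v)`. -/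
structure Realizes (p : Coord) (u v : Vec) : Prop where
  frame : IsFrame u v
  normal : u ⨯₃ v = Γ.normal
  pos : ∀ i, Γ.pos i = p.planarX m i • u + p.planarY m i • v

variable {Γ} {p : Coord}

/-- The $I_i$ determine the Gram matrix of the positions, and the signed area determines the side on
which the normal lies. Two vertices fix the frame and the centre of mass gives the third. -/
theorem exists_realizes (hm : ∀ i, 0 < m i) (hsum : ∑ i, m i = 1) (h : IsCoord Γ.moduli p)
    (hφ : Real.cos p.φ ≠ 0) : ∃ u v, Γ.Realizes p u v := by
  have hI : ∀ i, Γ.inertia i = p.inertia m i := h.inertia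
  have hA : Γ.signedArea = p.signedArea m := h.area
  have hx := p.sum_planarX hm hsum
  have hy := p.sum_planarY hm hsum
  have hD := p.planar_cross hm hsum 0
  have hn := Γ.cross_pos hm hsum 0
  have hg := Γ.two_mul_dot_pos 0
  have hG : ∀ i, Γ.pos i ⬝ᵥ Γ.pos i = p.planarX m i ^ 2 + p.planarY m i ^ 2 := by
    intro i
    have := hI i
    rw [p.inertia_eq_planar hm hsum, OrientedTriangle.inertia] at this
    exact mul_left_cancel₀ (hm i).ne' this
  simp only [hI, p.inertia_eq_planar hm hsum, Fin.isValue, zero_add, hA] at hg hn hD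
  have hD0 : 2 * m 2 * p.signedArea m ≠ 0 := by
    have := hm 2
    have := h.pos
    have : 0 < √(m 0 * m 1 * m 2) := Real.sqrt_pos.2 (mul_pos (mul_pos (hm 0) (hm 1)) (hm 2))
    rw [Coord.signedArea]
    positivity
  have hG0 := hG 0
  have hG1 := hG 1
  have hc : m 0 • Γ.pos 0 + m 1 • Γ.pos 1 + m 2 • Γ.pos 2 = 0 := by
    rw [← Fin.sum_univ_three (fun i => m i • Γ.pos i)]; exact Γ.com
  rw [Fin.sum_univ_three] at hx hy
  have hG01 : Γ.pos 0 ⬝ᵥ Γ.pos 1 =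
      p.planarX m 0 * p.planarX m 1 + p.planarY m 0 * p.planarY m 1 := by
    have h0 := (hm 0).ne'
    have h1 := (hm 1).ne'
    have : 2 * m 0 * m 1 ≠ 0 := by positivity
    apply mul_left_cancel₀ this
    rw [hg]
    linear_combination -(m 0 * p.planarX m 0 + m 1 * p.planarX m 1 - m 2 * p.planarX m 2) * hx
      - (m 0 * p.planarY m 0 + m 1 * p.planarY m 1 - m 2 * p.planarY m 2) * hy
  obtain ⟨u, v, hf, hp₀, hp₁, hc₁⟩ := exists_frame_of_gram hD hD0 hG0 hG01 hG1
  refine ⟨u, v, hf, ?_, ?_⟩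
  · apply smul_right_injective _ hD0
    simp only [hc₁, hn]
  · rw [forall_fin_three]
    refine ⟨hp₀, hp₁, ?_⟩
    apply smul_right_injective _ (hm 2).ne'
    have e : m 2 • Γ.pos 2 = -(m 0 • Γ.pos 0) - m 1 • Γ.pos 1 := by
      rw [eq_sub_iff_add_eq, eq_neg_iff_add_eq_zero, ← hc]; abel
    simp only [e, hp₀, hp₁]
    rw [smul_add (m 2), smul_smul (m 2), smul_smul (m 2),
      show m 2 * p.planarX m 2 = -(m 0 * p.planarX m 0) - m 1 * p.planarX m 1 by linarith,
      show m 2 * p.planarY m 2 = -(m 0 * p.planarY m 0) - m 1 * p.planarY m 1 by linarith]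
    module

variable {u v : Vec}

theorem Realizes.inertia_eq (hm : ∀ i, 0 < m i) (hsum : ∑ i, m i = 1) (h : Γ.Realizes p u v)
    (i : Fin 3) : Γ.inertia i = p.inertia m i := by
  rw [OrientedTriangle.inertia, h.pos, p.inertia_eq_planar hm hsum]
  have hvu : v ⬝ᵥ u = 0 := by rw [dotProduct_comm]; exact h.frame.orthogonal
  simp only [add_dotProduct, dotProduct_add, smul_dotProduct, dotProduct_smul, h.frame.unit₁,
    h.frame.unit₂, h.frame.orthogonal, hvu, smul_eq_mul]
  ring

theorem Realizes.signedArea_eq (hm : ∀ i, 0 < m i) (hsum : ∑ i, m i = 1)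
    (h : Γ.Realizes p u v) : Γ.signedArea = p.signedArea m := by
  have h₁ := Γ.cross_pos_dot hm hsum 0
  have h₂ := p.planar_cross hm hsum 0
  have h₃ : Γ.pos 0 ⨯₃ Γ.pos 1 =
      (p.planarX m 0 * p.planarY m 1 - p.planarY m 0 * p.planarX m 1) • (u ⨯₃ v) := by
    rw [h.pos, h.pos]
    simp only [map_add, map_smul, LinearMap.add_apply, LinearMap.smul_apply, cross_self,
      ← cross_anticomm u v]
    module
  have h₄ := (hm 2).ne'
  simp only [zero_add, Fin.isValue] at h₁ h₂
  rw [h₃, smul_dotProduct, ← h.normal, h.frame.unit_normal, h₂, smul_eq_mul, mul_one] at h₁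
  have : 2 * m 2 ≠ 0 := by positivity
  exact (mul_left_cancel₀ this h₁).symm

theorem Realizes.isCoord (hm : ∀ i, 0 < m i) (hsum : ∑ i, m i = 1) (h : Γ.Realizes p u v)
    (hρ : 0 < p.ρ) : IsCoord Γ.moduli p :=
  ⟨hρ, h.inertia_eq hm hsum, h.signedArea_eq hm hsum⟩

/-- Cross products of in-plane vectors with positions are multiples of the normal, so the tensor is
given by the planar second moments, whose mixed term vanishes. -/
theorem Realizes.inertiaTensor_eq (hm : ∀ i, 0 < m i) (hsum : ∑ i, m i = 1)
    (h : Γ.Realizes p u v) (a b c d : ℝ) :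
    Γ.inertiaTensor (a • u + b • v) (c • u + d • v) =
      a * c * p.eigenvalue 0 + b * d * p.eigenvalue 1 := by
  have h₁ : ∀ (a b : ℝ) i, (a • u + b • v) ⨯₃ Γ.pos i =
      (a * p.planarY m i - b * p.planarX m i) • (u ⨯₃ v) := by
    intro a b i
    rw [h.pos]
    simp only [map_add, map_smul, LinearMap.add_apply, LinearMap.smul_apply, cross_self,
      ← cross_anticomm u v]
    module
  have hx := p.sum_planarX_sq hm hsum
  have hy := p.sum_planarY_sq hm hsum
  have hxy := p.sum_planarX_mul_planarY hm hsum
  simp only [inertiaTensor, h₁, smul_dotProduct, dotProduct_smul, h.frame.unit_normal, smul_eq_mul]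
  rw [Fin.sum_univ_three] at *
  linear_combination a * c * hy + b * d * hx - (a * d + b * c) * hxy

theorem Realizes.isEigenframe (hm : ∀ i, 0 < m i) (hsum : ∑ i, m i = 1) (h : Γ.Realizes p u v)
    (hφ : Real.cos p.φ ≠ 0) : IsEigenframe Γ p u v where
  unit₁ := h.frame.unit₁
  unit₂ := h.frame.unit₂
  orthogonal := h.frame.orthogonal
  positive := h.normal
  eigen₁ := by simpa using h.inertiaTensor_eq hm hsum 1 0 1 0
  eigen₂ := by simpa using h.inertiaTensor_eq hm hsum 0 1 0 1
  eigen₁₂ := by simpa using h.inertiaTensor_eq hm hsum 1 0 0 1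
  pole := fun _ => by
    have hvu : v ⬝ᵥ u = 0 := by rw [dotProduct_comm]; exact h.frame.orthogonal
    simp [h.pos, h.frame.unit₁, h.frame.unit₂, h.frame.orthogonal, hvu,
      p.planar_frameAngle hm hsum hφ]

theorem planar_sq_pos (hm : ∀ i, 0 < m i) (hsum : ∑ i, m i = 1) (hρ : 0 < p.ρ)
    (hφ : Real.cos p.φ ≠ 0) (i : Fin 3) : 0 < p.planarX m i ^ 2 + p.planarY m i ^ 2 := by
  by_contra hle
  have hx : p.planarX m i = 0 := by nlinarith [sq_nonneg (p.planarX m i), sq_nonneg (p.planarY m i)]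
  have hy : p.planarY m i = 0 := by nlinarith [sq_nonneg (p.planarX m i), sq_nonneg (p.planarY m i)]
  have h := p.planar_cross hm hsum i
  have h₂ := hm (i + 2)
  have : 0 < √(m 0 * m 1 * m 2) := Real.sqrt_pos.2 (mul_pos (mul_pos (hm 0) (hm 1)) (hm 2))
  have h₃ : 2 * m (i + 2) * p.signedArea m ≠ 0 := by rw [Coord.signedArea]; positivity
  rw [hx, hy] at h
  exact h₃ (by linarith)

/-- Up to a common sign, the eigenframe is the frame along which the standard triangle is placed. -/
theorem exists_sign_realizes (hm : ∀ i, 0 < m i) (hsum : ∑ i, m i = 1) (h : IsCoord Γ.moduli p)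
    (hφ : Real.cos p.φ ≠ 0) {u₁ u₂ : Vec} (he : IsEigenframe Γ p u₁ u₂) :
    ∃ ε : ℝ, ε ^ 2 = 1 ∧ Γ.Realizes p (ε • u₁) (ε • u₂) := by
  obtain ⟨u, v, hr⟩ := exists_realizes hm hsum h hφ
  have hf : IsFrame u₁ u₂ := ⟨he.unit₁, he.unit₂, he.orthogonal⟩
  have hn : u₁ ⨯₃ u₂ = u ⨯₃ v := he.positive.trans hr.normal.symm
  set c := u₁ ⬝ᵥ u with hc
  set s := u₁ ⬝ᵥ v with hs
  have h₁ : u₁ = c • u + s • v := by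
    conv_lhs => rw [hr.frame.expand u₁, ← hn, IsFrame.dot_normal₁]
    simp [hc, hs]
  have h₂ : u₂ = (-s) • u + c • v := by
    rw [← neg_neg u₂, ← hf.cross_normal₁, hn, h₁]
    simp only [map_add, map_smul, LinearMap.add_apply, LinearMap.smul_apply,
      hr.frame.cross_normal₁, hr.frame.cross_normal₂]
    module
  have hvu : v ⬝ᵥ u = 0 := by rw [dotProduct_comm]; exact hr.frame.orthogonal
  have hcs : c ^ 2 + s ^ 2 = 1 := by
    have := he.unit₁
    rw [h₁] at this
    simp only [add_dotProduct, dotProduct_add, smul_dotProduct, dotProduct_smul, hr.frame.unit₁,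
      hr.frame.unit₂, hr.frame.orthogonal, hvu, smul_eq_mul] at this
    linarith
  -- The two frames differ by an in-plane rotation $(c,s)$. Away from the poles the eigenvalues are
  -- distinct and the first of them forces $\rho^2\sin\varphi\,s^2=0$. At a pole the eigenvalues
  -- coincide, and the prescribed direction of the first vertex, which is not at the origin, forces
  -- $s=0$ instead.
  have hs₀ : s = 0 := by
    by_cases hφ' : Real.sin p.φ = 0
    · have := he.pole hφ'
      have hψ := p.planar_frameAngle hm hsum hφ 0
      have hsc := Real.sin_sq_add_cos_sq (p.frameAngle m 0)
      have hpos := planar_sq_pos hm hsum h.pos hφ 0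
      rw [h₁, h₂, hr.pos] at this
      simp only [add_dotProduct, dotProduct_add, smul_dotProduct, dotProduct_smul, hr.frame.unit₁,
        hr.frame.unit₂, hr.frame.orthogonal, hvu, smul_eq_mul] at this
      generalize p.planarX m 0 = x at *
      generalize p.planarY m 0 = y at *
      generalize Real.sin (p.frameAngle m 0) = S at *
      generalize Real.cos (p.frameAngle m 0) = C at *
      have e₁ : s * (x * C + y * S) = 0 := by linear_combination this - c * hψ
      have e₂ : (x * C + y * S) ^ 2 = x ^ 2 + y ^ 2 := by
        linear_combination (x ^ 2 + y ^ 2) * hsc - (x * S - y * C) * hψ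
      rcases mul_eq_zero.1 e₁ with h | h
      · exact h
      · rw [h] at e₂; simp at e₂; linarith
    · have := he.eigen₁
      rw [h₁, hr.inertiaTensor_eq hm hsum] at this
      have hρ := h.pos
      simp only [Coord.eigenvalue, Matrix.cons_val_zero, Matrix.cons_val_one] at this
      have : p.ρ ^ 2 * Real.sin p.φ * s ^ 2 = 0 := by
        linear_combination this - p.ρ ^ 2 / 2 * (1 - Real.sin p.φ) * hcs
      have h₃ : p.ρ ^ 2 * Real.sin p.φ ≠ 0 := by positivity
      simpa [h₃] using this
  rw [hs₀] at h₁ h₂ hcs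
  have hc₁ : c ^ 2 = 1 := by linarith
  have hcc : c * c = 1 := by linarith
  have e₁ : c • u₁ = u := by rw [h₁, zero_smul, add_zero, smul_smul, hcc, one_smul]
  have e₂ : c • u₂ = v := by rw [h₂, neg_zero, zero_smul, zero_add, smul_smul, hcc, one_smul]
  exact ⟨c, hc₁, by rwa [e₁, e₂]⟩

end OrientedTriangle

/-- The matrix with the frame vectors as rows is a rotation; the transpose of the second such matrix
times the first one carries one frame to the other. -/
theorem IsFrame.exists_rotation {u v u' v' : Vec} (h : IsFrame u v) (h' : IsFrame u' v') :
    ∃ R ∈ Matrix.specialOrthogonalGroup (Fin 3) ℝ,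
      R *ᵥ u = u' ∧ R *ᵥ v = v' ∧ R *ᵥ (u ⨯₃ v) = u' ⨯₃ v' := by
  have key : ∀ {u v : Vec}, IsFrame u v →
      (Matrix.of ![u, v, u ⨯₃ v]) ∈ Matrix.specialOrthogonalGroup (Fin 3) ℝ := by
    intro u v h
    have hvu : v ⬝ᵥ u = 0 := by rw [dotProduct_comm]; exact h.orthogonal
    have hun := IsFrame.dot_normal₁ (u := u) (v := v)
    have hvn := IsFrame.dot_normal₂ (u := u) (v := v)
    have hnu := hun
    have hnv := hvn
    rw [dotProduct_comm] at hnu hnv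
    have h₁ := h.unit₁
    have h₂ := h.unit₂
    have h₃ := h.unit_normal
    have h₄ := h.orthogonal
    have hdet : (Matrix.of ![u, v, u ⨯₃ v]).det = 1 := by
      refine (triple_product_eq_det u v (u ⨯₃ v)).symm.trans ?_
      rw [h.cross_normal₂, h₁]
    refine Matrix.mem_specialOrthogonalGroup_iff.2 ⟨?_, hdet⟩
    rw [Matrix.mem_orthogonalGroup_iff]
    ext i j
    change (![u, v, u ⨯₃ v] i) ⬝ᵥ (![u, v, u ⨯₃ v] j) = _
    fin_cases i <;> fin_cases j <;> simp only [Matrix.one_apply] <;>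
      first | (simp; done) | simpa using (by assumption)
  have hM : ∀ w : Vec, Matrix.of ![u, v, u ⨯₃ v] *ᵥ w = ![u ⬝ᵥ w, v ⬝ᵥ w, (u ⨯₃ v) ⬝ᵥ w] := by
    intro w
    apply vec_ext <;> rfl
  have hM' : ∀ a b c : ℝ, (Matrix.of ![u', v', u' ⨯₃ v'])ᵀ *ᵥ ![a, b, c] =
      a • u' + b • v' + c • (u' ⨯₃ v') := by
    intro a b c
    ext k
    simp [Matrix.mulVec, dotProduct, Fin.sum_univ_three, mul_comm]
  have hvu : v ⬝ᵥ u = 0 := by rw [dotProduct_comm]; exact h.orthogonal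
  have hnu : (u ⨯₃ v) ⬝ᵥ u = 0 := by rw [dotProduct_comm]; exact IsFrame.dot_normal₁
  have hnv : (u ⨯₃ v) ⬝ᵥ v = 0 := by rw [dotProduct_comm]; exact IsFrame.dot_normal₂
  have hT : (Matrix.of ![u', v', u' ⨯₃ v'])ᵀ ∈ Matrix.specialOrthogonalGroup (Fin 3) ℝ := by
    have := Matrix.mem_specialOrthogonalGroup_iff.1 (key h')
    refine Matrix.mem_specialOrthogonalGroup_iff.2 ⟨?_, by rw [Matrix.det_transpose]; exact this.2⟩
    rw [Matrix.mem_orthogonalGroup_iff]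
    exact (Matrix.mem_orthogonalGroup_iff' (Fin 3) ℝ).1 this.1
  refine ⟨_, mul_mem hT (key h), ?_, ?_, ?_⟩ <;> rw [← Matrix.mulVec_mulVec, hM, hM']
  · simp [h.unit₁, hvu, hnu]
  · simp [h.unit₂, h.orthogonal, hnv]
  · simp [h.unit_normal]

/-- Triangles with the same coordinates are copies of one standard triangle along two frames, and a
rotation matches the frames. Coordinates therefore separate noncollinear points of the moduli space.
-/
theorem OrientedTriangle.moduli_eq_of_isCoord (hm : ∀ i, 0 < m i) (hsum : ∑ i, m i = 1)
    {Γ : OrientedTriangle m} {δ : ModuliSpace m} {p : Coord} (h : IsCoord Γ.moduli p)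
    (h' : IsCoord δ p) (hφ : Real.cos p.φ ≠ 0) : Γ.moduli = δ := by
  obtain ⟨Γ', rfl⟩ : ∃ Γ' : OrientedTriangle m, Γ'.moduli = δ := Quotient.exists_rep δ
  obtain ⟨u, v, hr⟩ := exists_realizes hm hsum h hφ
  obtain ⟨u', v', hr'⟩ := exists_realizes hm hsum h' hφ
  obtain ⟨R, hR, h₁, h₂, h₃⟩ := hr.frame.exists_rotation hr'.frame
  refine Quotient.sound ⟨R, hR, fun i => ?_, ?_⟩
  · rw [hr.pos, hr'.pos, Matrix.mulVec_add, Matrix.mulVec_smul, Matrix.mulVec_smul, h₁, h₂]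
  · rw [← hr.normal, ← hr'.normal, h₃]

end

section

variable {m : Fin 3 → ℝ}

/-! ### Kinematics in the eigenframe -/

/-- Time derivative of `Coord.planarX` along a curve of coordinates. -/
noncomputable def planarXDot (m : Fin 3 → ℝ) (γ : ℝ → Coord) (i : Fin 3) (t : ℝ) : ℝ :=
  deriv (fun s => (γ s).planarX m i) t

/-- Time derivative of `Coord.planarY` along a curve of coordinates. -/
noncomputable def planarYDot (m : Fin 3 → ℝ) (γ : ℝ → Coord) (i : Fin 3) (t : ℝ) : ℝ :=
  deriv (fun s => (γ s).planarY m i) t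

section CoordCurve

variable {δ : ℝ → ModuliSpace m} {γ : ℝ → Coord} {J : Set ℝ} {t : ℝ}

theorem _root_.ContDiffOn.hasDerivAt_deriv {f : ℝ → ℝ} {n : WithTop ℕ∞} (hf : ContDiffOn ℝ n f J)
    (hn : n ≠ 0) (hJ : IsOpen J) (ht : t ∈ J) : HasDerivAt f (deriv f t) t :=
  ((hf.differentiableOn hn).differentiableAt (hJ.mem_nhds ht)).hasDerivAt

theorem IsCoordCurve.contDiffOn_planarX (h : IsCoordCurve δ γ J) (i : Fin 3) :
    ContDiffOn ℝ 2 (fun s => (γ s).planarX m i) J := by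
  have h₁ := h.contDiffOn_ρ
  have h₂ := h.contDiffOn_φ
  have h₃ := h.contDiffOn_θ
  unfold Coord.planarX
  fun_prop

theorem IsCoordCurve.contDiffOn_planarY (h : IsCoordCurve δ γ J) (i : Fin 3) :
    ContDiffOn ℝ 2 (fun s => (γ s).planarY m i) J := by
  have h₁ := h.contDiffOn_ρ
  have h₂ := h.contDiffOn_φ
  have h₃ := h.contDiffOn_θ
  unfold Coord.planarY
  fun_prop

theorem IsCoordCurve.hasDerivAt_planarX (h : IsCoordCurve δ γ J) (hJ : IsOpen J) (ht : t ∈ J)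
    (i : Fin 3) : HasDerivAt (fun s => (γ s).planarX m i) (planarXDot m γ i t) t :=
  (h.contDiffOn_planarX i).hasDerivAt_deriv two_ne_zero hJ ht

theorem IsCoordCurve.hasDerivAt_planarY (h : IsCoordCurve δ γ J) (hJ : IsOpen J) (ht : t ∈ J)
    (i : Fin 3) : HasDerivAt (fun s => (γ s).planarY m i) (planarYDot m γ i t) t :=
  (h.contDiffOn_planarY i).hasDerivAt_deriv two_ne_zero hJ ht

theorem IsCoordCurve.hasDerivAt_planarXDot (h : IsCoordCurve δ γ J) (hJ : IsOpen J) (ht : t ∈ J)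
    (i : Fin 3) : HasDerivAt (planarXDot m γ i) (deriv (planarXDot m γ i) t) t :=
  ((h.contDiffOn_planarX i).deriv_of_isOpen hJ (m := 1) (by norm_num)).hasDerivAt_deriv
    one_ne_zero hJ ht

theorem IsCoordCurve.hasDerivAt_planarYDot (h : IsCoordCurve δ γ J) (hJ : IsOpen J) (ht : t ∈ J)
    (i : Fin 3) : HasDerivAt (planarYDot m γ i) (deriv (planarYDot m γ i) t) t :=
  ((h.contDiffOn_planarY i).deriv_of_isOpen hJ (m := 1) (by norm_num)).hasDerivAt_deriv
    one_ne_zero hJ ht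

theorem IsCoordCurve.sum_planarXDot (hm : ∀ i, 0 < m i) (hsum : ∑ i, m i = 1)
    (h : IsCoordCurve δ γ J) (hJ : IsOpen J) (ht : t ∈ J) : ∑ i, m i * planarXDot m γ i t = 0 := by
  have h₁ := HasDerivAt.fun_sum (u := Finset.univ)
    fun i _ => (h.hasDerivAt_planarX hJ ht i).const_mul (m i)
  simp only [fun s => (γ s).sum_planarX hm hsum] at h₁
  exact h₁.unique (hasDerivAt_const t 0)

theorem IsCoordCurve.sum_planarYDot (hm : ∀ i, 0 < m i) (hsum : ∑ i, m i = 1)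
    (h : IsCoordCurve δ γ J) (hJ : IsOpen J) (ht : t ∈ J) : ∑ i, m i * planarYDot m γ i t = 0 := by
  have h₁ := HasDerivAt.fun_sum (u := Finset.univ)
    fun i _ => (h.hasDerivAt_planarY hJ ht i).const_mul (m i)
  simp only [fun s => (γ s).sum_planarY hm hsum] at h₁
  exact h₁.unique (hasDerivAt_const t 0)

/-- Angular momentum of the planar motion of the standard triangle relative to its eigenframe. -/
theorem IsCoordCurve.sum_planar_cross (hm : ∀ i, 0 < m i) (hsum : ∑ i, m i = 1)
    (h : IsCoordCurve δ γ J) (hJ : IsOpen J) (ht : t ∈ J) :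
    ∑ i, m i * ((γ t).planarX m i * planarYDot m γ i t - (γ t).planarY m i * planarXDot m γ i t) =
      -((γ t).ρ ^ 2 * frameRate γ t) := by
  have hρ := h.contDiffOn_ρ.hasDerivAt_deriv two_ne_zero hJ ht
  have hφ := h.contDiffOn_φ.hasDerivAt_deriv two_ne_zero hJ ht
  have hθ := h.contDiffOn_θ.hasDerivAt_deriv two_ne_zero hJ ht
  have hα := (hφ.div_const 2).sub_const (Real.pi / 4)
  have hβ := hθ.div_const 2
  have hx := fun i => (h.hasDerivAt_planarX hJ ht i).unique
    ((hρ.fun_mul hα.cos).fun_mul ((hβ.cos.const_mul (refX m i)).fun_sub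
      (hβ.sin.const_mul (refY m i))))
  have hy := fun i => (h.hasDerivAt_planarY hJ ht i).unique
    ((hρ.fun_mul hα.sin).fun_mul ((hβ.sin.const_mul (refX m i)).fun_add
      (hβ.cos.const_mul (refY m i)))).fun_neg
  simp only [hx, hy, Coord.planarX, Coord.planarY, frameRate, Coord.cos_eq_half (γ t).φ]
  obtain ⟨-, -, h₁, h₂, h₃⟩ := ref_relations hm hsum
  have h₄ := Real.sin_sq_add_cos_sq ((γ t).θ / 2)
  generalize deriv (fun s => (γ s).ρ) t = ρ' at *
  generalize deriv (fun s => (γ s).φ) t = φ' at *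
  generalize deriv (fun s => (γ s).θ) t = θ' at *
  generalize Real.cos ((γ t).φ / 2 - Real.pi / 4) = c at *
  generalize Real.sin ((γ t).φ / 2 - Real.pi / 4) = d at *
  generalize Real.cos ((γ t).θ / 2) = k at *
  generalize Real.sin ((γ t).θ / 2) = s at *
  generalize (γ t).ρ = ρ at *
  simp only [Fin.sum_univ_three] at *
  -- The rates of $\rho$ and $\varphi$ only rescale the two axes; they are multiplied by the mixed
  -- second moment of the rotated reference triangle, which is zero. Only $\dot\theta$ contributes.
  linear_combination
    ρ * (d * (ρ' * c - ρ * d * (φ' / 2)) - c * (ρ' * d + ρ * c * (φ' / 2))) *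
        (k * s * h₁ - k * s * h₂ + (k ^ 2 - s ^ 2) * h₃) -
      ρ ^ 2 * c * d * (θ' / 2) * ((k ^ 2 + s ^ 2) * h₁ + (k ^ 2 + s ^ 2) * h₂ + 2 * h₄)

theorem inertiaDot_eq (hm : ∀ i, 0 < m i) (hsum : ∑ i, m i = 1)
    (h : IsCoordCurve δ γ J) (hJ : IsOpen J) (ht : t ∈ J) (i : Fin 3) :
    inertiaDot m γ i t = 2 * m i *
      ((γ t).planarX m i * planarXDot m γ i t + (γ t).planarY m i * planarYDot m γ i t) := by
  have h₁ := (((h.hasDerivAt_planarX hJ ht i).fun_pow 2).fun_add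
    ((h.hasDerivAt_planarY hJ ht i).fun_pow 2)).const_mul (m i)
  rw [inertiaDot]
  simp only [fun s => (γ s).inertia_eq_planar hm hsum]
  rw [h₁.deriv]
  push_cast
  ring

/-- Adding a common rotation rate $\kappa$ to the planar motion changes the angular momentum of one
vertex by $\kappa I_0$ and the total by $\kappa I$. The bracket on the right is thus unaffected by
rotation, which is why, times an area, it can be a combination of the $\dot I_j$ alone. Eliminating
one vertex by the centre of mass makes it a polynomial identity. -/
theorem planar_omega_identity {m₀ m₁ m₂ x₀ x₁ x₂ y₀ y₁ y₂ X₀ X₁ X₂ Y₀ Y₁ Y₂ : ℝ}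
    (h₂ : m₂ ≠ 0)
    (hx : m₀ * x₀ + m₁ * x₁ + m₂ * x₂ = 0) (hy : m₀ * y₀ + m₁ * y₁ + m₂ * y₂ = 0)
    (hX : m₀ * X₀ + m₁ * X₁ + m₂ * X₂ = 0) (hY : m₀ * Y₀ + m₁ * Y₁ + m₂ * Y₂ = 0)
    {I₀ I₁ I₂ D₀ D₁ D₂ : ℝ} (hI₀ : I₀ = m₀ * (x₀ ^ 2 + y₀ ^ 2)) (hI₁ : I₁ = m₁ * (x₁ ^ 2 + y₁ ^ 2))
    (hI₂ : I₂ = m₂ * (x₂ ^ 2 + y₂ ^ 2)) (hD₀ : D₀ = 2 * m₀ * (x₀ * X₀ + y₀ * Y₀))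
    (hD₁ : D₁ = 2 * m₁ * (x₁ * X₁ + y₁ * Y₁)) (hD₂ : D₂ = 2 * m₂ * (x₂ * X₂ + y₂ * Y₂)) :
    ((-(m₂ * I₂) + m₀ * I₀ + m₁ * I₁) * I₂ - (-(m₁ * I₁) + m₂ * I₂ + m₀ * I₀) * I₁) * D₀
      - (-(m₀ * I₀) + m₁ * I₁ + m₂ * I₂ + 2 * m₁ * I₂) * D₁ * I₀
      + (-(m₀ * I₀) + m₁ * I₁ + m₂ * I₂ + 2 * m₂ * I₁) * D₂ * I₀ =
    4 * m₀ * m₁ * (x₀ * y₁ - y₀ * x₁) *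
      (m₀ * (x₀ * Y₀ - y₀ * X₀) * (I₀ + I₁ + I₂) - I₀ * (m₀ * (x₀ * Y₀ - y₀ * X₀) +
        m₁ * (x₁ * Y₁ - y₁ * X₁) + m₂ * (x₂ * Y₂ - y₂ * X₂))) := by
  have ex : x₂ = -(m₀ * x₀ + m₁ * x₁) / m₂ := by rw [eq_div_iff h₂]; linarith
  have ey : y₂ = -(m₀ * y₀ + m₁ * y₁) / m₂ := by rw [eq_div_iff h₂]; linarith
  have eX : X₂ = -(m₀ * X₀ + m₁ * X₁) / m₂ := by rw [eq_div_iff h₂]; linarith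
  have eY : Y₂ = -(m₀ * Y₀ + m₁ * Y₁) / m₂ := by rw [eq_div_iff h₂]; linarith
  subst hI₀ hI₁ hI₂ hD₀ hD₁ hD₂ ex ey eX eY
  clear hx hy hX hY
  field_simp
  ring

end CoordCurve

end

/-! ### Velocities, kinetic energies and angular momentum in a moving frame -/

section

variable {m : Fin 3 → ℝ}

theorem sum_rotate {M : Type*} [AddCommMonoid M] (f : Fin 3 → M) (i : Fin 3) :
    ∑ j, f j = f i + f (i + 1) + f (i + 2) := by
  rw [Fin.sum_univ_three]
  revert i
  rw [forall_fin_three]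
  refine ⟨by simp, ?_, ?_⟩
  · simp only [Fin.isValue, Fin.reduceAdd]; abel
  · simp only [Fin.isValue, Fin.reduceAdd]; abel

theorem prod_rotate (m : Fin 3 → ℝ) (i : Fin 3) : m 0 * m 1 * m 2 = m i * m (i + 1) * m (i + 2) := by
  revert i
  simp only [forall_fin_three, Fin.isValue, Fin.reduceAdd, zero_add, true_and]
  constructor <;> ring

theorem add_one_add_one (i : Fin 3) : i + 1 + 1 = i + 2 := by revert i; decide
theorem add_one_add_two (i : Fin 3) : i + 1 + 2 = i := by revert i; decide
theorem add_two_add_one (i : Fin 3) : i + 2 + 1 = i := by revert i; decide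
theorem add_two_add_two (i : Fin 3) : i + 2 + 2 = i + 1 := by revert i; decide

/-- The rate at which the eigenframe rotates in the plane of the triangle, in a motion with angular
momentum given by `g`. -/
noncomputable def spin (γ : ℝ → Coord) (g : ℝ → Fin 3 → ℝ) (t : ℝ) : ℝ :=
  g t 2 / (γ t).ρ ^ 2 + frameRate γ t

/-- First component of the velocity of the `i`-th vertex relative to the moving eigenframe. -/
noncomputable def frameVelX (m : Fin 3 → ℝ) (γ : ℝ → Coord) (κ : ℝ → ℝ) (i : Fin 3) (t : ℝ) : ℝ :=
  planarXDot m γ i t - κ t * (γ t).planarY m i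

/-- Second component of the velocity of the `i`-th vertex relative to the moving eigenframe. -/
noncomputable def frameVelY (m : Fin 3 → ℝ) (γ : ℝ → Coord) (κ : ℝ → ℝ) (i : Fin 3) (t : ℝ) : ℝ :=
  planarYDot m γ i t + κ t * (γ t).planarX m i

/-- Third component of the velocity of the `i`-th vertex relative to the moving eigenframe. -/
noncomputable def frameVelZ (m : Fin 3 → ℝ) (γ : ℝ → Coord) (a b : ℝ → ℝ) (i : Fin 3) (t : ℝ) : ℝ :=
  a t * (γ t).planarY m i - b t * (γ t).planarX m i

variable {δ : ℝ → ModuliSpace m} {γ : ℝ → Coord} {J : Set ℝ} {t : ℝ}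

theorem IsCoordCurve.signedArea_ne_zero (hm : ∀ i, 0 < m i) (h : IsCoordCurve δ γ J)
    (ht : t ∈ J) (hφ : Real.cos (γ t).φ ≠ 0) : (γ t).signedArea m ≠ 0 := by
  have := (h.isCoord t ht).pos
  have : 0 < √(m 0 * m 1 * m 2) := Real.sqrt_pos.2 (mul_pos (mul_pos (hm 0) (hm 1)) (hm 2))
  rw [Coord.signedArea]
  positivity

/-- This identifies $\omega_i$ as the true angular velocity of the vertex in the plane. The planar
identity gives $\omega_i^0$ as its rate in the frame plus `frameRate`; the remaining term $g_3/I$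
completes the spin of the frame. -/
theorem omega_mul (hm : ∀ i, 0 < m i) (hsum : ∑ i, m i = 1)
    (h : IsCoordCurve δ γ J) (hJ : IsOpen J) (ht : t ∈ J) (hφ : Real.cos (γ t).φ ≠ 0)
    (g : ℝ → Fin 3 → ℝ) (i : Fin 3) :
    omega m γ g i t * ((γ t).planarX m i ^ 2 + (γ t).planarY m i ^ 2) =
      (γ t).planarX m i * frameVelY m γ (spin γ g) i t -
        (γ t).planarY m i * frameVelX m γ (spin γ g) i t := by
  have hρ := (h.isCoord t ht).pos
  have hA := h.signedArea_ne_zero hm ht hφ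
  have hpos := OrientedTriangle.planar_sq_pos hm hsum hρ hφ i
  have hL := h.sum_planar_cross hm hsum hJ ht
  have hI := (γ t).sum_inertia hm hsum
  have hx := (γ t).sum_planarX hm hsum
  have hy := (γ t).sum_planarY hm hsum
  have hX := h.sum_planarXDot hm hsum hJ ht
  have hY := h.sum_planarYDot hm hsum hJ ht
  rw [sum_rotate _ i] at hL hI hx hy hX hY
  have key := planar_omega_identity (hm (i + 2)).ne' hx hy hX hY
    ((γ t).inertia_eq_planar hm hsum i) ((γ t).inertia_eq_planar hm hsum (i + 1))
    ((γ t).inertia_eq_planar hm hsum (i + 2)) (inertiaDot_eq hm hsum h hJ ht i)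
    (inertiaDot_eq hm hsum h hJ ht (i + 1)) (inertiaDot_eq hm hsum h hJ ht (i + 2))
  rw [hL, hI, (γ t).planar_cross hm hsum i] at key
  have hmi := (hm i).ne'
  have hm3 := prod_rotate m i
  have hmm : m i * m (i + 1) * m (i + 2) ≠ 0 := by
    have := (hm (i + 1)).ne'
    have := (hm (i + 2)).ne'
    positivity
  have hIi := (γ t).inertia_eq_planar hm hsum i
  have hI0 : (γ t).inertia m i ≠ 0 := by rw [hIi]; positivity
  have h0 : omegaZero m γ i t * (γ t).inertia m i =
      m i * ((γ t).planarX m i * planarYDot m γ i t - (γ t).planarY m i * planarXDot m γ i t) +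
        (γ t).inertia m i * frameRate γ t := by
    rw [omegaZero, hm3]
    simp only [Coord.cevaC, add_one_add_one, add_one_add_two, add_two_add_one, add_two_add_two]
    have := (hm (i + 1)).ne'
    have := (hm (i + 2)).ne'
    field_simp
    linear_combination key
  apply mul_left_cancel₀ hmi
  rw [hIi] at h0
  rw [omega, frameVelX, frameVelY, spin]
  linear_combination h0

/-- Split the tangential velocity into parts along and across the position: $|x|^2|v|^2=(x\cdot
v)^2+(x\times v)^2$. The spin does not contribute to $x\cdot v$, so the first part is given by $\dot
I_i$; the second is given by $\omega_i$. -/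
theorem kinTangential_eq (hm : ∀ i, 0 < m i) (hsum : ∑ i, m i = 1)
    (h : IsCoordCurve δ γ J) (hJ : IsOpen J) (ht : t ∈ J) (hφ : Real.cos (γ t).φ ≠ 0)
    (g : ℝ → Fin 3 → ℝ) (i : Fin 3) :
    kinTangential m γ g i t = 1 / 2 * m i *
      (frameVelX m γ (spin γ g) i t ^ 2 + frameVelY m γ (spin γ g) i t ^ 2) := by
  have hω := omega_mul hm hsum h hJ ht hφ g i
  have hpos := OrientedTriangle.planar_sq_pos hm hsum (h.isCoord t ht).pos hφ i
  have hd := inertiaDot_eq hm hsum h hJ ht i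
  have hd' : inertiaDot m γ i t = 2 * m i * ((γ t).planarX m i * frameVelX m γ (spin γ g) i t +
      (γ t).planarY m i * frameVelY m γ (spin γ g) i t) := by
    rw [hd, frameVelX, frameVelY]; ring
  rw [kinTangential, hd', (γ t).inertia_eq_planar hm hsum]
  rw [← eq_div_iff hpos.ne'] at hω
  rw [hω]
  have := hm i
  field_simp
  ring

theorem kinNormal_eq (hm : ∀ i, 0 < m i) (hsum : ∑ i, m i = 1)
    (hφ : Real.cos (γ t).φ ≠ 0) (g : ℝ → Fin 3 → ℝ) (i : Fin 3) :
    kinNormal m γ g i t = 1 / 2 * m i * frameVelZ m γ (fun s => g s 0 / (γ s).eigenvalue 0)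
      (fun s => g s 1 / (γ s).eigenvalue 1) i t ^ 2 := by
  have hψ := (γ t).planar_frameAngle hm hsum hφ i
  have hsc := Real.sin_sq_add_cos_sq ((γ t).frameAngle m i)
  rw [kinNormal, (γ t).inertia_eq_planar hm hsum, frameVelZ]
  generalize (γ t).planarX m i = x at *
  generalize (γ t).planarY m i = y at *
  generalize Real.sin ((γ t).frameAngle m i) = S at *
  generalize Real.cos ((γ t).frameAngle m i) = C at *
  generalize g t 0 / (γ t).eigenvalue 0 = a at *
  generalize g t 1 / (γ t).eigenvalue 1 = b at *
  have e : (x ^ 2 + y ^ 2) * (a * S - b * C) ^ 2 = (a * y - b * x) ^ 2 := by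
    -- The signed radius may be negative because $\psi_i$ is known only modulo $\pi$; the square
    -- does not notice.
    obtain ⟨r, rfl, rfl⟩ : ∃ r, x = C * r ∧ y = S * r :=
      ⟨x * C + y * S, by linear_combination (-x) * hsc + S * hψ,
        by linear_combination (-y) * hsc - C * hψ⟩
    linear_combination r ^ 2 * (a * S - b * C) ^ 2 * hsc
  linear_combination m i / 2 * e

variable {u₁ u₂ : ℝ → Vec} {κ a b : ℝ → ℝ}

/-- Velocity of the vertices of a standard triangle moving with its eigenframe. -/
theorem IsCoordCurve.hasDerivAt_vertex (h : IsCoordCurve δ γ J) (hJ : IsOpen J) (ht : t ∈ J)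
    (h₁ : HasDerivAt u₁ (κ t • u₂ t - b t • (u₁ t ⨯₃ u₂ t)) t)
    (h₂ : HasDerivAt u₂ (-(κ t) • u₁ t + a t • (u₁ t ⨯₃ u₂ t)) t) (i : Fin 3) :
    HasDerivAt (fun s => (γ s).planarX m i • u₁ s + (γ s).planarY m i • u₂ s)
      (frameVelX m γ κ i t • u₁ t + frameVelY m γ κ i t • u₂ t +
        frameVelZ m γ a b i t • (u₁ t ⨯₃ u₂ t)) t := by
  refine (((h.hasDerivAt_planarX hJ ht i).fun_smul h₁).fun_add
    ((h.hasDerivAt_planarY hJ ht i).fun_smul h₂)).congr_deriv ?_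
  rw [frameVelX, frameVelY, frameVelZ]
  module

/-- Angular momentum of a standard triangle moving with its eigenframe. -/
theorem IsCoordCurve.sum_cross_velocity (hm : ∀ i, 0 < m i) (hsum : ∑ i, m i = 1)
    (h : IsCoordCurve δ γ J) (hJ : IsOpen J) (ht : t ∈ J) {u v : Vec} (hf : IsFrame u v) :
    ∑ i, m i • (((γ t).planarX m i • u + (γ t).planarY m i • v) ⨯₃
        (frameVelX m γ κ i t • u + frameVelY m γ κ i t • v + frameVelZ m γ a b i t • (u ⨯₃ v))) =
      (a t * (γ t).eigenvalue 0) • u + (b t * (γ t).eigenvalue 1) • v +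
        ((γ t).ρ ^ 2 * (κ t - frameRate γ t)) • (u ⨯₃ v) := by
  have hL := h.sum_planar_cross hm hsum hJ ht
  have hx := (γ t).sum_planarX_sq hm hsum
  have hy := (γ t).sum_planarY_sq hm hsum
  have hxy := (γ t).sum_planarX_mul_planarY hm hsum
  have hI : (γ t).eigenvalue 0 + (γ t).eigenvalue 1 = (γ t).ρ ^ 2 := by
    simp [Coord.eigenvalue]; ring
  have key : ∀ i, ((γ t).planarX m i • u + (γ t).planarY m i • v) ⨯₃
        (frameVelX m γ κ i t • u + frameVelY m γ κ i t • v + frameVelZ m γ a b i t • (u ⨯₃ v)) =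
      ((γ t).planarY m i * frameVelZ m γ a b i t) • u
      - ((γ t).planarX m i * frameVelZ m γ a b i t) • v
      + ((γ t).planarX m i * frameVelY m γ κ i t - (γ t).planarY m i * frameVelX m γ κ i t) •
        (u ⨯₃ v) := by
    intro i
    simp only [map_add, map_smul, LinearMap.add_apply, LinearMap.smul_apply, cross_self,
      ← cross_anticomm u v, hf.cross_normal₁, hf.cross_normal₂]
    module
  simp only [key, smul_add, smul_sub, Finset.sum_add_distrib, Finset.sum_sub_distrib, smul_smul,
    ← Finset.sum_smul]
  have e₁ : ∑ i, m i * ((γ t).planarY m i * frameVelZ m γ a b i t) =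
      a t * (γ t).eigenvalue 0 := by
    simp only [frameVelZ, Fin.sum_univ_three] at *
    linear_combination a t * hy - b t * hxy
  have e₂ : ∑ i, m i * ((γ t).planarX m i * frameVelZ m γ a b i t) =
      -(b t * (γ t).eigenvalue 1) := by
    simp only [frameVelZ, Fin.sum_univ_three] at *
    linear_combination a t * hxy - b t * hx
  have e₃ : ∑ i, m i * ((γ t).planarX m i * frameVelY m γ κ i t -
      (γ t).planarY m i * frameVelX m γ κ i t) = (γ t).ρ ^ 2 * (κ t - frameRate γ t) := by
    simp only [frameVelX, frameVelY, Fin.sum_univ_three] at *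
    linear_combination hL + κ t * hx + κ t * hy + κ t * hI
  rw [e₁, e₂, e₃]
  module

end

section

variable {m : Fin 3 → ℝ}

/-! ### Gravitational forces -/

namespace OrientedTriangle

variable (Γ : OrientedTriangle m)

/-- Gravitational acceleration of the `i`-th mass. -/
noncomputable def force (i : Fin 3) : Vec :=
  ∑ j ∈ Finset.univ.erase i, (m j / Γ.dist i j ^ 3) • (Γ.pos j - Γ.pos i)

theorem force_eq (i : Fin 3) : Γ.force i =
    (m (i + 1) / Γ.dist i (i + 1) ^ 3) • (Γ.pos (i + 1) - Γ.pos i) +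
      (m (i + 2) / Γ.dist i (i + 2) ^ 3) • (Γ.pos (i + 2) - Γ.pos i) := by
  have : Finset.univ.erase i = {i + 1, i + 2} := by revert i; decide
  rw [force, this, Finset.sum_pair (by revert i; decide)]

theorem dist_comm (i j : Fin 3) : Γ.dist i j = Γ.dist j i := by
  rw [dist, dist, ← neg_sub (Γ.pos j), neg_dotProduct, dotProduct_neg, neg_neg]

theorem sum_force : ∑ i, m i • Γ.force i = 0 := by
  rw [Fin.sum_univ_three]
  simp only [force_eq, Fin.isValue, Fin.reduceAdd, zero_add, Γ.dist_comm 1 0, Γ.dist_comm 2 0,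
    Γ.dist_comm 2 1]
  module

theorem sum_cross_force : ∑ i, m i • (Γ.pos i ⨯₃ Γ.force i) = 0 := by
  rw [Fin.sum_univ_three]
  simp only [force_eq, Fin.isValue, Fin.reduceAdd, zero_add, Γ.dist_comm 1 0, Γ.dist_comm 2 0,
    Γ.dist_comm 2 1, map_add, map_sub, map_smul, cross_self, ← cross_anticomm (Γ.pos 0) (Γ.pos 1),
    ← cross_anticomm (Γ.pos 0) (Γ.pos 2), ← cross_anticomm (Γ.pos 1) (Γ.pos 2)]
  module

variable {Γ} {p : Coord}

theorem dist_eq_side (hm : ∀ i, 0 < m i) (hsum : ∑ i, m i = 1) (h : IsCoord Γ.moduli p)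
    (i : Fin 3) : Γ.dist (i + 1) (i + 2) = p.side m i := by
  have hI : ∀ i, Γ.inertia i = p.inertia m i := h.inertia
  have hs := p.sum_inertia hm hsum
  have hd := Γ.two_mul_dot_pos (i + 1)
  rw [sum_rotate _ i] at hs hsum
  rw [dist, Coord.side]
  congr 1
  have h₁ := (hm (i + 1)).ne'
  have h₂ := (hm (i + 2)).ne'
  rw [eq_div_iff (mul_ne_zero h₁ h₂), ← hs, ← hI, ← hI, ← hI]
  simp only [add_one_add_one, add_one_add_two] at hd
  have e : (Γ.pos (i + 1) - Γ.pos (i + 2)) ⬝ᵥ (Γ.pos (i + 1) - Γ.pos (i + 2)) =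
      Γ.pos (i + 1) ⬝ᵥ Γ.pos (i + 1) + Γ.pos (i + 2) ⬝ᵥ Γ.pos (i + 2) -
        2 * (Γ.pos (i + 1) ⬝ᵥ Γ.pos (i + 2)) := by
    simp only [dot_eq, Pi.sub_apply]; ring
  rw [e]
  simp only [inertia] at *
  have hmi : m i = 1 - m (i + 1) - m (i + 2) := by linarith
  rw [hmi] at hd ⊢
  linear_combination -hd

/-- The inner products $\mathbf a_i\cdot\mathbf a_j$ are linear in the $I_k$ by the centre of mass
relation, so the gravitational part of $\ddot I_i$ is a function on the moduli space. -/
theorem two_mul_pos_dot_force (hm : ∀ i, 0 < m i) (hsum : ∑ i, m i = 1) (h : IsCoord Γ.moduli p)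
    (i : Fin 3) : 2 * m i * (Γ.pos i ⬝ᵥ Γ.force i) =
      - ((m i + 2 * m (i + 1)) / p.side m (i + 2) ^ 3
          + (m i + 2 * m (i + 2)) / p.side m (i + 1) ^ 3) * p.inertia m i
      - (1 / p.side m (i + 2) ^ 3 - 1 / p.side m (i + 1) ^ 3)
          * (m (i + 1) * p.inertia m (i + 1) - m (i + 2) * p.inertia m (i + 2)) := by
  have hI : ∀ i, Γ.inertia i = p.inertia m i := h.inertia
  have hI' : m i * (Γ.pos i ⬝ᵥ Γ.pos i) = p.inertia m i := hI i
  have h₁ := dist_eq_side hm hsum h (i + 2)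
  have h₂ := dist_eq_side hm hsum h (i + 1)
  have hd₁ := Γ.two_mul_dot_pos i
  have hd₂ := Γ.two_mul_dot_pos (i + 2)
  simp only [add_one_add_one, add_one_add_two, add_two_add_one,
    add_two_add_two] at h₁ h₂ hd₁ hd₂
  rw [Γ.dist_comm] at h₂
  rw [dotProduct_comm] at hd₂
  rw [force_eq, h₁, h₂]
  simp only [hI] at hd₁ hd₂
  simp only [dotProduct_add, dotProduct_smul, dotProduct_sub, smul_eq_mul]
  generalize p.side m (i + 2) ^ 3 = s at *
  generalize p.side m (i + 1) ^ 3 = s' at *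
  simp only [div_eq_mul_inv]
  linear_combination s⁻¹ * hd₁ + s'⁻¹ * hd₂ - 2 * (m (i + 1) * s⁻¹ + m (i + 2) * s'⁻¹) * hI'

/-- An infinitesimal deformation of a nondegenerate triangle which fixes the center of mass and the
distances from it, and has no angular momentum, vanishes. -/
theorem eq_zero_of_sum_cross_eq_zero (hm : ∀ i, 0 < m i) (hsum : ∑ i, m i = 1)
    (hA : Γ.signedArea ≠ 0) {d : Fin 3 → Vec} (h₀ : ∑ i, m i • d i = 0)
    (h₁ : ∑ i, m i • (Γ.pos i ⨯₃ d i) = 0) (h₂ : ∀ i, Γ.pos i ⬝ᵥ d i = 0) : d = 0 := by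
  have hc : m 0 • Γ.pos 0 + m 1 • Γ.pos 1 + m 2 • Γ.pos 2 = 0 := by
    rw [← Fin.sum_univ_three (fun i => m i • Γ.pos i)]; exact Γ.com
  have hcross : Γ.pos 0 ⨯₃ Γ.pos 1 ≠ 0 := by
    intro h
    have := Γ.cross_pos_dot hm hsum 0
    simp only [Fin.isValue, zero_add] at this
    rw [h, zero_dotProduct] at this
    exact mul_ne_zero (mul_ne_zero two_ne_zero (hm 2).ne') hA this.symm
  -- Two of the positions are independent, so the centre of mass relation is the only linear
  -- relation between the three, up to a factor.
  have key : ∀ r : Fin 3 → ℝ, ∑ i, (m i * r i) • Γ.pos i = 0 → r 0 = r 2 ∧ r 1 = r 2 := by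
    intro r hr
    rw [Fin.sum_univ_three] at hr
    have e : (m 0 * (r 0 - r 2)) • Γ.pos 0 + (m 1 * (r 1 - r 2)) • Γ.pos 1 = 0 := by
      linear_combination (norm := module) hr - r 2 • hc
    constructor
    · have := congrArg (fun w => w ⨯₃ Γ.pos 1) e
      simp only [map_add, map_smul, LinearMap.add_apply, LinearMap.smul_apply, cross_self,
        smul_zero, add_zero, map_zero, LinearMap.zero_apply] at this
      have := (smul_eq_zero.1 this).resolve_right hcross
      linarith [(mul_eq_zero.1 this).resolve_left (hm 0).ne']
    · have := congrArg (fun w => Γ.pos 0 ⨯₃ w) e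
      simp only [map_add, map_smul, cross_self, smul_zero, zero_add, map_zero] at this
      have := (smul_eq_zero.1 this).resolve_right hcross
      linarith [(mul_eq_zero.1 this).resolve_left (hm 1).ne']
  -- Crossing the angular momentum relation with the normal gives a relation between the positions,
  -- so the normal component of `d i` is the same for all vertices; the centre of mass then makes it
  -- zero.
  have hn : ∀ i, Γ.normal ⬝ᵥ d i = 0 := by
    have e : ∑ i, (m i * (Γ.normal ⬝ᵥ d i)) • Γ.pos i = 0 := by
      have := congrArg (fun w => Γ.normal ⨯₃ w) h₁
      simp only [map_sum, map_smul, map_zero, cross_cross_eq_smul_sub_smul', dotProduct_comm _ Γ.normal,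
        Γ.perp, zero_smul, sub_zero, smul_smul] at this
      exact this
    obtain ⟨e₁, e₂⟩ := key _ e
    have e₃ : Γ.normal ⬝ᵥ d 2 = 0 := by
      have := congrArg (fun w => Γ.normal ⬝ᵥ w) h₀
      simp only [Fin.sum_univ_three, dotProduct_add, dotProduct_smul, dotProduct_zero,
        smul_eq_mul, e₁, e₂] at this
      rw [Fin.sum_univ_three] at hsum
      linear_combination this - (Γ.normal ⬝ᵥ d 2) * hsum
    rw [forall_fin_three, e₁, e₂, e₃]
    simp
  have hpos : ∀ i, Γ.pos i ⬝ᵥ Γ.pos i ≠ 0 := by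
    intro i hi
    have := Γ.cross_pos_dot hm hsum i
    rw [dotProduct_self_eq_zero.1 hi, map_zero, LinearMap.zero_apply, zero_dotProduct] at this
    exact mul_ne_zero (mul_ne_zero two_ne_zero (hm (i + 2)).ne') hA this.symm
  -- Being perpendicular to both the normal and the position, each `d i` is an infinitesimal
  -- rotation of its vertex within the plane.
  have hτ : ∀ i, ∃ τ : ℝ, d i = τ • (Γ.normal ⨯₃ Γ.pos i) := by
    intro i
    set c := Γ.normal ⨯₃ Γ.pos i with hcdef
    have hcc : c ⬝ᵥ c = Γ.pos i ⬝ᵥ Γ.pos i := by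
      rw [hcdef, cross_dot_cross, Γ.unit, Γ.perp, one_mul, zero_mul, sub_zero]
    have hdc : d i ⨯₃ c = 0 := by
      rw [hcdef, cross_cross_eq_smul_sub_smul', dotProduct_comm (d i), h₂, zero_smul, zero_sub,
        hn, zero_smul, neg_zero]
    have := cross_cross_eq_smul_sub_smul' c (d i) c
    rw [hdc, map_zero, hcc] at this
    refine ⟨(d i ⬝ᵥ c) / (Γ.pos i ⬝ᵥ Γ.pos i), ?_⟩
    apply smul_right_injective _ (hpos i)
    simp only [smul_smul, mul_div_cancel₀ _ (hpos i)]
    exact sub_eq_zero.1 this.symm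
  choose τ hτ using hτ
  have hw : ∑ i, (m i * τ i) • Γ.pos i = 0 := by
    have e : Γ.normal ⨯₃ (∑ i, (m i * τ i) • Γ.pos i) = 0 := by
      simp only [hτ] at h₀
      simpa only [map_sum, map_smul, smul_smul] using h₀
    have := cross_cross_eq_smul_sub_smul' Γ.normal Γ.normal (∑ i, (m i * τ i) • Γ.pos i)
    rw [e, map_zero, Γ.unit, dotProduct_sum] at this
    simpa [dotProduct_smul, Γ.perp] using this
  obtain ⟨e₁, e₂⟩ := key _ hw
  have hall : ∀ i, τ i = τ 2 := by
    rw [forall_fin_three]; exact ⟨e₁, e₂, rfl⟩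
  have hI : 0 < ∑ i, m i * (Γ.pos i ⬝ᵥ Γ.pos i) :=
    Finset.sum_pos (fun i _ => mul_pos (hm i)
      (lt_of_le_of_ne (by simpa using dotProduct_star_self_nonneg (Γ.pos i)) (hpos i).symm))
        ⟨0, Finset.mem_univ _⟩
  -- With one common rate the deformation is a rigid rotation, whose angular momentum is the rate
  -- times the positive total inertia.
  have hτ₂ : τ 2 = 0 := by
    have := congrArg (fun w => Γ.normal ⬝ᵥ w) h₁
    simp only [hτ, hall, map_smul, cross_cross_eq_smul_sub_smul', dotProduct_comm _ Γ.normal,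
      Γ.perp, zero_smul, sub_zero, dotProduct_sum, dotProduct_smul, Γ.unit, dotProduct_zero,
      smul_eq_mul, mul_one, mul_left_comm _ (τ 2), ← Finset.mul_sum] at this
    exact (mul_eq_zero.1 this).resolve_right hI.ne'
  funext i
  rw [hτ, hall, hτ₂, zero_smul, Pi.zero_apply]

end OrientedTriangle

theorem angularMomentum_eq {Γ : ℝ → OrientedTriangle m} {J : Set ℝ} (hJ : IsOpen J)
    (hJ' : J.OrdConnected) (h : IsThreeBodyMotion Γ J) {s t : ℝ} (hs : s ∈ J) (ht : t ∈ J) :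
    angularMomentum Γ s = angularMomentum Γ t := by
  refine eq_of_hasDerivAt_zero hJ hJ' (fun r hr => ?_) hs ht
  have h₁ := HasDerivAt.fun_sum (u := Finset.univ) fun i _ =>
    (((h.differentiable r hr i).hasDerivAt.crossProduct (h.newton r hr i)).const_smul (m i))
  refine h₁.congr_deriv ?_
  change ∑ i, m i • (vel Γ i r ⨯₃ vel Γ i r + (Γ r).pos i ⨯₃ (Γ r).force i) = 0
  simp only [cross_self, zero_add, (Γ r).sum_cross_force]

end

section

variable {m : Fin 3 → ℝ}

/-! ### A motion is determined by its moduli curve, initial position and angular momentum -/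

/-- Newton's equations as a vector field on the phase space. -/
noncomputable def newtonField (m : Fin 3 → ℝ) (z : (Fin 3 → Vec) × (Fin 3 → Vec)) :
    (Fin 3 → Vec) × (Fin 3 → Vec) :=
  (z.2, fun i => ∑ j ∈ Finset.univ.erase i,
    (m j / √((z.1 i - z.1 j) ⬝ᵥ (z.1 i - z.1 j)) ^ 3) • (z.1 j - z.1 i))

theorem contDiffAt_newtonField {z : (Fin 3 → Vec) × (Fin 3 → Vec)}
    (hz : Function.Injective z.1) : ContDiffAt ℝ 1 (newtonField m) z := by
  refine contDiffAt_snd.prodMk (contDiffAt_pi.2 fun i => ContDiffAt.sum fun j hj => ?_)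
  have hij : z.1 i - z.1 j ≠ 0 := sub_ne_zero.2 fun h => (Finset.ne_of_mem_erase hj) (hz h).symm
  have h₀ : (z.1 i - z.1 j) ⬝ᵥ (z.1 i - z.1 j) ≠ 0 := fun h => hij (dotProduct_self_eq_zero.1 h)
  have h₁ : ContDiffAt ℝ 1 (fun z : (Fin 3 → Vec) × (Fin 3 → Vec) =>
      (z.1 i - z.1 j) ⬝ᵥ (z.1 i - z.1 j)) z := by
    simp only [dot_eq, Pi.sub_apply]
    fun_prop
  refine ContDiffAt.smul (contDiffAt_const.div ((h₁.sqrt h₀).pow 3) ?_) (by fun_prop)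
  exact pow_ne_zero _ (Real.sqrt_ne_zero'.2
    (lt_of_le_of_ne (by simpa using dotProduct_star_self_nonneg (z.1 i - z.1 j)) h₀.symm))

/-- The curve in phase space described by a motion. -/
noncomputable def phaseCurve (Γ : ℝ → OrientedTriangle m) (t : ℝ) :
    (Fin 3 → Vec) × (Fin 3 → Vec) :=
  ((Γ t).pos, fun i => vel Γ i t)

variable {Γ Γ' : ℝ → OrientedTriangle m} {J : Set ℝ} {t : ℝ}

theorem IsThreeBodyMotion.hasDerivAt_pos (h : IsThreeBodyMotion Γ J) (ht : t ∈ J) (i : Fin 3) :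
    HasDerivAt (fun s => (Γ s).pos i) (vel Γ i t) t :=
  (h.differentiable t ht i).hasDerivAt

theorem IsThreeBodyMotion.hasDerivAt_phaseCurve (h : IsThreeBodyMotion Γ J) (ht : t ∈ J) :
    HasDerivAt (phaseCurve Γ) (newtonField m (phaseCurve Γ t)) t :=
  (hasDerivAt_pi.2 fun i => h.hasDerivAt_pos ht i).prodMk (hasDerivAt_pi.2 fun i => h.newton t ht i)

theorem IsThreeBodyMotion.eventuallyEq (hJ : IsOpen J) (h : IsThreeBodyMotion Γ J)
    (h' : IsThreeBodyMotion Γ' J) (ht : t ∈ J) (he : phaseCurve Γ t = phaseCurve Γ' t) :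
    phaseCurve Γ =ᶠ[𝓝 t] phaseCurve Γ' := by
  obtain ⟨K, s, hs, hK⟩ := (contDiffAt_newtonField (m := m) (z := phaseCurve Γ t)
    (h.noncollision t ht)).exists_lipschitzOnWith
  refine ODE_solution_unique_of_eventually (v := fun _ => newtonField m) (s := fun _ => s) (K := K)
    (Eventually.of_forall fun _ => hK) ?_ ?_ he
  · filter_upwards [hJ.mem_nhds ht,
      (h.hasDerivAt_phaseCurve ht).continuousAt.preimage_mem_nhds hs] with r hr hrs
    exact ⟨h.hasDerivAt_phaseCurve hr, hrs⟩
  · rw [he] at hs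
    filter_upwards [hJ.mem_nhds ht,
      (h'.hasDerivAt_phaseCurve ht).continuousAt.preimage_mem_nhds hs] with r hr hrs
    exact ⟨h'.hasDerivAt_phaseCurve hr, hrs⟩

/-- The times near which the two phase curves coincide form an open set. It is also closed in $J$:
at a limit time the values agree by continuity, and local uniqueness applies there. -/
theorem IsThreeBodyMotion.eqOn_phaseCurve (hJ : IsOpen J) (hJ' : J.OrdConnected)
    (h : IsThreeBodyMotion Γ J) (h' : IsThreeBodyMotion Γ' J) (ht : t ∈ J)
    (he : phaseCurve Γ t = phaseCurve Γ' t) : EqOn (phaseCurve Γ) (phaseCurve Γ') J := by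
  have hsub : J ⊆ {r | phaseCurve Γ =ᶠ[𝓝 r] phaseCurve Γ'} := by
    refine hJ'.isPreconnected.subset_of_closure_inter_subset ?_
      ⟨t, ht, h.eventuallyEq hJ h' ht he⟩ ?_
    · exact isOpen_setOfPred_eventually_nhds
    · rintro r ⟨hr, hrJ⟩
      refine h.eventuallyEq hJ h' hrJ ?_
      by_contra hne
      have hev := ((h.hasDerivAt_phaseCurve hrJ).continuousAt.ne_iff_eventually_ne
        (h'.hasDerivAt_phaseCurve hrJ).continuousAt).1 hne
      obtain ⟨q, hq₁, hq₂⟩ := mem_closure_iff_nhds.1 hr _ hev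
      exact hq₁ hq₂.self_of_nhds
  exact fun r hr => (hsub hr).self_of_nhds

theorem moduli_eq_iff {Γ Γ' : OrientedTriangle m} : Γ.moduli = Γ'.moduli ↔ Γ.Congruent Γ' :=
  Quotient.eq (r := congruence m)

/-- The normal is recovered by dividing a cross product of positions by a multiple of the signed
area, and the latter is a function on the moduli space. -/
theorem OrientedTriangle.eq_of_pos_eq (hm : ∀ i, 0 < m i) (hsum : ∑ i, m i = 1)
    {Γ Γ' : OrientedTriangle m} (h : Γ.moduli = Γ'.moduli) (hp : Γ.pos = Γ'.pos)
    (hA : Γ.signedArea ≠ 0) : Γ = Γ' := by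
  have hA' : Γ.signedArea = Γ'.signedArea := congrArg ModuliSpace.signedArea h
  have h₁ := Γ.cross_pos hm hsum 0
  have h₂ := Γ'.cross_pos hm hsum 0
  rw [hp, h₂, ← hA'] at h₁
  have h₃ : 2 * m (0 + 2) * Γ.signedArea ≠ 0 :=
    mul_ne_zero (mul_ne_zero two_ne_zero (hm _).ne') hA
  exact OrientedTriangle.ext hp (smul_right_injective _ h₃ h₁).symm

/-- The difference of the velocities preserves the centre of mass, has no angular momentum, and is
perpendicular to the positions because the two motions have the same $|\mathbf a_j|^2$ near $t$;
rigidity makes it zero. -/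
theorem vel_eq_of_moduli_eq (hm : ∀ i, 0 < m i) (hsum : ∑ i, m i = 1) (hJ : IsOpen J)
    (h : IsThreeBodyMotion Γ J) (h' : IsThreeBodyMotion Γ' J) (ht : t ∈ J)
    (hmod : ∀ s ∈ J, (Γ s).moduli = (Γ' s).moduli) (h₀ : Γ t = Γ' t)
    (hΩ : angularMomentum Γ t = angularMomentum Γ' t) (hA : (Γ t).signedArea ≠ 0) (i : Fin 3) :
    vel Γ i t = vel Γ' i t := by
  have hcom : ∀ {Γ : ℝ → OrientedTriangle m}, IsThreeBodyMotion Γ J → ∑ i, m i • vel Γ i t = 0 := by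
    intro Γ h
    have := HasDerivAt.fun_sum (u := Finset.univ)
      fun i _ => (h.hasDerivAt_pos ht i).fun_const_smul (m i)
    simp only [fun s => (Γ s).com] at this
    exact this.unique (hasDerivAt_const t 0)
  have := OrientedTriangle.eq_zero_of_sum_cross_eq_zero hm hsum hA
    (d := fun i => vel Γ i t - vel Γ' i t) ?_ ?_ ?_
  · exact sub_eq_zero.1 (congrFun this i)
  · simp only [smul_sub, Finset.sum_sub_distrib, hcom h, hcom h', sub_zero]
  · simp only [map_sub, smul_sub, Finset.sum_sub_distrib]
    rw [sub_eq_zero]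
    have := hΩ
    simp only [angularMomentum, ← h₀] at this
    exact this
  · intro j
    have e₁ := (h.hasDerivAt_pos ht j).dotProduct (h.hasDerivAt_pos ht j)
    have e₂ := (h'.hasDerivAt_pos ht j).dotProduct (h'.hasDerivAt_pos ht j)
    have e₃ : (fun s => (Γ s).pos j ⬝ᵥ (Γ s).pos j) =ᶠ[𝓝 t]
        fun s => (Γ' s).pos j ⬝ᵥ (Γ' s).pos j := by
      filter_upwards [hJ.mem_nhds ht] with s hs
      obtain ⟨R, hR, hp, -⟩ := moduli_eq_iff.1 (hmod s hs)
      rw [← hp, rot_dot hR]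
    have e₄ := e₁.unique (e₂.congr_of_eventuallyEq e₃)
    rw [← h₀, dotProduct_comm _ ((Γ t).pos j), dotProduct_comm _ ((Γ t).pos j)] at e₄
    rw [dotProduct_sub]
    linarith

/-- Nondegeneracy is needed only at the initial time, to fix the velocities. Afterwards uniqueness
in phase space only requires the absence of collisions; passing through collinear positions leaves
the positions determined, but not the normal at those times. -/
theorem IsThreeBodyMotion.determined (hm : ∀ i, 0 < m i) (hsum : ∑ i, m i = 1) (hJ : IsOpen J)
    (hJ' : J.OrdConnected) (h : IsThreeBodyMotion Γ J) (h' : IsThreeBodyMotion Γ' J) {t₀ : ℝ}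
    (ht₀ : t₀ ∈ J) (hΩ : angularMomentum Γ t₀ = angularMomentum Γ' t₀)
    (hmod : ∀ s ∈ J, (Γ s).moduli = (Γ' s).moduli) (h₀ : Γ t₀ = Γ' t₀)
    (hA : (Γ t₀).Nondegenerate) (ht : t ∈ J) :
    (Γ t).pos = (Γ' t).pos ∧ ((Γ t).Nondegenerate → Γ t = Γ' t) := by
  have he : phaseCurve Γ t₀ = phaseCurve Γ' t₀ := by
    refine Prod.ext (congrArg OrientedTriangle.pos h₀) (funext fun i => ?_)
    exact vel_eq_of_moduli_eq hm hsum hJ h h' ht₀ hmod h₀ hΩ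
      ((Γ t₀).signedArea_ne_zero hA) i
  have hp : (Γ t).pos = (Γ' t).pos :=
    congrArg Prod.fst (h.eqOn_phaseCurve hJ hJ' h' ht₀ he ht)
  exact ⟨hp, fun hn => OrientedTriangle.eq_of_pos_eq hm hsum (hmod t ht) hp
    ((Γ t).signedArea_ne_zero hn)⟩

end

section

variable {m : Fin 3 → ℝ}

/-! ### The reduced equations -/

/-- Differentiating the orthonormality relations shows that the matrix of the derivative in the
frame is skew-symmetric, leaving three angular velocity components. -/
theorem IsFrame.hasDerivAt_eq {u₁ u₂ : ℝ → Vec} {u₁' u₂' : Vec} {t : ℝ}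
    (hf : ∀ᶠ s in 𝓝 t, IsFrame (u₁ s) (u₂ s)) (h₁ : HasDerivAt u₁ u₁' t)
    (h₂ : HasDerivAt u₂ u₂' t) : ∃ κ a b : ℝ, u₁' = κ • u₂ t - b • (u₁ t ⨯₃ u₂ t) ∧
      u₂' = -κ • u₁ t + a • (u₁ t ⨯₃ u₂ t) := by
  have e₁ : u₁' ⬝ᵥ u₁ t + u₁ t ⬝ᵥ u₁' = 0 :=
    (h₁.dotProduct h₁).unique ((hasDerivAt_const t 1).congr_of_eventuallyEq
      (hf.mono fun s hs => hs.unit₁))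
  have e₂ : u₂' ⬝ᵥ u₂ t + u₂ t ⬝ᵥ u₂' = 0 :=
    (h₂.dotProduct h₂).unique ((hasDerivAt_const t 1).congr_of_eventuallyEq
      (hf.mono fun s hs => hs.unit₂))
  have e₃ : u₁' ⬝ᵥ u₂ t + u₁ t ⬝ᵥ u₂' = 0 :=
    (h₁.dotProduct h₂).unique ((hasDerivAt_const t 0).congr_of_eventuallyEq
      (hf.mono fun s hs => hs.orthogonal))
  rw [dotProduct_comm (u₁ t)] at e₁ e₃
  rw [dotProduct_comm (u₂ t)] at e₂
  refine ⟨u₁' ⬝ᵥ u₂ t, u₂' ⬝ᵥ (u₁ t ⨯₃ u₂ t), -(u₁' ⬝ᵥ (u₁ t ⨯₃ u₂ t)), ?_, ?_⟩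
  · conv_lhs => rw [hf.self_of_nhds.expand u₁']
    rw [show u₁' ⬝ᵥ u₁ t = 0 by linarith]
    module
  · conv_lhs => rw [hf.self_of_nhds.expand u₂']
    rw [show u₂' ⬝ᵥ u₂ t = 0 by linarith, show u₂' ⬝ᵥ u₁ t = -(u₁' ⬝ᵥ u₂ t) by linarith]
    module

theorem IsFrame.combination_eq_iff {u v : Vec} (h : IsFrame u v) {a b c a' b' c' : ℝ} :
    a • u + b • v + c • (u ⨯₃ v) = a' • u + b' • v + c' • (u ⨯₃ v) ↔
      a = a' ∧ b = b' ∧ c = c' := by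
  constructor
  · intro he
    have hvu : v ⬝ᵥ u = 0 := by rw [dotProduct_comm]; exact h.orthogonal
    have hnu : (u ⨯₃ v) ⬝ᵥ u = 0 := by rw [dotProduct_comm]; exact IsFrame.dot_normal₁
    have hnv : (u ⨯₃ v) ⬝ᵥ v = 0 := by rw [dotProduct_comm]; exact IsFrame.dot_normal₂
    have h₁ := congrArg (fun w => w ⬝ᵥ u) he
    have h₂ := congrArg (fun w => w ⬝ᵥ v) he
    have h₃ := congrArg (fun w => w ⬝ᵥ (u ⨯₃ v)) he
    simp only [add_dotProduct, smul_dotProduct, h.unit₁, h.unit₂, h.orthogonal, hvu, hnu, hnv,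
      h.unit_normal, IsFrame.dot_normal₁, IsFrame.dot_normal₂, smul_eq_mul, mul_one, mul_zero,
      add_zero, zero_add] at h₁ h₂ h₃
    exact ⟨h₁, h₂, h₃⟩
  · rintro ⟨rfl, rfl, rfl⟩
    rfl

theorem IsFrame.dot_combination {u v : Vec} (h : IsFrame u v) (a b c : ℝ) :
    (a • u + b • v + c • (u ⨯₃ v)) ⬝ᵥ (u ⨯₃ v) = c ∧
      (a • u + b • v + c • (u ⨯₃ v)) ⬝ᵥ (a • u + b • v + c • (u ⨯₃ v)) = a ^ 2 + b ^ 2 + c ^ 2 := by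
  have hvu : v ⬝ᵥ u = 0 := by rw [dotProduct_comm]; exact h.orthogonal
  have hnu : (u ⨯₃ v) ⬝ᵥ u = 0 := by rw [dotProduct_comm]; exact IsFrame.dot_normal₁
  have hnv : (u ⨯₃ v) ⬝ᵥ v = 0 := by rw [dotProduct_comm]; exact IsFrame.dot_normal₂
  simp only [add_dotProduct, smul_dotProduct, dotProduct_add, dotProduct_smul, h.unit₁, h.unit₂,
    h.orthogonal, hvu, hnu, hnv, h.unit_normal, IsFrame.dot_normal₁, IsFrame.dot_normal₂,
    smul_eq_mul, mul_one, mul_zero, add_zero, zero_add]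
  exact ⟨trivial, by ring⟩

variable {δ : ℝ → ModuliSpace m} {Γ : ℝ → OrientedTriangle m} {γ : ℝ → Coord} {J : Set ℝ} {t : ℝ}
  {u₁ u₂ : ℝ → Vec} {g : ℝ → Fin 3 → ℝ}

/-- Velocity of the `i`-th vertex of the standard triangle with coordinates `γ`, moving with a frame
whose rotation is determined by the angular momentum `g`. -/
noncomputable def frameVel (m : Fin 3 → ℝ) (γ : ℝ → Coord) (g : ℝ → Fin 3 → ℝ) (u₁ u₂ : ℝ → Vec)
    (i : Fin 3) (t : ℝ) : Vec :=
  frameVelX m γ (spin γ g) i t • u₁ t + frameVelY m γ (spin γ g) i t • u₂ t +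
    frameVelZ m γ (fun s => g s 0 / (γ s).eigenvalue 0) (fun s => g s 1 / (γ s).eigenvalue 1) i t •
      (u₁ t ⨯₃ u₂ t)

/-- The equations of motion of a frame whose rotation is determined by the angular momentum. -/
def FrameEquations (γ : ℝ → Coord) (g : ℝ → Fin 3 → ℝ) (u₁ u₂ : ℝ → Vec) (J : Set ℝ) : Prop :=
  ∀ t ∈ J,
    HasDerivAt u₁ (spin γ g t • u₂ t - (g t 1 / (γ t).eigenvalue 1) • (u₁ t ⨯₃ u₂ t)) t ∧
    HasDerivAt u₂ (-(spin γ g t) • u₁ t + (g t 0 / (γ t).eigenvalue 0) • (u₁ t ⨯₃ u₂ t)) t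

theorem hasDerivAt_pos_of_frameEquations (hJ : IsOpen J) (hc : IsCoordCurve δ γ J)
    (hr : ∀ t ∈ J, (Γ t).Realizes (γ t) (u₁ t) (u₂ t)) (hF : FrameEquations γ g u₁ u₂ J)
    (ht : t ∈ J) (i : Fin 3) :
    HasDerivAt (fun s => (Γ s).pos i) (frameVel m γ g u₁ u₂ i t) t := by
  refine (hc.hasDerivAt_vertex (a := fun s => g s 0 / (γ s).eigenvalue 0)
    (b := fun s => g s 1 / (γ s).eigenvalue 1) hJ ht (hF t ht).1 (hF t ht).2
    i).congr_of_eventuallyEq ?_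
  filter_upwards [hJ.mem_nhds ht] with s hs
  exact (hr s hs).pos i

theorem kinetic_energies (hm : ∀ i, 0 < m i) (hsum : ∑ i, m i = 1) (hJ : IsOpen J)
    (hc : IsCoordCurve δ γ J) (hφ : ∀ t ∈ J, Real.cos (γ t).φ ≠ 0)
    (hr : ∀ t ∈ J, (Γ t).Realizes (γ t) (u₁ t) (u₂ t)) (hF : FrameEquations γ g u₁ u₂ J)
    (ht : t ∈ J) (i : Fin 3) :
    kinTangential m γ g i t =
        1 / 2 * m i * (vel Γ i t ⬝ᵥ vel Γ i t - (vel Γ i t ⬝ᵥ (Γ t).normal) ^ 2) ∧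
      kinNormal m γ g i t = 1 / 2 * m i * (vel Γ i t ⬝ᵥ (Γ t).normal) ^ 2 := by
  have hv : vel Γ i t = frameVel m γ g u₁ u₂ i t :=
    (hasDerivAt_pos_of_frameEquations hJ hc hr hF ht i).deriv
  have hf := (hr t ht).frame
  rw [hv, ← (hr t ht).normal, frameVel, (hf.dot_combination _ _ _).1, (hf.dot_combination _ _ _).2,
    kinTangential_eq hm hsum hc hJ ht (hφ t ht), kinNormal_eq hm hsum (hφ t ht)]
  exact ⟨by ring, rfl⟩

/-- This is $\tfrac{d^2}{dt^2}\,m|\mathbf a|^2=2m|\dot{\mathbf a}|^2+2m\,\mathbf a\cdot\ddot{\mathbf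
a}$. The acceleration `w` is left arbitrary, so the identity serves both for a motion and for a
curve whose Newton equations are still to be shown. -/
theorem deriv_inertiaDot_eq (hm : ∀ i, 0 < m i) (hsum : ∑ i, m i = 1) (hJ : IsOpen J)
    (hc : IsCoordCurve δ γ J) (hφ : ∀ t ∈ J, Real.cos (γ t).φ ≠ 0)
    (hr : ∀ t ∈ J, (Γ t).Realizes (γ t) (u₁ t) (u₂ t)) (hF : FrameEquations γ g u₁ u₂ J)
    (ht : t ∈ J) {i : Fin 3} {w : Vec} (hw : HasDerivAt (vel Γ i) w t) :
    deriv (inertiaDot m γ i) t =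
      4 * (kinTangential m γ g i t + kinNormal m γ g i t) + 2 * m i * ((Γ t).pos i ⬝ᵥ w) := by
  obtain ⟨h₁, h₂⟩ := kinetic_energies hm hsum hJ hc hφ hr hF ht i
  have hp : ∀ s ∈ J, HasDerivAt (fun s => (Γ s).pos i) (vel Γ i s) s := fun s hs =>
    (hasDerivAt_pos_of_frameEquations hJ hc hr hF hs i).differentiableAt.hasDerivAt
  have hI : inertiaDot m γ i =ᶠ[𝓝 t] fun s => 2 * m i * ((Γ s).pos i ⬝ᵥ vel Γ i s) := by
    filter_upwards [hJ.mem_nhds ht] with s hs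
    refine HasDerivAt.deriv ?_
    refine ((((hp s hs).dotProduct (hp s hs)).const_mul (m i)).congr_of_eventuallyEq
      ?_).congr_deriv ?_
    · filter_upwards [hJ.mem_nhds hs] with r hr'
      exact ((hr r hr').inertia_eq hm hsum i).symm
    · rw [dotProduct_comm (vel Γ i s)]; ring
  rw [hI.deriv_eq, (((hp t ht).dotProduct hw).const_mul (2 * m i)).deriv, h₁, h₂]
  ring

/-- Any differentiable orthonormal frame rotates with some angular velocity. Computing the angular
momentum from it and comparing coefficients in the frame determines its components as
$g_1/\lambda_1$, $g_2/\lambda_2$ and the spin. -/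
theorem IsThreeBodyMotion.frameEquations (hm : ∀ i, 0 < m i) (hsum : ∑ i, m i = 1) (hJ : IsOpen J)
    (h : IsThreeBodyMotion Γ J) (hc : IsCoordCurve δ γ J) (hφ : ∀ t ∈ J, Real.cos (γ t).φ ≠ 0)
    (hr : ∀ t ∈ J, (Γ t).Realizes (γ t) (u₁ t) (u₂ t))
    (hg : ∀ t ∈ J, g t = frameCoords (angularMomentum Γ t) (u₁ t) (u₂ t) (Γ t).normal) :
    FrameEquations γ g u₁ u₂ J := by
  intro t ht
  have hρ := (hc.isCoord t ht).pos
  have hD : ∀ s ∈ J, (γ s).planarX m 0 * (γ s).planarY m 1 -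
      (γ s).planarY m 0 * (γ s).planarX m 1 ≠ 0 := by
    intro s hs
    have := (γ s).planar_cross hm hsum 0
    simp only [Fin.isValue, zero_add] at this
    rw [this]
    exact mul_ne_zero (mul_ne_zero two_ne_zero (hm 2).ne') (hc.signedArea_ne_zero hm hs (hφ s hs))
  have hx := fun i => (hc.hasDerivAt_planarX hJ ht i).differentiableAt
  have hy := fun i => (hc.hasDerivAt_planarY hJ ht i).differentiableAt
  have hDd : DifferentiableAt ℝ (fun s => (γ s).planarX m 0 * (γ s).planarY m 1 -
      (γ s).planarY m 0 * (γ s).planarX m 1) t :=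
    ((hx 0).fun_mul (hy 1)).fun_sub ((hy 0).fun_mul (hx 1))
  -- Solving the placement of two vertices for the frame vectors, by the inverse of the planar
  -- coordinate matrix, makes the frame as regular as positions and coordinates allow.
  have hd₁ : DifferentiableAt ℝ u₁ t := by
    have := (hDd.fun_inv (hD t ht)).fun_smul
      (((hy 1).fun_smul (h.differentiable t ht 0)).fun_sub
        ((hy 0).fun_smul (h.differentiable t ht 1)))
    refine this.congr_of_eventuallyEq ?_
    filter_upwards [hJ.mem_nhds ht] with s hs
    rw [(hr s hs).pos, (hr s hs).pos]
    apply smul_right_injective _ (hD s hs)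
    simp only
    rw [smul_inv_smul₀ (hD s hs)]
    module
  have hd₂ : DifferentiableAt ℝ u₂ t := by
    have := (hDd.fun_inv (hD t ht)).fun_smul
      (((hx 0).fun_smul (h.differentiable t ht 1)).fun_sub
        ((hx 1).fun_smul (h.differentiable t ht 0)))
    refine this.congr_of_eventuallyEq ?_
    filter_upwards [hJ.mem_nhds ht] with s hs
    rw [(hr s hs).pos, (hr s hs).pos]
    apply smul_right_injective _ (hD s hs)
    simp only
    rw [smul_inv_smul₀ (hD s hs)]
    module
  have hf := (hr t ht).frame
  obtain ⟨κ, a, b, e₁, e₂⟩ := IsFrame.hasDerivAt_eq (u₁ := u₁) (u₂ := u₂)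
    (by filter_upwards [hJ.mem_nhds ht] with s hs using (hr s hs).frame) hd₁.hasDerivAt
    hd₂.hasDerivAt
  have h₁ := hd₁.hasDerivAt
  have h₂ := hd₂.hasDerivAt
  rw [e₁] at h₁
  rw [e₂] at h₂
  have hv : ∀ i, vel Γ i t = frameVelX m γ (fun _ => κ) i t • u₁ t +
      frameVelY m γ (fun _ => κ) i t • u₂ t +
        frameVelZ m γ (fun _ => a) (fun _ => b) i t • (u₁ t ⨯₃ u₂ t) := by
    intro i
    refine HasDerivAt.deriv ((hc.hasDerivAt_vertex (κ := fun _ => κ) (a := fun _ => a)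
      (b := fun _ => b) hJ ht h₁ h₂ i).congr_of_eventuallyEq ?_)
    filter_upwards [hJ.mem_nhds ht] with s hs
    exact (hr s hs).pos i
  have hL : angularMomentum Γ t = (a * (γ t).eigenvalue 0) • u₁ t + (b * (γ t).eigenvalue 1) • u₂ t +
      ((γ t).ρ ^ 2 * (κ - frameRate γ t)) • (u₁ t ⨯₃ u₂ t) := by
    rw [← hc.sum_cross_velocity (κ := fun _ => κ) (a := fun _ => a) (b := fun _ => b) hm hsum hJ ht
      hf]
    simp only [angularMomentum, hv, (hr t ht).pos]
  have hL' := hf.expand (angularMomentum Γ t)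
  conv_lhs at hL' => rw [hL]
  obtain ⟨c₁, c₂, c₃⟩ := hf.combination_eq_iff.1 hL'
  have hg₀ : g t 0 = a * (γ t).eigenvalue 0 := by rw [hg t ht, c₁]; rfl
  have hg₁ : g t 1 = b * (γ t).eigenvalue 1 := by rw [hg t ht, c₂]; rfl
  have hg₂ : g t 2 = (γ t).ρ ^ 2 * (κ - frameRate γ t) := by
    rw [hg t ht, c₃, (hr t ht).normal]; rfl
  have hl := (γ t).eigenvalue_pos hρ (hφ t ht)
  have hκ : spin γ g t = κ := by
    rw [spin, hg₂, mul_div_cancel_left₀ _ (pow_ne_zero 2 hρ.ne')]; ring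
  rw [hκ, hg₀, hg₁, mul_div_cancel_right₀ _ (hl 0).ne', mul_div_cancel_right₀ _ (hl 1).ne']
  exact ⟨h₁, h₂⟩

theorem FrameEquations.hasDerivAt_cross (hF : FrameEquations γ g u₁ u₂ J)
    (hf : IsFrame (u₁ t) (u₂ t)) (ht : t ∈ J) :
    HasDerivAt (fun s => u₁ s ⨯₃ u₂ s) ((g t 1 / (γ t).eigenvalue 1) • u₁ t -
      (g t 0 / (γ t).eigenvalue 0) • u₂ t) t := by
  refine ((hF t ht).1.crossProduct (hF t ht).2).congr_deriv ?_
  simp only [map_add, map_sub, map_smul, LinearMap.sub_apply,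
    LinearMap.smul_apply, cross_self, hf.cross_normal₁, ← cross_anticomm (u₂ t) (u₁ t ⨯₃ u₂ t),
    hf.cross_normal₂]
  module

/-- Only $\Omega$ being a fixed vector is used: each $g_i$ is its inner product with a frame vector
whose derivative is known. -/
theorem FrameEquations.eulerEquations (hF : FrameEquations γ g u₁ u₂ J)
    (hJ : IsOpen J) (hf : ∀ t ∈ J, IsFrame (u₁ t) (u₂ t)) {Ω : Vec}
    (hg : ∀ t ∈ J, g t = frameCoords Ω (u₁ t) (u₂ t) (u₁ t ⨯₃ u₂ t)) : EulerEquations γ g J := by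
  have hcoord : ∀ t ∈ J, Ω ⬝ᵥ u₁ t = g t 0 ∧ Ω ⬝ᵥ u₂ t = g t 1 ∧ Ω ⬝ᵥ (u₁ t ⨯₃ u₂ t) = g t 2 := by
    intro t ht
    rw [hg t ht]
    exact ⟨rfl, rfl, rfl⟩
  have he : ∀ p : Coord, p.eigenvalue 2 = p.ρ ^ 2 := fun _ => rfl
  refine ⟨fun t ht => ?_, fun t ht => ?_, fun t ht => ?_⟩
  · refine (((hasDerivAt_const t Ω).dotProduct (hF t ht).1).congr_of_eventuallyEq
      ?_).congr_deriv ?_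
    · filter_upwards [hJ.mem_nhds ht] with s hs using (hcoord s hs).1.symm
    · obtain ⟨c₁, c₂, c₃⟩ := hcoord t ht
      simp only [zero_dotProduct, dotProduct_sub, dotProduct_smul, c₂, c₃, smul_eq_mul, he, spin]
      ring
  · refine (((hasDerivAt_const t Ω).dotProduct (hF t ht).2).congr_of_eventuallyEq
      ?_).congr_deriv ?_
    · filter_upwards [hJ.mem_nhds ht] with s hs using (hcoord s hs).2.1.symm
    · obtain ⟨c₁, c₂, c₃⟩ := hcoord t ht
      simp only [zero_dotProduct, dotProduct_add, dotProduct_smul, c₁, c₃, smul_eq_mul, he, spin]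
      ring
  · refine (((hasDerivAt_const t Ω).dotProduct (hF.hasDerivAt_cross (hf t ht)
      ht)).congr_of_eventuallyEq ?_).congr_deriv ?_
    · filter_upwards [hJ.mem_nhds ht] with s hs using (hcoord s hs).2.2.symm
    · obtain ⟨c₁, c₂, c₃⟩ := hcoord t ht
      simp only [zero_dotProduct, dotProduct_sub, dotProduct_smul, c₁, c₂, smul_eq_mul]
      ring

theorem IsThreeBodyMotion.reducedNewton (hm : ∀ i, 0 < m i) (hsum : ∑ i, m i = 1) (hJ : IsOpen J)
    (h : IsThreeBodyMotion Γ J) (hc : IsCoordCurve (fun t => (Γ t).moduli) γ J)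
    (hφ : ∀ t ∈ J, Real.cos (γ t).φ ≠ 0)
    (hr : ∀ t ∈ J, (Γ t).Realizes (γ t) (u₁ t) (u₂ t)) (hF : FrameEquations γ g u₁ u₂ J) :
    ReducedNewton m γ g J := by
  intro t ht i
  have hN : HasDerivAt (vel Γ i) ((Γ t).force i) t := h.newton t ht i
  rw [deriv_inertiaDot_eq hm hsum hJ hc hφ hr hF ht hN,
    OrientedTriangle.two_mul_pos_dot_force hm hsum (hc.isCoord t ht)]
  ring

/-! ### Change of sign of the frame -/

/-- Coordinates of the angular momentum in the frame with the first two vectors multiplied by the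
sign `ε`. -/
def signChange (ε : ℝ) (g : ℝ → Fin 3 → ℝ) (t : ℝ) : Fin 3 → ℝ := ![ε * g t 0, ε * g t 1, g t 2]

variable {ε : ℝ}

theorem signChange_signChange (hε : ε ^ 2 = 1) : signChange ε (signChange ε g) = g := by
  funext t i
  revert i
  simp only [forall_fin_three, signChange, Matrix.cons_val_zero, Matrix.cons_val_one,
    Matrix.cons_val]
  refine ⟨by linear_combination g t 0 * hε, by linear_combination g t 1 * hε, trivial⟩

theorem kinTangential_signChange (i : Fin 3) :
    kinTangential m γ (signChange ε g) i t = kinTangential m γ g i t := rfl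

theorem kinNormal_signChange (hε : ε ^ 2 = 1) (i : Fin 3) :
    kinNormal m γ (signChange ε g) i t = kinNormal m γ g i t := by
  simp only [kinNormal, signChange, Matrix.cons_val_zero, Matrix.cons_val_one]
  linear_combination (1 / 2 * (γ t).inertia m i *
    (g t 0 / (γ t).eigenvalue 0 * Real.sin ((γ t).frameAngle m i)
      - g t 1 / (γ t).eigenvalue 1 * Real.cos ((γ t).frameAngle m i)) ^ 2) * hε

theorem ReducedNewton.signChange (hε : ε ^ 2 = 1) (h : ReducedNewton m γ g J) :
    ReducedNewton m γ (signChange ε g) J := by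
  intro t ht i
  rw [kinTangential_signChange, kinNormal_signChange hε]
  exact h t ht i

/-- The first two equations are linear in $(g_1,g_2)$ for given $g_3$, and the third contains only
the product $g_1g_2$. -/
theorem EulerEquations.signChange (hε : ε ^ 2 = 1) (h : EulerEquations γ g J) :
    EulerEquations γ (signChange ε g) J := by
  refine ⟨fun t ht => ?_, fun t ht => ?_, fun t ht => ?_⟩
  · refine ((h.euler₁ t ht).const_mul ε).congr_deriv ?_
    simp only [ThreeBody.signChange, Matrix.cons_val_zero, Matrix.cons_val_one, Matrix.cons_val]
    ring
  · refine ((h.euler₂ t ht).const_mul ε).congr_deriv ?_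
    simp only [ThreeBody.signChange, Matrix.cons_val_zero, Matrix.cons_val]
    ring
  · refine (h.euler₃ t ht).congr_deriv ?_
    simp only [ThreeBody.signChange, Matrix.cons_val_zero, Matrix.cons_val_one]
    linear_combination -(g t 0 * g t 1 * (1 / (γ t).eigenvalue 1 - 1 / (γ t).eigenvalue 0)) * hε

end

/-! ### The sign of an eigenframe along a curve -/

section

variable {m : Fin 3 → ℝ} {δ : ℝ → ModuliSpace m} {Γ : ℝ → OrientedTriangle m} {γ : ℝ → Coord}
  {J : Set ℝ} {t : ℝ} {u₁ u₂ : ℝ → Vec} {g : ℝ → Fin 3 → ℝ}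

theorem cos_ne_zero_of_nondegenerate {Γ : OrientedTriangle m} {p : Coord}
    (h : IsCoord Γ.moduli p) (hn : Γ.Nondegenerate) : Real.cos p.φ ≠ 0 := by
  intro h₀
  have hA : Γ.signedArea = p.signedArea m := h.area
  rw [Coord.signedArea, h₀, mul_zero, zero_div] at hA
  exact Γ.signedArea_ne_zero hn hA

theorem IsCoordCurve.planar_det_ne_zero (hm : ∀ i, 0 < m i) (hsum : ∑ i, m i = 1)
    (hc : IsCoordCurve δ γ J) (hφ : ∀ t ∈ J, Real.cos (γ t).φ ≠ 0) :
    ∀ s ∈ J, (γ s).planarX m 0 * (γ s).planarY m 1 -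
      (γ s).planarY m 0 * (γ s).planarX m 1 ≠ 0 := by
  intro s hs
  have := (γ s).planar_cross hm hsum 0
  simp only [Fin.isValue, zero_add] at this
  rw [this]
  exact mul_ne_zero (mul_ne_zero two_ne_zero (hm 2).ne') (hc.signedArea_ne_zero hm hs (hφ s hs))

/-- Pairing the eigenvector with the expression of the standard frame in terms of two positions
writes the pointwise sign as a quotient of continuous functions; on an interval it is constant. -/
theorem IsMovingEigenframe.exists_sign (hm : ∀ i, 0 < m i) (hsum : ∑ i, m i = 1)
    (hJ' : J.OrdConnected) (hpos : ∀ i, ContinuousOn (fun t => (Γ t).pos i) J)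
    (hc : IsCoordCurve (fun t => (Γ t).moduli) γ J) (hφ : ∀ t ∈ J, Real.cos (γ t).φ ≠ 0)
    (hu : IsMovingEigenframe Γ γ u₁ u₂ J) :
    ∃ ε : ℝ, ε ^ 2 = 1 ∧ ∀ t ∈ J, (Γ t).Realizes (γ t) (ε • u₁ t) (ε • u₂ t) := by
  choose! ε hε hr using fun t ht =>
    OrientedTriangle.exists_sign_realizes hm hsum (hc.isCoord t ht) (hφ t ht) (hu.isEigenframe t ht)
  have hx := fun i => (hc.contDiffOn_planarX i).continuousOn
  have hy := fun i => (hc.contDiffOn_planarY i).continuousOn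
  have hD := hc.planar_det_ne_zero hm hsum hφ
  have hcont : ContinuousOn ε J := by
    have hw : ContinuousOn (fun s => (γ s).planarY m 1 • (Γ s).pos 0 -
        (γ s).planarY m 0 • (Γ s).pos 1) J :=
      ((hy 1).smul (hpos 0)).sub ((hy 0).smul (hpos 1))
    have hdot : ContinuousOn (fun s => ((γ s).planarY m 1 • (Γ s).pos 0 -
        (γ s).planarY m 0 • (Γ s).pos 1) ⬝ᵥ u₁ s) J := by
      have h₁ := continuousOn_pi.1 hw
      have h₂ := continuousOn_pi.1 hu.continuousOn₁
      simp only [dot_eq]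
      exact (((h₁ 0).mul (h₂ 0)).add ((h₁ 1).mul (h₂ 1))).add ((h₁ 2).mul (h₂ 2))
    refine (hdot.div (((hx 0).mul (hy 1)).sub ((hy 0).mul (hx 1))) hD).congr fun s hs => ?_
    have he := hu.isEigenframe s hs
    have e : (γ s).planarY m 1 • (Γ s).pos 0 - (γ s).planarY m 0 • (Γ s).pos 1 =
        (((γ s).planarX m 0 * (γ s).planarY m 1 - (γ s).planarY m 0 * (γ s).planarX m 1) * ε s) •
          u₁ s := by
      rw [(hr s hs).pos, (hr s hs).pos]
      module
    simp only [Pi.div_apply, Pi.sub_apply, Pi.mul_apply]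
    rw [e, smul_dotProduct, he.unit₁, smul_eq_mul, mul_one, mul_div_cancel_left₀ _ (hD s hs)]
  rcases hJ'.isPreconnected.eq_one_or_eq_neg_one_of_sq_eq hcont (fun s hs => hε s hs) with h | h
  · exact ⟨1, one_pow 2, fun t ht => by simpa [h ht] using hr t ht⟩
  · exact ⟨-1, neg_one_sq, fun t ht => by simpa [h ht] using hr t ht⟩

/-- The moduli curve of a motion satisfies the reduced equations. -/
theorem IsThreeBodyMotion.coupled_equations (hm : ∀ i, 0 < m i) (hsum : ∑ i, m i = 1)
    (hJ : IsOpen J) (hJ' : J.OrdConnected) (h : IsThreeBodyMotion Γ J) {Ω : Vec}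
    (hΩ : ∀ t ∈ J, angularMomentum Γ t = Ω) (hn : ∀ t ∈ J, (Γ t).Nondegenerate)
    (hc : IsCoordCurve (fun t => (Γ t).moduli) γ J) (hu : IsMovingEigenframe Γ γ u₁ u₂ J)
    (hg : ∀ t, g t = frameCoords Ω (u₁ t) (u₂ t) (Γ t).normal) :
    ReducedNewton m γ g J ∧ EulerEquations γ g J ∧
      (∀ t ∈ J, ∀ i,
        kinTangential m γ g i t =
          1 / 2 * m i * (vel Γ i t ⬝ᵥ vel Γ i t - (vel Γ i t ⬝ᵥ (Γ t).normal) ^ 2) ∧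
        kinNormal m γ g i t = 1 / 2 * m i * (vel Γ i t ⬝ᵥ (Γ t).normal) ^ 2) := by
  have hφ : ∀ t ∈ J, Real.cos (γ t).φ ≠ 0 := fun t ht =>
    cos_ne_zero_of_nondegenerate (hc.isCoord t ht) (hn t ht)
  obtain ⟨ε, hε, hr⟩ := hu.exists_sign hm hsum hJ'
    (fun i t ht => (h.differentiable t ht i).continuousAt.continuousWithinAt) hc hφ
  have hg' : ∀ t, signChange ε g t = frameCoords Ω (ε • u₁ t) (ε • u₂ t) (Γ t).normal := by
    intro t
    simp [signChange, hg, frameCoords]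
  have hF := h.frameEquations (u₁ := fun t => ε • u₁ t) (u₂ := fun t => ε • u₂ t)
    (g := signChange ε g) hm hsum hJ hc hφ hr (fun t ht => by rw [hg', hΩ t ht])
  have hN := (h.reducedNewton hm hsum hJ hc hφ hr hF).signChange hε
  have hE := (hF.eulerEquations hJ (fun t ht => (hr t ht).frame)
    (fun t ht => by rw [hg', (hr t ht).normal])).signChange hε
  rw [signChange_signChange hε] at hN hE
  refine ⟨hN, hE, fun t ht i => ?_⟩
  have := kinetic_energies hm hsum hJ hc hφ hr hF ht i
  rwa [kinTangential_signChange, kinNormal_signChange hε] at this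

/-! ### Reconstruction of a motion from a solution of the reduced equations -/

/-- The standard triangle with coordinates `p`, placed along a given frame. -/
noncomputable def OrientedTriangle.standard (hm : ∀ i, 0 < m i) (hsum : ∑ i, m i = 1) (p : Coord)
    {u v : Vec} (h : IsFrame u v) : OrientedTriangle m where
  pos := fun i => p.planarX m i • u + p.planarY m i • v
  normal := u ⨯₃ v
  com := by
    simp only [smul_add, smul_smul, Finset.sum_add_distrib, ← Finset.sum_smul,
      p.sum_planarX hm hsum, p.sum_planarY hm hsum, zero_smul, add_zero]
  unit := h.unit_normal
  perp := fun i => by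
    rw [dotProduct_add, dotProduct_smul, dotProduct_smul, dotProduct_comm, IsFrame.dot_normal₁,
      dotProduct_comm, IsFrame.dot_normal₂, smul_zero, smul_zero, add_zero]

theorem OrientedTriangle.realizes_standard (hm : ∀ i, 0 < m i) (hsum : ∑ i, m i = 1) (p : Coord)
    {u v : Vec} (h : IsFrame u v) : (OrientedTriangle.standard hm hsum p h).Realizes p u v :=
  ⟨h, rfl, fun _ => rfl⟩

theorem OrientedTriangle.Realizes.eq {Γ Γ' : OrientedTriangle m} {p : Coord} {u v : Vec}
    (h : Γ.Realizes p u v) (h' : Γ'.Realizes p u v) : Γ = Γ' :=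
  OrientedTriangle.ext (funext fun i => by rw [h.pos, h'.pos]) (h.normal.symm.trans h'.normal)

theorem IsCoordCurve.hasDerivAt_frameRate (hc : IsCoordCurve δ γ J) (hJ : IsOpen J) (ht : t ∈ J) :
    DifferentiableAt ℝ (frameRate γ) t := by
  have h₁ := ((hc.contDiffOn_θ.deriv_of_isOpen hJ (m := 1) (by norm_num)).hasDerivAt_deriv
    one_ne_zero hJ ht).differentiableAt
  have h₂ := (hc.contDiffOn_φ.hasDerivAt_deriv two_ne_zero hJ ht).differentiableAt.cos
  exact ((h₁.const_mul (1 / 2)).fun_mul h₂).fun_neg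

theorem EulerEquations.differentiableAt (h : EulerEquations γ g J) (ht : t ∈ J) (i : Fin 3) :
    DifferentiableAt ℝ (fun s => g s i) t := by
  revert i
  rw [forall_fin_three]
  exact ⟨(h.euler₁ t ht).differentiableAt, (h.euler₂ t ht).differentiableAt,
    (h.euler₃ t ht).differentiableAt⟩

theorem IsCoordCurve.differentiableAt_eigenvalue (hc : IsCoordCurve δ γ J) (hJ : IsOpen J)
    (ht : t ∈ J) (i : Fin 3) : DifferentiableAt ℝ (fun s => (γ s).eigenvalue i) t := by
  have h₁ := (hc.contDiffOn_ρ.hasDerivAt_deriv two_ne_zero hJ ht).differentiableAt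
  have h₂ := (hc.contDiffOn_φ.hasDerivAt_deriv two_ne_zero hJ ht).differentiableAt
  revert i
  simp only [forall_fin_three, Coord.eigenvalue, Matrix.cons_val_zero, Matrix.cons_val_one,
    Matrix.cons_val]
  refine ⟨?_, ?_, ?_⟩ <;> fun_prop

theorem differentiableAt_spin (hc : IsCoordCurve δ γ J) (hJ : IsOpen J) (hE : EulerEquations γ g J)
    (ht : t ∈ J) : DifferentiableAt ℝ (spin γ g) t := by
  have h₁ := (hc.contDiffOn_ρ.hasDerivAt_deriv two_ne_zero hJ ht).differentiableAt
  have h₂ := hE.differentiableAt ht 2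
  have h₃ := hc.hasDerivAt_frameRate hJ ht
  exact (h₂.fun_div (h₁.fun_pow 2) (pow_ne_zero 2 (hc.isCoord t ht).pos.ne')).fun_add h₃

theorem differentiableAt_frameVel (hc : IsCoordCurve δ γ J) (hJ : IsOpen J)
    (hφ : ∀ t ∈ J, Real.cos (γ t).φ ≠ 0) (hE : EulerEquations γ g J)
    (hF : FrameEquations γ g u₁ u₂ J) (ht : t ∈ J) (i : Fin 3) :
    DifferentiableAt ℝ (frameVel m γ g u₁ u₂ i) t := by
  have hx := (hc.hasDerivAt_planarX hJ ht i).differentiableAt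
  have hy := (hc.hasDerivAt_planarY hJ ht i).differentiableAt
  have hx' := (hc.hasDerivAt_planarXDot hJ ht i).differentiableAt
  have hy' := (hc.hasDerivAt_planarYDot hJ ht i).differentiableAt
  have hκ := differentiableAt_spin hc hJ hE ht
  have hl := fun i => ((γ t).eigenvalue_pos (hc.isCoord t ht).pos (hφ t ht) i).ne'
  have hg := fun i => (hE.differentiableAt ht i).fun_div (hc.differentiableAt_eigenvalue hJ ht i) (hl i)
  have h₁ := (hF t ht).1.differentiableAt
  have h₂ := (hF t ht).2.differentiableAt
  have h₃ := ((hF t ht).1.crossProduct (hF t ht).2).differentiableAt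
  exact (((hx'.fun_sub (hκ.fun_mul hy)).fun_smul h₁).fun_add
    ((hy'.fun_add (hκ.fun_mul hx)).fun_smul h₂)).fun_add
    ((((hg 0).fun_mul hy).fun_sub ((hg 1).fun_mul hx)).fun_smul h₃)

/-- The vector with coordinates `g` in a frame obeying the frame equations is constant if `g`
satisfies the Euler equations. -/
theorem FrameEquations.momentum_eq (hF : FrameEquations γ g u₁ u₂ J) (hJ : IsOpen J)
    (hJ' : J.OrdConnected) (hf : ∀ t, IsFrame (u₁ t) (u₂ t)) (hE : EulerEquations γ g J) {s : ℝ}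
    (hs : s ∈ J) (ht : t ∈ J) :
    g s 0 • u₁ s + g s 1 • u₂ s + g s 2 • (u₁ s ⨯₃ u₂ s) =
      g t 0 • u₁ t + g t 1 • u₂ t + g t 2 • (u₁ t ⨯₃ u₂ t) := by
  refine eq_of_hasDerivAt_zero hJ hJ'
    (f := fun s => g s 0 • u₁ s + g s 1 • u₂ s + g s 2 • (u₁ s ⨯₃ u₂ s)) (fun r hr => ?_) hs ht
  refine ((((hE.euler₁ r hr).fun_smul (hF r hr).1).fun_add
    ((hE.euler₂ r hr).fun_smul (hF r hr).2)).fun_add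
    ((hE.euler₃ r hr).fun_smul (hF.hasDerivAt_cross (hf r) hr))).congr_deriv ?_
  rw [show (γ r).eigenvalue 2 = (γ r).ρ ^ 2 from rfl, spin]
  module

theorem IsFrame.eq_frameCoords {u v : Vec} (h : IsFrame u v) (c : Fin 3 → ℝ) :
    c = frameCoords (c 0 • u + c 1 • v + c 2 • (u ⨯₃ v)) u v (u ⨯₃ v) := by
  obtain ⟨h₁, h₂, h₃⟩ := h.combination_eq_iff.1 (h.expand (c 0 • u + c 1 • v + c 2 • (u ⨯₃ v)))
  exact vec_ext h₁ h₂ h₃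

/-- The frame is obtained by integrating the frame equations with coefficients from `g`, and the
standard triangles are laid along it. The Euler equations keep the angular momentum equal to
$\Omega$, and the reduced Newton equations supply what is then missing from Newton's equations. -/
theorem exists_motion_of_realizes (hm : ∀ i, 0 < m i) (hsum : ∑ i, m i = 1)
    (hJ : IsOpen J) (hJ' : J.OrdConnected) {t₀ : ℝ} (ht₀ : t₀ ∈ J) {Ω : Vec}
    (hc : IsCoordCurve δ γ J) (hφ : ∀ t ∈ J, Real.cos (γ t).φ ≠ 0)
    (hN : ReducedNewton m γ g J) (hE : EulerEquations γ g J)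
    {Γ₀ : OrientedTriangle m} {v₁ v₂ : Vec} (hr₀ : Γ₀.Realizes (γ t₀) v₁ v₂)
    (hg₀ : g t₀ = frameCoords Ω v₁ v₂ Γ₀.normal) :
    ∃ (Γ : ℝ → OrientedTriangle m) (u₁ u₂ : ℝ → Vec), IsThreeBodyMotion Γ J ∧
      (∀ t ∈ J, angularMomentum Γ t = Ω) ∧ Γ t₀ = Γ₀ ∧
      (∀ t ∈ J, (Γ t).Realizes (γ t) (u₁ t) (u₂ t)) ∧ ContinuousOn u₁ J ∧ ContinuousOn u₂ J ∧
      u₁ t₀ = v₁ ∧ u₂ t₀ = v₂ ∧ ∀ t ∈ J, g t = frameCoords Ω (u₁ t) (u₂ t) (Γ t).normal := by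
  have hcont : ∀ {f : ℝ → ℝ}, (∀ t ∈ J, DifferentiableAt ℝ f t) → ContinuousOn f J :=
    fun hf t ht => (hf t ht).continuousAt.continuousWithinAt
  have hl := fun t ht i => ((γ t).eigenvalue_pos (hc.isCoord t ht).pos (hφ t ht) i).ne'
  have hquot : ∀ i, ContinuousOn (fun s => g s i / (γ s).eigenvalue i) J := fun i =>
    hcont fun t ht => (hE.differentiableAt ht i).fun_div (hc.differentiableAt_eigenvalue hJ ht i)
      (hl t ht i)
  obtain ⟨u₁, u₂, hu₁, hu₂, hf, hd₁, hd₂⟩ := exists_rotating_frame hJ hJ' ht₀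
    (hcont fun t ht => differentiableAt_spin hc hJ hE ht) (hquot 0) (hquot 1) hr₀.frame
  have hF : FrameEquations γ g u₁ u₂ J := fun t ht => ⟨hd₁ t ht, hd₂ t ht⟩
  set Γ : ℝ → OrientedTriangle m := fun t => OrientedTriangle.standard hm hsum (γ t) (hf t) with hΓ
  have hr : ∀ t, (Γ t).Realizes (γ t) (u₁ t) (u₂ t) := fun t =>
    OrientedTriangle.realizes_standard hm hsum (γ t) (hf t)
  have hΩ₀ : Ω = g t₀ 0 • u₁ t₀ + g t₀ 1 • u₂ t₀ + g t₀ 2 • (u₁ t₀ ⨯₃ u₂ t₀) := by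
    rw [hg₀, ← hr₀.normal, hu₁, hu₂]
    exact hr₀.frame.expand Ω
  have hΩ : ∀ t ∈ J, g t 0 • u₁ t + g t 1 • u₂ t + g t 2 • (u₁ t ⨯₃ u₂ t) = Ω := by
    intro t ht
    rw [hΩ₀]
    exact hF.momentum_eq hJ hJ' hf hE ht ht₀
  have hp : ∀ t ∈ J, ∀ i, HasDerivAt (fun s => (Γ s).pos i) (frameVel m γ g u₁ u₂ i t) t :=
    fun t ht i => hasDerivAt_pos_of_frameEquations hJ hc (fun s _ => hr s) hF ht i
  have hvel : ∀ t ∈ J, ∀ i, vel Γ i t = frameVel m γ g u₁ u₂ i t := fun t ht i => (hp t ht i).deriv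
  have hacc : ∀ t ∈ J, ∀ i, HasDerivAt (vel Γ i) (deriv (vel Γ i) t) t := by
    intro t ht i
    refine ((differentiableAt_frameVel hc hJ hφ hE hF ht i).congr_of_eventuallyEq ?_).hasDerivAt
    filter_upwards [hJ.mem_nhds ht] with s hs using hvel s hs i
  have hL : ∀ t ∈ J, angularMomentum Γ t = Ω := by
    intro t ht
    have hρ := (hc.isCoord t ht).pos.ne'
    have := hc.sum_cross_velocity (κ := spin γ g) (a := fun s => g s 0 / (γ s).eigenvalue 0)
      (b := fun s => g s 1 / (γ s).eigenvalue 1) hm hsum hJ ht (hf t)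
    simp only [angularMomentum, hvel t ht, (hr t).pos]
    refine this.trans ?_
    rw [← hΩ t ht, div_mul_cancel₀ _ (hl t ht 0), div_mul_cancel₀ _ (hl t ht 1), spin,
      add_sub_cancel_right, mul_div_cancel₀ _ (pow_ne_zero 2 hρ)]
  have hcoord : ∀ t ∈ J, IsCoord (Γ t).moduli (γ t) := fun t ht =>
    (hr t).isCoord hm hsum (hc.isCoord t ht).pos
  have hA : ∀ t ∈ J, (Γ t).signedArea ≠ 0 := by
    intro t ht
    rw [(hr t).signedArea_eq hm hsum]
    exact hc.signedArea_ne_zero hm ht (hφ t ht)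
  -- Rigidity is applied to acceleration minus force. Differentiating the centre of mass relation
  -- twice gives the first hypothesis, differentiating the constant angular momentum gives the
  -- second, and comparing the two formulas for $\ddot I_i$ gives the third.
  have hnewton : ∀ t ∈ J, ∀ i, deriv (vel Γ i) t = (Γ t).force i := by
    intro t ht
    have hcom : ∀ s ∈ J, ∑ i, m i • vel Γ i s = 0 := by
      intro s hs
      have := HasDerivAt.fun_sum (u := Finset.univ)
        fun i _ => ((hp s hs i).differentiableAt.hasDerivAt).fun_const_smul (m i)
      simp only [fun s => (Γ s).com] at this
      exact this.unique (hasDerivAt_const s 0)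
    have h₁ : ∑ i, m i • deriv (vel Γ i) t = 0 := by
      have := HasDerivAt.fun_sum (u := Finset.univ)
        fun i _ => (hacc t ht i).fun_const_smul (m i)
      refine this.unique ((hasDerivAt_const t 0).congr_of_eventuallyEq ?_)
      filter_upwards [hJ.mem_nhds ht] with s hs using hcom s hs
    have h₂ : ∑ i, m i • ((Γ t).pos i ⨯₃ deriv (vel Γ i) t) = 0 := by
      have := HasDerivAt.fun_sum (u := Finset.univ) fun i _ =>
        (((hp t ht i).crossProduct (hacc t ht i)).fun_const_smul (m i))
      have e := this.unique ((hasDerivAt_const t Ω).congr_of_eventuallyEq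
        (by filter_upwards [hJ.mem_nhds ht] with s hs using hL s hs))
      simpa only [hvel t ht, cross_self, zero_add] using e
    have h₃ : ∀ i, (Γ t).pos i ⬝ᵥ deriv (vel Γ i) t = (Γ t).pos i ⬝ᵥ (Γ t).force i := by
      intro i
      have e₁ := deriv_inertiaDot_eq hm hsum hJ hc hφ (fun s _ => hr s) hF ht (hacc t ht i)
      rw [hN t ht i] at e₁
      have e₂ := OrientedTriangle.two_mul_pos_dot_force hm hsum (hcoord t ht) i
      have : 2 * m i ≠ 0 := mul_ne_zero two_ne_zero (hm i).ne'
      apply mul_left_cancel₀ this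
      linarith
    have := OrientedTriangle.eq_zero_of_sum_cross_eq_zero hm hsum (hA t ht)
      (d := fun i => deriv (vel Γ i) t - (Γ t).force i) ?_ ?_ ?_
    · exact fun i => sub_eq_zero.1 (congrFun this i)
    · simp only [smul_sub, Finset.sum_sub_distrib, h₁, (Γ t).sum_force, sub_zero]
    · simp only [map_sub, smul_sub, Finset.sum_sub_distrib, h₂, (Γ t).sum_cross_force, sub_zero]
    · intro i
      rw [dotProduct_sub, h₃, sub_self]
  refine ⟨Γ, u₁, u₂, ⟨?_, ?_, ?_, ?_⟩, hL, ?_, fun t _ => hr t, ?_, ?_, hu₁, hu₂, ?_⟩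
  · intro t ht
    exact ((hd₁ t ht).crossProduct (hd₂ t ht)).continuousAt.continuousWithinAt
  · exact fun t ht => (Γ t).injective_pos hm hsum (hA t ht)
  · exact fun t ht i => (hp t ht i).differentiableAt
  · intro t ht i
    have := hacc t ht i
    rw [hnewton t ht i] at this
    exact this
  · have h₀ := hr t₀
    rw [hu₁, hu₂] at h₀
    exact h₀.eq hr₀
  · exact fun t ht => (hd₁ t ht).continuousAt.continuousWithinAt
  · exact fun t ht => (hd₂ t ht).continuousAt.continuousWithinAt
  · intro t ht
    rw [← (hr t).normal, ← hΩ t ht]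
    exact (hf t).eq_frameCoords (g t)

theorem IsEigenframe.smul {Γ : OrientedTriangle m} {p : Coord} {u v : Vec}
    (h : IsEigenframe Γ p u v) {ε : ℝ} (hε : ε ^ 2 = 1) : IsEigenframe Γ p (ε • u) (ε • v) := by
  have hs : ∀ a : ℝ, ε * (ε * a) = a := fun a => by rw [← mul_assoc, ← sq, hε, one_mul]
  have hT : ∀ a b : Vec, Γ.inertiaTensor (ε • a) (ε • b) = Γ.inertiaTensor a b := fun a b => by
    simp only [OrientedTriangle.inertiaTensor, map_smul, LinearMap.smul_apply, smul_dotProduct,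
      dotProduct_smul, smul_eq_mul, hs]
  constructor
  · rw [smul_dotProduct, dotProduct_smul, smul_eq_mul, smul_eq_mul, hs, h.unit₁]
  · rw [smul_dotProduct, dotProduct_smul, smul_eq_mul, smul_eq_mul, hs, h.unit₂]
  · rw [smul_dotProduct, dotProduct_smul, smul_eq_mul, smul_eq_mul, hs, h.orthogonal]
  · rw [map_smul, map_smul, LinearMap.smul_apply, smul_smul, ← sq, hε, one_smul, h.positive]
  · rw [hT, h.eigen₁]
  · rw [hT, h.eigen₂]
  · rw [hT, h.eigen₁₂]
  · intro h₀
    rw [dotProduct_smul, dotProduct_smul, smul_eq_mul, smul_eq_mul, mul_assoc, mul_assoc, h.pole h₀]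

/-- Every solution of the reduced equations is the moduli curve of a motion. -/
theorem exists_motion (hm : ∀ i, 0 < m i) (hsum : ∑ i, m i = 1)
    (hJ : IsOpen J) (hJ' : J.OrdConnected) {t₀ : ℝ} (ht₀ : t₀ ∈ J) {Ω : Vec}
    (hc : IsCoordCurve δ γ J) (hφ : ∀ t ∈ J, Real.cos (γ t).φ ≠ 0)
    (hN : ReducedNewton m γ g J) (hE : EulerEquations γ g J)
    {Γ₀ : OrientedTriangle m} {v₁ v₂ : Vec} (hΓ₀ : Γ₀.moduli = δ t₀)
    (he : IsEigenframe Γ₀ (γ t₀) v₁ v₂) (hg₀ : g t₀ = frameCoords Ω v₁ v₂ Γ₀.normal) :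
    ∃ (Γ : ℝ → OrientedTriangle m) (u₁ u₂ : ℝ → Vec), IsThreeBodyMotion Γ J ∧
      (∀ t ∈ J, angularMomentum Γ t = Ω) ∧ Γ t₀ = Γ₀ ∧ (∀ t ∈ J, (Γ t).moduli = δ t) ∧
      IsMovingEigenframe Γ γ u₁ u₂ J ∧ u₁ t₀ = v₁ ∧ u₂ t₀ = v₂ ∧
      ∀ t ∈ J, g t = frameCoords Ω (u₁ t) (u₂ t) (Γ t).normal := by
  have hI₀ : IsCoord Γ₀.moduli (γ t₀) := by rw [hΓ₀]; exact hc.isCoord t₀ ht₀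
  obtain ⟨ε, hε, hr₀⟩ := OrientedTriangle.exists_sign_realizes hm hsum hI₀ (hφ t₀ ht₀) he
  have hεε : ∀ w : Vec, ε • ε • w = w := fun w => by rw [smul_smul, ← sq, hε, one_smul]
  obtain ⟨Γ, u₁, u₂, hmot, hL, hΓ, hr, hc₁, hc₂, hu₁, hu₂, hg⟩ :=
    exists_motion_of_realizes (Ω := Ω) hm hsum hJ hJ' ht₀ hc hφ (hN.signChange hε) (hE.signChange hε)
      hr₀ (by simp [signChange, hg₀, frameCoords])
  have hcoord : ∀ t ∈ J, IsCoord (Γ t).moduli (γ t) := fun t ht =>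
    (hr t ht).isCoord hm hsum (hc.isCoord t ht).pos
  refine ⟨Γ, fun t => ε • u₁ t, fun t => ε • u₂ t, hmot, hL, hΓ, fun t ht => ?_,
    ⟨hc₁.const_smul ε, hc₂.const_smul ε, fun t ht => ?_⟩,
    by simp only [hu₁, hεε], by simp only [hu₂, hεε], fun t ht => ?_⟩
  · exact OrientedTriangle.moduli_eq_of_isCoord hm hsum (hcoord t ht) (hc.isCoord t ht) (hφ t ht)
  · exact ((hr t ht).isEigenframe hm hsum (hφ t ht)).smul hε
  · have h₁ := congrFun (signChange_signChange (g := g) hε) t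
    rw [← h₁, signChange, hg t ht]
    simp [frameCoords]

end

section

variable {m : Fin 3 → ℝ} {J : Set ℝ}

/-! ### Existence of spherical coordinates and eigenframes along a motion -/

theorem contDiffOn_two_of_hasDerivAt {E : Type*} [NormedAddCommGroup E] [NormedSpace ℝ E]
    {f f' : ℝ → E} (hJ : IsOpen J) (hf : ∀ t ∈ J, HasDerivAt f (f' t) t)
    (hf' : ContDiffOn ℝ 1 f' J) : ContDiffOn ℝ 2 f J := by
  rw [show (2 : WithTop ℕ∞) = 1 + 1 by norm_num, contDiffOn_succ_iff_deriv_of_isOpen hJ]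
  exact ⟨fun t ht => (hf t ht).differentiableAt.differentiableWithinAt, by simp,
    hf'.congr fun t ht => (hf t ht).deriv⟩

theorem contDiffOn_one_of_hasDerivAt {E : Type*} [NormedAddCommGroup E] [NormedSpace ℝ E]
    {f f' : ℝ → E} (hJ : IsOpen J) (hf : ∀ t ∈ J, HasDerivAt f (f' t) t)
    (hf' : ContinuousOn f' J) : ContDiffOn ℝ 1 f J := by
  rw [show (1 : WithTop ℕ∞) = 0 + 1 by norm_num, contDiffOn_succ_iff_deriv_of_isOpen hJ]
  exact ⟨fun t ht => (hf t ht).differentiableAt.differentiableWithinAt, by simp,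
    contDiffOn_zero.2 (hf'.congr fun t ht => (hf t ht).deriv)⟩

/-- A curve in the unit circle has an angular coordinate. -/
theorem exists_angle (hJ : IsOpen J) (hJ' : J.OrdConnected) {t₀ : ℝ} (ht₀ : t₀ ∈ J) {x y : ℝ → ℝ}
    (hx : ContDiffOn ℝ 2 x J) (hy : ContDiffOn ℝ 2 y J) (hxy : ∀ t ∈ J, x t ^ 2 + y t ^ 2 = 1) :
    ∃ θ : ℝ → ℝ, ContDiffOn ℝ 2 θ J ∧ ∀ t ∈ J, x t = Real.cos (θ t) ∧ y t = Real.sin (θ t) := by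
  have hx' : ContDiffOn ℝ 1 (deriv x) J := hx.deriv_of_isOpen hJ (by norm_num)
  have hy' : ContDiffOn ℝ 1 (deriv y) J := hy.deriv_of_isOpen hJ (by norm_num)
  have hω : ContDiffOn ℝ 1 (fun t => x t * deriv y t - y t * deriv x t) J :=
    ((hx.of_le (by norm_num)).mul hy').sub ((hy.of_le (by norm_num)).mul hx')
  have hdx := fun t (ht : t ∈ J) => hx.hasDerivAt_deriv two_ne_zero hJ ht
  have hdy := fun t (ht : t ∈ J) => hy.hasDerivAt_deriv two_ne_zero hJ ht
  -- The angle is an antiderivative of $x\dot y-y\dot x$, started at an argument of the initial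
  -- point; the field does not depend on the state, hence the Lipschitz constant 0.
  obtain ⟨θ, hθ₀, hθ⟩ := exists_hasDerivAt_of_lipschitz_bounded hJ hJ' ht₀
    (fun t _ => x t * deriv y t - y t * deriv x t) (fun _ => hω.continuousOn)
    (fun a b hab => by
      obtain ⟨C, hC⟩ := isCompact_Icc.exists_bound_of_continuousOn (hω.continuousOn.mono hab)
      exact ⟨0, C.toNNReal, fun t ht => ⟨LipschitzWith.const _, fun _ =>
        (hC t ht).trans (Real.le_coe_toNNReal C)⟩⟩)
    (Complex.arg ⟨x t₀, y t₀⟩)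
  have hnorm : ‖(⟨x t₀, y t₀⟩ : ℂ)‖ = 1 := by
    rw [Complex.norm_def, Complex.normSq_mk, ← sq, ← sq, hxy t₀ ht₀, Real.sqrt_one]
  have hne : (⟨x t₀, y t₀⟩ : ℂ) ≠ 0 := by rw [← norm_ne_zero_iff, hnorm]; exact one_ne_zero
  have hc₀ : Real.cos (θ t₀) = x t₀ := by rw [hθ₀, Complex.cos_arg hne, hnorm, div_one]
  have hs₀ : Real.sin (θ t₀) = y t₀ := by rw [hθ₀, Complex.sin_arg, hnorm, div_one]
  refine ⟨θ, contDiffOn_two_of_hasDerivAt hJ hθ hω, fun t ht => ?_⟩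
  have hdot : ∀ s ∈ J, x s * deriv x s + y s * deriv y s = 0 := by
    intro s hs
    have h₁ := ((hdx s hs).fun_pow 2).fun_add ((hdy s hs).fun_pow 2)
    have h₂ : HasDerivAt (fun s => x s ^ 2 + y s ^ 2) 0 s :=
      (hasDerivAt_const s (1 : ℝ)).congr_of_eventuallyEq
        (eventuallyEq_of_mem (hJ.mem_nhds hs) hxy)
    have := h₁.unique h₂
    push_cast at this
    linarith
  have key : ∀ s ∈ J, deriv x s = -(y s * (x s * deriv y s - y s * deriv x s)) ∧
      deriv y s = x s * (x s * deriv y s - y s * deriv x s) := by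
    intro s hs
    constructor
    · linear_combination x s * hdot s hs - deriv x s * hxy s hs
    · linear_combination y s * hdot s hs - deriv y s * hxy s hs
  -- The inner product and the determinant of $(x,y)$ and $(\cos\theta,\sin\theta)$ are both
  -- constant, so the two unit vectors stay equal.
  have h₁ := eq_of_hasDerivAt_zero hJ hJ'
    (f := fun s => x s * Real.cos (θ s) + y s * Real.sin (θ s)) (fun s hs =>
      (((hdx s hs).fun_mul (hθ s hs).cos).fun_add ((hdy s hs).fun_mul (hθ s hs).sin)).congr_deriv
        (by linear_combination Real.cos (θ s) * (key s hs).1 + Real.sin (θ s) * (key s hs).2))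
    ht ht₀
  have h₂ := eq_of_hasDerivAt_zero hJ hJ'
    (f := fun s => y s * Real.cos (θ s) - x s * Real.sin (θ s)) (fun s hs =>
      (((hdy s hs).fun_mul (hθ s hs).cos).fun_sub ((hdx s hs).fun_mul (hθ s hs).sin)).congr_deriv
        (by linear_combination Real.cos (θ s) * (key s hs).2 - Real.sin (θ s) * (key s hs).1))
    ht ht₀
  have h₃ := Real.sin_sq_add_cos_sq (θ t)
  have h₄ := hxy t₀ ht₀
  simp only [hc₀, hs₀] at h₁ h₂
  constructor
  · linear_combination Real.cos (θ t) * (h₁ + h₄) - Real.sin (θ t) * h₂ - x t * h₃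
  · linear_combination Real.sin (θ t) * (h₁ + h₄) + Real.cos (θ t) * h₂ - y t * h₃

/-- Newton's field is continuous away from collisions, so the phase curve is $C^1$ and the positions
gain one more derivative. -/
theorem IsThreeBodyMotion.contDiffOn_pos {Γ : ℝ → OrientedTriangle m} (hJ : IsOpen J)
    (h : IsThreeBodyMotion Γ J) (i : Fin 3) : ContDiffOn ℝ 2 (fun t => (Γ t).pos i) J := by
  have h₁ : ContDiffOn ℝ 1 (phaseCurve Γ) J :=
    contDiffOn_one_of_hasDerivAt hJ (fun t ht => h.hasDerivAt_phaseCurve ht) fun t ht =>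
      ((contDiffAt_newtonField (h.noncollision t ht)).continuousAt.comp
        (f := phaseCurve Γ) (h.hasDerivAt_phaseCurve ht).continuousAt).continuousWithinAt
  exact contDiffOn_two_of_hasDerivAt hJ (fun t ht => h.hasDerivAt_pos ht i)
    (contDiffOn_pi.1 (contDiff_snd.comp_contDiffOn h₁) i)

/-! ### Jacobi vectors and Cartesian coordinates on the moduli space -/

namespace OrientedTriangle

/-- First Jacobi vector. -/
noncomputable def jacobi₁ (Γ : OrientedTriangle m) : Vec := ∑ i, (m i * refX m i) • Γ.pos i

/-- Second Jacobi vector. -/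
noncomputable def jacobi₂ (Γ : OrientedTriangle m) : Vec := ∑ i, (m i * refY m i) • Γ.pos i

variable (Γ : OrientedTriangle m)

/-- The Jacobi vectors are the coefficients of the positions with respect to an orthonormal basis of
weights, the component along the masses being zero by the centre of mass; this is the inverse
expansion. -/
theorem pos_eq_jacobi (hm : ∀ i, 0 < m i) (hsum : ∑ i, m i = 1) (i : Fin 3) :
    Γ.pos i = refX m i • Γ.jacobi₁ + refY m i • Γ.jacobi₂ := by
  obtain ⟨r₁, r₂, r₃, r₄, r₅⟩ := ref_relations hm hsum
  have hc := sum_three_smul_eq_zero Γ.com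
  have c₀ := ref_cross hm hsum 0
  have c₁ := ref_cross hm hsum 1
  have c₂ := ref_cross hm hsum 2
  have hs : 0 < √(m 0 * m 1 * m 2) := Real.sqrt_pos.2 (mul_pos (mul_pos (hm 0) (hm 1)) (hm 2))
  have m₀ := hm 0
  have m₁ := hm 1
  have m₂ := hm 2
  simp only [Fin.isValue, Fin.reduceAdd, zero_add, Fin.sum_univ_three] at r₁ r₂ r₃ r₄ r₅ hsum c₀ c₁ c₂
  generalize √(m 0 * m 1 * m 2) = κ at *
  rw [eq_div_iff hs.ne'] at c₀ c₁ c₂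
  rw [← sub_eq_zero]
  ext k
  have hk := hc k
  -- The residual `e` is orthogonal, in the mass-weighted product, to the constants and to both
  -- reference coordinates. Eliminating with the known minors makes it constant, and then zero.
  obtain ⟨e, he⟩ : ∃ e : Fin 3 → ℝ, ∀ i,
      e i = Γ.pos i k - (refX m i * Γ.jacobi₁ k + refY m i * Γ.jacobi₂ k) := ⟨_, fun _ => rfl⟩
  have j₁ : Γ.jacobi₁ k = m 0 * refX m 0 * Γ.pos 0 k + m 1 * refX m 1 * Γ.pos 1 k +
      m 2 * refX m 2 * Γ.pos 2 k := by simp [jacobi₁, Fin.sum_univ_three]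
  have j₂ : Γ.jacobi₂ k = m 0 * refY m 0 * Γ.pos 0 k + m 1 * refY m 1 * Γ.pos 1 k +
      m 2 * refY m 2 * Γ.pos 2 k := by simp [jacobi₂, Fin.sum_univ_three]
  have h₀ : m 0 * e 0 + m 1 * e 1 + m 2 * e 2 = 0 := by
    rw [he, he, he]; linear_combination hk - Γ.jacobi₁ k * r₁ - Γ.jacobi₂ k * r₂
  have hX : m 0 * refX m 0 * e 0 + m 1 * refX m 1 * e 1 + m 2 * refX m 2 * e 2 = 0 := by
    rw [he, he, he]; linear_combination -j₁ - Γ.jacobi₁ k * r₃ - Γ.jacobi₂ k * r₅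
  have hY : m 0 * refY m 0 * e 0 + m 1 * refY m 1 * e 1 + m 2 * refY m 2 * e 2 = 0 := by
    rw [he, he, he]; linear_combination -j₂ - Γ.jacobi₁ k * r₅ - Γ.jacobi₂ k * r₄
  have e₀ : e 0 = e 2 := by
    have : m 0 * m 2 * m 2 * (e 0 - e 2) = 0 := by
      linear_combination m 2 * κ * (refY m 1 * hX - refX m 1 * hY) - m 2 * m 0 * e 0 * c₀ +
        m 2 * m 2 * e 2 * c₁
    have h' : m 0 * m 2 * m 2 ≠ 0 := by positivity
    exact sub_eq_zero.1 ((mul_eq_zero.1 this).resolve_left h')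
  have e₁ : e 1 = e 2 := by
    have : m 1 * m 2 * (e 1 - e 2) = 0 := by
      linear_combination κ * (refX m 0 * hY - refY m 0 * hX) - m 1 * e 1 * c₀ + m 2 * e 2 * c₂
    have h' : m 1 * m 2 ≠ 0 := by positivity
    exact sub_eq_zero.1 ((mul_eq_zero.1 this).resolve_left h')
  have e₂ : e 2 = 0 := by
    rw [e₀, e₁] at h₀
    linear_combination h₀ - e 2 * hsum
  have : e i = 0 := by
    revert i
    rw [forall_fin_three]
    exact ⟨e₀.trans e₂, e₁.trans e₂, e₂⟩
  simpa [he] using this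

/-- First equatorial coordinate of the shape. -/
noncomputable def shapeX : ℝ := Γ.jacobi₁ ⬝ᵥ Γ.jacobi₁ - Γ.jacobi₂ ⬝ᵥ Γ.jacobi₂

/-- Second equatorial coordinate of the shape. -/
noncomputable def shapeY : ℝ := -(2 * (Γ.jacobi₁ ⬝ᵥ Γ.jacobi₂))

/-- Total moment of inertia. -/
noncomputable def size : ℝ := Γ.jacobi₁ ⬝ᵥ Γ.jacobi₁ + Γ.jacobi₂ ⬝ᵥ Γ.jacobi₂

theorem sum_inertia_eq_size (hm : ∀ i, 0 < m i) (hsum : ∑ i, m i = 1) :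
    ∑ i, Γ.inertia i = Γ.size := by
  obtain ⟨-, -, h₁, h₂, h₃⟩ := ref_relations hm hsum
  have h := Γ.pos_eq_jacobi hm hsum
  simp only [inertia, h, size, dotProduct_add, add_dotProduct, smul_dotProduct, dotProduct_smul,
    smul_eq_mul, dotProduct_comm Γ.jacobi₂ Γ.jacobi₁, Fin.sum_univ_three] at *
  linear_combination (Γ.jacobi₁ ⬝ᵥ Γ.jacobi₁) * h₁ + (Γ.jacobi₂ ⬝ᵥ Γ.jacobi₂) * h₂ +
    2 * (Γ.jacobi₁ ⬝ᵥ Γ.jacobi₂) * h₃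

/-- In polar form $\mathbf a_i$ combines the Jacobi vectors with the cosine and minus the sine of
half a longitude; double-angle formulas make its square linear in the shape coordinates. -/
theorem inertia_eq_shape (hm : ∀ i, 0 < m i) (hsum : ∑ i, m i = 1) (i : Fin 3) :
    Γ.inertia i = (1 - m i) / 2 * (Γ.size + Γ.shapeX * Real.cos (collisionLongitude m i) +
      Γ.shapeY * Real.sin (collisionLongitude m i)) := by
  have h₁ := refRadius_sq hm hsum i
  rw [eq_div_iff (hm i).ne'] at h₁
  rw [inertia, Γ.pos_eq_jacobi hm hsum, (ref_polar hm hsum i).1, (ref_polar hm hsum i).2, ← h₁,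
    show collisionLongitude m i = 2 * (collisionLongitude m i / 2) by ring, Real.cos_two_mul,
    Real.sin_two_mul, show 2 * (collisionLongitude m i / 2) / 2 = collisionLongitude m i / 2 by ring]
  have h₂ := Real.sin_sq_add_cos_sq (collisionLongitude m i / 2)
  simp only [size, shapeX, shapeY, dotProduct_add, add_dotProduct, smul_dotProduct,
    dotProduct_smul, smul_eq_mul, dotProduct_comm Γ.jacobi₂ Γ.jacobi₁]
  linear_combination m i * refRadius m i ^ 2 * (Γ.jacobi₂ ⬝ᵥ Γ.jacobi₂) * h₂

theorem cross_jacobi (hm : ∀ i, 0 < m i) (hsum : ∑ i, m i = 1) :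
    Γ.jacobi₁ ⨯₃ Γ.jacobi₂ = (2 * √(m 0 * m 1 * m 2) * Γ.signedArea) • Γ.normal := by
  have h := Γ.cross_pos hm hsum 0
  have hr := ref_cross hm hsum 0
  have hs : 0 < √(m 0 * m 1 * m 2) := Real.sqrt_pos.2 (mul_pos (mul_pos (hm 0) (hm 1)) (hm 2))
  have h2 := hm 2
  simp only [Fin.isValue, zero_add] at h hr
  have e : Γ.pos 0 ⨯₃ Γ.pos 1 =
      (m 2 / √(m 0 * m 1 * m 2)) • (Γ.jacobi₁ ⨯₃ Γ.jacobi₂) := by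
    rw [Γ.pos_eq_jacobi hm hsum 0, Γ.pos_eq_jacobi hm hsum 1, ← hr]
    simp only [map_add, map_smul, LinearMap.add_apply, LinearMap.smul_apply, cross_self,
      ← cross_anticomm Γ.jacobi₁ Γ.jacobi₂]
    module
  have hne : m 2 / √(m 0 * m 1 * m 2) ≠ 0 := (div_pos h2 hs).ne'
  apply smul_right_injective _ hne
  simp only
  rw [← e, h, smul_smul]
  generalize √(m 0 * m 1 * m 2) = κ at *
  congr 1
  field_simp

/-- This is Lagrange's identity for the cross product of the Jacobi vectors: `shapeX`, `shapeY` and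
the scaled area are the Cartesian coordinates of a point on the sphere of radius $I$. -/
theorem shape_sq (hm : ∀ i, 0 < m i) (hsum : ∑ i, m i = 1) :
    Γ.shapeX ^ 2 + Γ.shapeY ^ 2 + (4 * √(m 0 * m 1 * m 2) * Γ.signedArea) ^ 2 = Γ.size ^ 2 := by
  have h := cross_dot_cross Γ.jacobi₁ Γ.jacobi₂ Γ.jacobi₁ Γ.jacobi₂
  rw [Γ.cross_jacobi hm hsum, smul_dotProduct, dotProduct_smul, Γ.unit,
    dotProduct_comm Γ.jacobi₂ Γ.jacobi₁] at h
  simp only [smul_eq_mul, mul_one] at h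
  simp only [shapeX, shapeY, size]
  linear_combination 4 * h

theorem shape_pos (hm : ∀ i, 0 < m i) (hsum : ∑ i, m i = 1) (h : ¬ Γ.moduli.IsPole) :
    0 < Γ.shapeX ^ 2 + Γ.shapeY ^ 2 := by
  by_contra hle
  have hx : Γ.shapeX = 0 := by nlinarith [sq_nonneg Γ.shapeX, sq_nonneg Γ.shapeY]
  have hy : Γ.shapeY = 0 := by nlinarith [sq_nonneg Γ.shapeX, sq_nonneg Γ.shapeY]
  refine h fun i => ?_
  change Γ.inertia i = (1 - m i) / 2 * ∑ j, Γ.inertia j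
  rw [Γ.sum_inertia_eq_size hm hsum, Γ.inertia_eq_shape hm hsum, hx, hy]
  ring

/-- The spherical coordinates of a triangle in terms of its Jacobi vectors. -/
theorem isCoord_of_shape (hm : ∀ i, 0 < m i) (hsum : ∑ i, m i = 1) {p : Coord} (hρ : 0 < p.ρ)
    (hsize : Γ.size = p.ρ ^ 2) (hφ : 4 * √(m 0 * m 1 * m 2) * Γ.signedArea = p.ρ ^ 2 * Real.cos p.φ)
    (hX : Γ.shapeX = p.ρ ^ 2 * Real.sin p.φ * Real.cos p.θ)
    (hY : Γ.shapeY = p.ρ ^ 2 * Real.sin p.φ * Real.sin p.θ) : IsCoord Γ.moduli p := by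
  refine ⟨hρ, fun i => ?_, ?_⟩
  · change Γ.inertia i = _
    rw [Γ.inertia_eq_shape hm hsum, hsize, hX, hY, Coord.inertia, Coord.relLongitude, Real.cos_sub]
    ring
  · change Γ.signedArea = _
    have hs : 0 < √(m 0 * m 1 * m 2) := Real.sqrt_pos.2 (mul_pos (mul_pos (hm 0) (hm 1)) (hm 2))
    rw [Coord.signedArea, ← hφ, mul_div_cancel_left₀ _ (by positivity)]

end OrientedTriangle

theorem contDiff_dotProduct : ContDiff ℝ 2 (fun z : Vec × Vec => z.1 ⬝ᵥ z.2) := by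
  simp only [dot_eq]
  fun_prop

section Motion

variable {Γ : ℝ → OrientedTriangle m}

/-- The signed area is as smooth as the positions, even if the normal is only continuous. -/
theorem contDiffOn_signedArea (hJ' : J.OrdConnected)
    (hpos : ∀ i, ContDiffOn ℝ 2 (fun t => (Γ t).pos i) J)
    (hnormal : ContinuousOn (fun t => (Γ t).normal) J) (hA : ∀ t ∈ J, (Γ t).signedArea ≠ 0) :
    ContDiffOn ℝ 2 (fun t => (Γ t).signedArea) J := by
  have hN : ContDiffOn ℝ 2
      (fun t => ((Γ t).pos 1 - (Γ t).pos 0) ⨯₃ ((Γ t).pos 2 - (Γ t).pos 0)) J := by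
    have h₁ := fun i => contDiffOn_pi.1 (hpos i)
    rw [contDiffOn_pi]
    rw [forall_fin_three]
    simp only [cross_zero, cross_one, cross_two, Pi.sub_apply]
    refine ⟨?_, ?_, ?_⟩ <;>
    exact (((h₁ _ _).sub (h₁ _ _)).mul ((h₁ _ _).sub (h₁ _ _))).sub
      (((h₁ _ _).sub (h₁ _ _)).mul ((h₁ _ _).sub (h₁ _ _)))
  -- The squared area is a quarter of the squared length of a cross product of edges, in which the
  -- merely continuous normal no longer occurs. Continuity of the normal is used only to keep the
  -- sign of the root constant.
  have hsq : ContDiffOn ℝ 2 (fun t => (Γ t).signedArea ^ 2) J := by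
    refine ((contDiffOn_const (c := (1 / 4 : ℝ))).mul
      (contDiff_dotProduct.comp_contDiffOn (hN.prodMk hN))).congr fun t ht => ?_
    have h₀ : ∀ i j, (Γ t).normal ⬝ᵥ ((Γ t).pos i - (Γ t).pos j) = 0 := fun i j => by
      rw [dotProduct_sub, (Γ t).perp, (Γ t).perp, sub_zero]
    have := eq_smul_of_dot_eq_zero (Γ t).unit (h₀ 1 0) (h₀ 2 0)
    simp only [Function.comp_apply]
    conv_rhs => rw [this]
    rw [smul_dotProduct, dotProduct_smul, (Γ t).unit, OrientedTriangle.signedArea, smul_eq_mul,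
      smul_eq_mul]
    ring
  have hcont : ContinuousOn (fun t => (Γ t).signedArea) J := by
    have h₁ := continuousOn_pi.1 hN.continuousOn
    have h₂ := continuousOn_pi.1 hnormal
    simp only [OrientedTriangle.signedArea]
    refine continuousOn_const.mul ?_
    simp only [dot_eq]
    exact (((h₁ 0).mul (h₂ 0)).add ((h₁ 1).mul (h₂ 1))).add ((h₁ 2).mul (h₂ 2))
  have hroot : ContDiffOn ℝ 2 (fun t => √((Γ t).signedArea ^ 2)) J :=
    hsq.sqrt fun t ht => pow_ne_zero 2 (hA t ht)
  rcases hJ'.isPreconnected.eq_or_eq_neg_of_sq_eq hcont hroot.continuousOn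
    (fun t _ => by simp only [Pi.pow_apply, Real.sq_sqrt (sq_nonneg _)])
    (fun {t} ht => Real.sqrt_ne_zero'.2 (by have := hA t ht; positivity)) with h | h
  · exact hroot.congr fun t ht => h ht
  · exact hroot.neg.congr fun t ht => h ht

/-- Off the poles the equatorial part $(X,Y)$ of the Cartesian coordinates is nonzero, so its
normalization has a $C^2$ angle. There the ratio of the vertical coordinate to $I$ also lies
strictly between $-1$ and $1$, where `Real.arccos` is smooth. -/
theorem exists_isCoordCurve (hm : ∀ i, 0 < m i) (hsum : ∑ i, m i = 1) (hJ : IsOpen J)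
    (hJ' : J.OrdConnected) {t₀ : ℝ} (ht₀ : t₀ ∈ J)
    (hpos : ∀ i, ContDiffOn ℝ 2 (fun t => (Γ t).pos i) J)
    (hnormal : ContinuousOn (fun t => (Γ t).normal) J) (hA : ∀ t ∈ J, (Γ t).signedArea ≠ 0)
    (hpole : ∀ t ∈ J, ¬ (Γ t).moduli.IsPole) :
    ∃ γ : ℝ → Coord, IsCoordCurve (fun t => (Γ t).moduli) γ J := by
  have hj₁ : ContDiffOn ℝ 2 (fun t => (Γ t).jacobi₁) J :=
    ContDiffOn.sum fun i _ => (hpos i).const_smul (m i * _)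
  have hj₂ : ContDiffOn ℝ 2 (fun t => (Γ t).jacobi₂) J :=
    ContDiffOn.sum fun i _ => (hpos i).const_smul (m i * _)
  have h₁₁ := contDiff_dotProduct.comp_contDiffOn (hj₁.prodMk hj₁)
  have h₁₂ := contDiff_dotProduct.comp_contDiffOn (hj₁.prodMk hj₂)
  have h₂₂ := contDiff_dotProduct.comp_contDiffOn (hj₂.prodMk hj₂)
  have hX : ContDiffOn ℝ 2 (fun t => (Γ t).shapeX) J := h₁₁.sub h₂₂
  have hY : ContDiffOn ℝ 2 (fun t => (Γ t).shapeY) J := (contDiffOn_const.mul h₁₂).neg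
  have hS : ContDiffOn ℝ 2 (fun t => (Γ t).size) J := h₁₁.add h₂₂
  have hE := contDiffOn_signedArea hJ' hpos hnormal hA
  have hXY := fun t (ht : t ∈ J) => (Γ t).shape_pos hm hsum (hpole t ht)
  have hsq := fun t => (Γ t).shape_sq hm hsum
  have hS₀ : ∀ t ∈ J, 0 < (Γ t).size := by
    intro t ht
    refine lt_of_le_of_ne ?_ fun h => ?_
    · have := dotProduct_star_self_nonneg (Γ t).jacobi₁
      have := dotProduct_star_self_nonneg (Γ t).jacobi₂
      simp only [star_trivial] at *
      simp only [OrientedTriangle.size]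
      positivity
    · have := hsq t
      rw [← h] at this
      nlinarith [hXY t ht, sq_nonneg (4 * √(m 0 * m 1 * m 2) * (Γ t).signedArea)]
  have hr : ContDiffOn ℝ 2 (fun t => √((Γ t).shapeX ^ 2 + (Γ t).shapeY ^ 2)) J :=
    ((hX.pow 2).add (hY.pow 2)).sqrt fun t ht => (hXY t ht).ne'
  have hr₀ : ∀ t ∈ J, 0 < √((Γ t).shapeX ^ 2 + (Γ t).shapeY ^ 2) := fun t ht =>
    Real.sqrt_pos.2 (hXY t ht)
  obtain ⟨θ, hθ, hθ'⟩ := exists_angle hJ hJ' ht₀ (hX.div hr fun t ht => (hr₀ t ht).ne')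
    (hY.div hr fun t ht => (hr₀ t ht).ne') (fun t ht => by
      simp only [Pi.div_apply, div_pow, Real.sq_sqrt (hXY t ht).le]
      rw [← add_div, div_self (hXY t ht).ne'])
  have hlt : ∀ t ∈ J, (4 * √(m 0 * m 1 * m 2) * (Γ t).signedArea / (Γ t).size) ^ 2 < 1 := by
    intro t ht
    rw [div_pow, div_lt_one (pow_pos (hS₀ t ht) 2)]
    linarith [hsq t, hXY t ht]
  have hlt' := fun t ht => abs_lt.1 ((sq_lt_one_iff_abs_lt_one _).1 (hlt t ht))
  have hc : ContDiffOn ℝ 2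
      (fun t => 4 * √(m 0 * m 1 * m 2) * (Γ t).signedArea / (Γ t).size) J :=
    (contDiffOn_const.mul hE).div hS fun t ht => (hS₀ t ht).ne'
  refine ⟨fun t => ⟨√(Γ t).size,
    Real.arccos (4 * √(m 0 * m 1 * m 2) * (Γ t).signedArea / (Γ t).size), θ t⟩,
    hS.sqrt fun t ht => (hS₀ t ht).ne', fun t ht => ?_, hθ, fun t ht => ?_⟩
  · exact ContDiffAt.comp_contDiffWithinAt (g := Real.arccos) t
      (Real.contDiffAt_arccos (hlt' t ht).1.ne' (hlt' t ht).2.ne) (hc t ht)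
  · have hS' := Real.sq_sqrt (hS₀ t ht).le
    have hsin : (Γ t).size * Real.sin (Real.arccos
        (4 * √(m 0 * m 1 * m 2) * (Γ t).signedArea / (Γ t).size)) =
        √((Γ t).shapeX ^ 2 + (Γ t).shapeY ^ 2) := by
      rw [Real.sin_arccos, ← Real.sqrt_sq (hS₀ t ht).le, ← Real.sqrt_mul (sq_nonneg _),
        Real.sqrt_sq (hS₀ t ht).le, mul_sub, mul_one, div_pow,
        mul_div_cancel₀ _ (pow_ne_zero 2 (hS₀ t ht).ne')]
      congr 1
      linarith [hsq t]
    obtain ⟨hx, hy⟩ := hθ' t ht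
    rw [Pi.div_apply, div_eq_iff (hr₀ t ht).ne'] at hx hy
    refine (Γ t).isCoord_of_shape hm hsum (Real.sqrt_pos.2 (hS₀ t ht)) hS'.symm ?_ ?_ ?_
    · dsimp only
      rw [hS', Real.cos_arccos (hlt' t ht).1.le (hlt' t ht).2.le,
        mul_div_cancel₀ _ (hS₀ t ht).ne']
    · dsimp only
      rw [hS', hsin, mul_comm, ← hx]
    · dsimp only
      rw [hS', hsin, mul_comm, ← hy]

/-- Spherical coordinates of nondegenerate triangles determine continuous eigenframes. -/
theorem IsCoordCurve.exists_isMovingEigenframe (hm : ∀ i, 0 < m i) (hsum : ∑ i, m i = 1)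
    {γ : ℝ → Coord} (hc : IsCoordCurve (fun t => (Γ t).moduli) γ J)
    (hpos : ∀ i, ContinuousOn (fun t => (Γ t).pos i) J) (hφ : ∀ t ∈ J, Real.cos (γ t).φ ≠ 0) :
    ∃ u₁ u₂ : ℝ → Vec, IsMovingEigenframe Γ γ u₁ u₂ J := by
  choose! u₁ u₂ hr using fun t ht =>
    OrientedTriangle.exists_realizes hm hsum (hc.isCoord t ht) (hφ t ht)
  have hx := fun i => (hc.contDiffOn_planarX i).continuousOn
  have hy := fun i => (hc.contDiffOn_planarY i).continuousOn
  have hD := hc.planar_det_ne_zero hm hsum hφ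
  have hDc := (((hx 0).mul (hy 1)).sub ((hy 0).mul (hx 1))).inv₀ hD
  refine ⟨u₁, u₂, (hDc.smul (((hy 1).smul (hpos 0)).sub ((hy 0).smul (hpos 1)))).congr ?_,
    (hDc.smul (((hx 0).smul (hpos 1)).sub ((hx 1).smul (hpos 0)))).congr ?_,
    fun t ht => (hr t ht).isEigenframe hm hsum (hφ t ht)⟩
  · intro t ht
    simp only [Pi.smul_apply', Pi.inv_apply, Pi.sub_apply, Pi.mul_apply]
    rw [eq_inv_smul_iff₀ (hD t ht), (hr t ht).pos, (hr t ht).pos]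
    module
  · intro t ht
    simp only [Pi.smul_apply', Pi.inv_apply, Pi.sub_apply, Pi.mul_apply]
    rw [eq_inv_smul_iff₀ (hD t ht), (hr t ht).pos, (hr t ht).pos]
    module

/-- A motion which avoids the collinear shapes and the poles has coordinates and an eigenframe. -/
theorem IsThreeBodyMotion.exists_coord_frame (hm : ∀ i, 0 < m i) (hsum : ∑ i, m i = 1)
    (hJ : IsOpen J) (hJ' : J.OrdConnected) {t₀ : ℝ} (ht₀ : t₀ ∈ J) (h : IsThreeBodyMotion Γ J)
    (hn : ∀ t ∈ J, (Γ t).Nondegenerate) (hpole : ∀ t ∈ J, ¬ (Γ t).moduli.IsPole) :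
    ∃ (γ : ℝ → Coord) (u₁ u₂ : ℝ → Vec), IsCoordCurve (fun t => (Γ t).moduli) γ J ∧
      IsMovingEigenframe Γ γ u₁ u₂ J := by
  obtain ⟨γ, hc⟩ := exists_isCoordCurve hm hsum hJ hJ' ht₀ (h.contDiffOn_pos hJ)
    h.normal_continuousOn (fun t ht => (Γ t).signedArea_ne_zero (hn t ht)) hpole
  obtain ⟨u₁, u₂, hu⟩ := hc.exists_isMovingEigenframe hm hsum
    (fun i => (h.contDiffOn_pos hJ i).continuousOn)
    fun t ht => cos_ne_zero_of_nondegenerate (hc.isCoord t ht) (hn t ht)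
  exact ⟨γ, u₁, u₂, hc, hu⟩

end Motion

end

end ThreeBody

theorem theoremE2 (m : Fin 3 → ℝ) (hm : ∀ i, 0 < m i) (hsum : ∑ i, m i = 1)
    (J : Set ℝ) (hJopen : IsOpen J) (hJconn : J.OrdConnected) (t₀ : ℝ) (ht₀ : t₀ ∈ J)
    (Ω : ThreeBody.Vec) :
    -- a motion is determined by moduli curve, initial position and angular momentum
    (∀ Γ Γ' : ℝ → ThreeBody.OrientedTriangle m,
      ThreeBody.IsThreeBodyMotion Γ J → ThreeBody.IsThreeBodyMotion Γ' J →
      ThreeBody.angularMomentum Γ t₀ = Ω → ThreeBody.angularMomentum Γ' t₀ = Ω →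
      (∀ t ∈ J, (Γ t).moduli = (Γ' t).moduli) →
      Γ t₀ = Γ' t₀ → (Γ t₀).Nondegenerate →
      ∀ t ∈ J, (Γ t).pos = (Γ' t).pos ∧ ((Γ t).Nondegenerate → Γ t = Γ' t)) ∧
    -- moduli curves of motions solve the coupled reduced equations
    (∀ Γ : ℝ → ThreeBody.OrientedTriangle m,
      ThreeBody.IsThreeBodyMotion Γ J → ThreeBody.angularMomentum Γ t₀ = Ω →
      (∀ t ∈ J, (Γ t).Nondegenerate) →
      (∀ (γ : ℝ → ThreeBody.Coord) (u₁ u₂ : ℝ → ThreeBody.Vec) (g : ℝ → Fin 3 → ℝ),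
        ThreeBody.IsCoordCurve (fun t => (Γ t).moduli) γ J →
        ThreeBody.IsMovingEigenframe Γ γ u₁ u₂ J →
        (∀ t, g t = ThreeBody.frameCoords Ω (u₁ t) (u₂ t) (Γ t).normal) →
        ThreeBody.ReducedNewton m γ g J ∧ ThreeBody.EulerEquations γ g J ∧
        (∀ t ∈ J, ∀ i,
          ThreeBody.kinTangential m γ g i t =
            1 / 2 * m i * (ThreeBody.vel Γ i t ⬝ᵥ ThreeBody.vel Γ i t
              - (ThreeBody.vel Γ i t ⬝ᵥ (Γ t).normal) ^ 2) ∧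
          ThreeBody.kinNormal m γ g i t =
            1 / 2 * m i * (ThreeBody.vel Γ i t ⬝ᵥ (Γ t).normal) ^ 2)) ∧
      ((∀ t ∈ J, ¬ (Γ t).moduli.IsPole) →
        ∃ (γ : ℝ → ThreeBody.Coord) (u₁ u₂ : ℝ → ThreeBody.Vec),
          ThreeBody.IsCoordCurve (fun t => (Γ t).moduli) γ J ∧
          ThreeBody.IsMovingEigenframe Γ γ u₁ u₂ J)) ∧
    -- solutions of the coupled reduced equations are moduli curves of motions
    (∀ (δ : ℝ → ThreeBody.ModuliSpace m) (γ : ℝ → ThreeBody.Coord) (g : ℝ → Fin 3 → ℝ)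
        (Γ₀ : ThreeBody.OrientedTriangle m) (v₁ v₂ : ThreeBody.Vec),
      ThreeBody.IsCoordCurve δ γ J → (∀ t ∈ J, Real.cos (γ t).φ ≠ 0) →
      ThreeBody.ReducedNewton m γ g J → ThreeBody.EulerEquations γ g J →
      Γ₀.moduli = δ t₀ → ThreeBody.IsEigenframe Γ₀ (γ t₀) v₁ v₂ →
      g t₀ = ThreeBody.frameCoords Ω v₁ v₂ Γ₀.normal →
      ∃ (Γ : ℝ → ThreeBody.OrientedTriangle m) (u₁ u₂ : ℝ → ThreeBody.Vec),
        ThreeBody.IsThreeBodyMotion Γ J ∧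
        (∀ t ∈ J, ThreeBody.angularMomentum Γ t = Ω) ∧
        Γ t₀ = Γ₀ ∧ (∀ t ∈ J, (Γ t).moduli = δ t) ∧
        ThreeBody.IsMovingEigenframe Γ γ u₁ u₂ J ∧ u₁ t₀ = v₁ ∧ u₂ t₀ = v₂ ∧
        (∀ t ∈ J, g t = ThreeBody.frameCoords Ω (u₁ t) (u₂ t) (Γ t).normal)) := by
  refine ⟨fun Γ Γ' h h' hΩ hΩ' hmod h₀ hn t ht => ?_,
    fun Γ h hΩ hn => ⟨fun γ u₁ u₂ g hc hu hg => ?_, fun hpole => ?_⟩,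
    fun δ γ g Γ₀ v₁ v₂ hc hφ hN hE hΓ₀ he hg₀ => ?_⟩
  · exact h.determined hm hsum hJopen hJconn h' ht₀ (hΩ.trans hΩ'.symm) hmod h₀ hn ht
  · exact h.coupled_equations hm hsum hJopen hJconn
      -- The angular momentum is prescribed only at `t₀`; its conservation extends this to all of
      -- `J`.
      (fun t ht => (ThreeBody.angularMomentum_eq hJopen hJconn h ht ht₀).trans hΩ) hn hc hu hg
  · exact h.exists_coord_frame hm hsum hJopen hJconn ht₀ hn hpole
  · exact ThreeBody.exists_motion hm hsum hJopen hJconn ht₀ hc hφ hN hE hΓ₀ he hg₀
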